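/- For a permutation $\pi\in S_n$, let $p(\pi)$ denote its number of peaks, i.e. the number of positions $1<i<n$ with $\pi(i-1)<\pi(i)>\pi(i+1)$. Theorem. For each $s>0$ there exists a constant $C=C(s)>0$, depending only on $s$, such that the following is true. Let $n\ge 1$, let $\lambda=1^{n_1}2^{n_2}\cdots$ be a partition of $n$ (with $n_i$ parts of size $i$), let $\mathcal{C}_\lambda\subseteq S_n$ be the conjugacy class of all permutations of cycle type $\lambda$ (so that $n_1$ is the number of fixed points), and let $\pi$ be chosen uniformly at random from $\mathcal{C}_\lambda$. Put $\alpha_1=n_1/n$. Then \[ \mathbb{E}\left[e^{-s\,p(\pi)/\sqrt{n}}\right] =\exp\left\{-\frac{1-\alpha_1^3}{3}\,s\sqrt{n}+\left(\frac{1}{45}+\frac{\alpha_1^3}{18}-\frac{3\alpha_1^5}{10}+\frac{2\alpha_1^6}{9}\right)s^2+E_{\lambda,s}\right\}, \] where $|E_{\lambda,s}|\le C\,n^{-1/4}$. -/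

import Mathlib

/-- The number of peaks of a permutation `π` of `{0, …, n - 1}`: the number of positions `i` that
have both a predecessor `j = i - 1` and a successor `k = i + 1`, with `π j < π i > π k`. -/
def peaks {n : ℕ} (π : Equiv.Perm (Fin n)) : ℕ :=
  (Finset.univ.filter fun i : Fin n =>
    ∃ j k : Fin n, (j : ℕ) + 1 = i ∧ (i : ℕ) + 1 = k ∧ π j < π i ∧ π k < π i).card

/-- The conjugacy class of all permutations of cycle type `lam`; `Equiv.Perm.partition` records
all the cycle lengths, with a part `1` for every fixed point. -/
def cycleClass {n : ℕ} (lam : n.Partition) : Finset (Equiv.Perm (Fin n)) :=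
  Finset.univ.filter fun π => π.partition.parts = lam.parts

/-- The expectation of `f π` for `π` uniform on the (nonempty) finite set `A`. -/
noncomputable def uniformExp {α : Type*} (A : Finset α) (f : α → ℝ) : ℝ :=
  (∑ π ∈ A, f π) / (A.card : ℝ)

/-- The density `n₁ / n` of fixed points, `n₁` being the number of parts of `lam` equal to `1`. -/
noncomputable def fixedDensity {n : ℕ} (lam : n.Partition) : ℝ :=
  (lam.parts.count 1 : ℝ) / (n : ℝ)

/-! Enriched P-partitions turn the peak number into a counting problem. Let Ω_π(B) be the number of
sequences over B letters compatible with π, ties being allowed across ascents on odd letters and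
across descents on even ones. Then Σ_a Ω_π(2a) t^a = ½ ((1+t)/(1-t))^{n+1} (4t/(1+t)²)^{p(π)+1}
(`hasSum_enrichedCount`). Choosing t with 4t/(1+t)² = e^{-s/√n}, the expectation can be read off the
generating function of the class mean of Ω_π(2a).

Summed over the conjugates of σ, Ω counts pairs of a letter assignment and a strict total order
invariant under a signed lexicographic operator, as in Gessel–Reutenauer theory
(`sum_enrichedCount_conj`). Letters decide the order of any two points whose words along σ differ.
For a large alphabet, ties on cycles of length at least 2 are rare, so such a cycle of length i
contributes a factor close to B^i. The m = n₁ fixed points contribute exactly m! times the count for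
the identity of size m (`card_signedConfigs_le`, `card_signedConfigs_ge`). A three-term recursion
shows that the latter factor is (2a)^m exp(m³/(12a²) - 3m⁵/(160a⁴) + small) for B = 2a
(`abs_log_fixedFactor_le`).

Put t = e^{-θ}, so that θ has order n^{-1/4}, and x = n/θ. The sum Σ a^n exp(c(x/a)² - d(x/a)⁴) t^a
concentrates near a = x, where the exponential behaves like e^{c-d}(x/a)^J with J ≈ 2c. The
remaining power sums are N!/θ^{N+1} up to a factor 1 + O(θ²) by the Lipschitz formula
(`exists_powerSum_bound`, `exists_laplace_bound`).

Finally everything is expanded in ε = s/√n, with w² = 1 - e^{-ε}, θ = 2 artanh w and α = m/n. The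
factor (θ/2w)^{n+1} yields -s√n/3 + s²/45; c yields α³s√n/3 + α³s²/18; d yields -3α⁵s²/10; and
n^J(n-J)!/n! ≈ e^{J²/2n} yields 2α⁶s²/9. The error O(n^{-1/4}) = O(θ) comes from approximating the
class means for a ≥ x/8. -/

/-! ### Enriched P-partitions and their generating function. -/

/-- The number of letter sequences of length `k + 1` ending in the letter `l` that are weakly
increasing and in which two consecutive letters, at positions `i` and `i + 1`, may agree only if
they are odd and `asc i` holds, or they are even and `asc i` fails. -/
noncomputable def prefixCount (asc : ℕ → Prop) : ℕ → ℕ → ℕ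
  | 0, _ => 1
  | k + 1, l => ∑ j ∈ Finset.range l, prefixCount asc k j +
      open Classical in if (Odd l ↔ asc k) then prefixCount asc k l else 0

/-- The condition on consecutive letters counted by `prefixCount`. -/
def LetterStep (asc : ℕ → Prop) (k l l' : ℕ) : Prop :=
  l < l' ∨ l = l' ∧ (Odd l ↔ asc k)

-- The recursion of `prefixCount` is a transfer matrix acting on the last letter; an arbitrary
-- weight `φ` of that letter lets the induction absorb one more step.
open Classical in
theorem sum_letterStep (asc : ℕ → Prop) (B k : ℕ) (φ : Fin B → ℕ) :
    (∑ f : Fin (k + 1) → Fin B,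
      if ∀ i : Fin k, LetterStep asc i (f i.castSucc) (f i.succ) then φ (f (Fin.last k)) else 0) =
    ∑ l : Fin B, prefixCount asc k l * φ l := by
  induction k generalizing φ with
  | zero =>
    simp only [IsEmpty.forall_iff, if_true, prefixCount, one_mul]
    exact Fintype.sum_equiv (Equiv.funUnique (Fin 1) (Fin B)) _ _ (fun f => rfl)
  | succ k ih =>
    rw [← Fintype.sum_equiv (Fin.snocEquiv fun _ : Fin (k + 2) => Fin B)
      (fun p => if (∀ i : Fin k, LetterStep asc i (p.2 i.castSucc) (p.2 i.succ)) then
        (if LetterStep asc k (p.2 (Fin.last k)) p.1 then φ p.1 else 0) else 0) _ ?_]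
    · rw [Fintype.sum_prod_type_right]
      have := ih (fun l => ∑ l' : Fin B, if LetterStep asc k l l' then φ l' else 0)
      calc _ = _ := by
            refine Finset.sum_congr rfl fun f _ => ?_
            by_cases h : ∀ i : Fin k, LetterStep asc i (f i.castSucc) (f i.succ)
            · simp only [h, implies_true, if_true]
            · simp only [h, if_false, Finset.sum_const_zero]
        _ = _ := this
        _ = _ := by
            simp only [Finset.mul_sum]
            rw [Finset.sum_comm]
            refine Finset.sum_congr rfl fun l' _ => ?_
            rw [prefixCount, add_mul, Finset.sum_mul]
            have hsplit : ∀ l : Fin B, (prefixCount asc k l * if LetterStep asc k l l' then φ l' else 0)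
                = (if (l : ℕ) < l' then prefixCount asc k l * φ l' else 0) +
                  if l = l' then (if (Odd (l' : ℕ) ↔ asc k) then prefixCount asc k l' else 0) * φ l'
                    else 0 := by
              intro l
              unfold LetterStep
              by_cases h1 : (l : ℕ) < l'
              · have : l ≠ l' := fun h => by simp [h] at h1
                simp [h1, this]
              · by_cases h2 : l = l'
                · subst h2; simp
                · have h3 : (l : ℕ) ≠ l' := fun h => h2 (Fin.ext h)
                  simp [h1, h2, h3]
            rw [Finset.sum_congr rfl fun l _ => hsplit l, Finset.sum_add_distrib,
              Finset.sum_ite_eq' Finset.univ l']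
            simp only [Finset.mem_univ, if_true]
            congr 1
            rw [Finset.sum_ite, Finset.sum_const_zero, add_zero]
            refine Finset.sum_bij (fun l _ => (l : ℕ)) ?_ ?_ ?_ ?_
            · intro l hl; simpa using hl
            · intro a _ b _ h; exact Fin.ext h
            · intro b hb
              refine ⟨⟨b, (Finset.mem_range.1 hb).trans l'.2⟩,
                Finset.mem_filter.2 ⟨Finset.mem_univ _, Finset.mem_range.1 hb⟩, rfl⟩
            · intro l _; rfl
    · rintro ⟨l, f⟩
      rw [← ite_and]
      refine if_congr ?_ (by simp [Fin.snocEquiv]) rfl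
      rw [Fin.forall_fin_succ']
      simp only [Fin.snocEquiv, Equiv.coe_fn_mk, Fin.snoc_last, Fin.succ_last, Fin.snoc_castSucc,
        Fin.val_castSucc, Fin.val_last]
      refine and_congr (forall_congr' fun i => ?_) Iff.rfl
      rw [Fin.succ_castSucc, Fin.snoc_castSucc]

open Classical in
theorem card_letterStep (asc : ℕ → Prop) (B k : ℕ) :
    Fintype.card {f : Fin (k + 1) → Fin B //
      ∀ i : Fin k, LetterStep asc i (f i.castSucc) (f i.succ)} =
    ∑ l ∈ Finset.range B, prefixCount asc k l := by
  have h := sum_letterStep asc B k (fun _ => 1)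
  simp only [mul_one] at h
  rw [Fintype.card_subtype, Finset.card_filter, h, Finset.sum_range]

theorem hasSum_partialSum_mul_pow {x : ℕ → ℝ} (hx : ∀ c, 0 ≤ x c) {t X : ℝ} (ht0 : 0 < t)
    (ht1 : t < 1) (h : HasSum (fun c => x c * t ^ c) X) :
    HasSum (fun c => (∑ j ∈ Finset.range c, x j) * t ^ c) (t / (1 - t) * X) := by
  have hg := hasSum_geometric_of_lt_one ht0.le ht1
  have h1 : Summable fun c => ‖x c * t ^ c‖ := by
    refine h.summable.congr fun c => ?_
    rw [Real.norm_of_nonneg (mul_nonneg (hx c) (by positivity))]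
  have h2 : Summable fun c => ‖t ^ c‖ := by
    refine hg.summable.congr fun c => ?_
    rw [Real.norm_of_nonneg (by positivity)]
  have h3 := hasSum_sum_range_mul_of_summable_norm h1 h2
  rw [h.tsum_eq, hg.tsum_eq] at h3
  rw [← hasSum_nat_add_iff' 1]
  simp only [Finset.range_one, Finset.sum_singleton, Finset.range_zero, Finset.sum_empty, zero_mul,
    sub_zero]
  have h4 := h3.mul_left t
  rw [show t / (1 - t) * X = t * (X * (1 - t)⁻¹) by rw [div_eq_mul_inv]; ring]
  refine h4.congr_fun ?_
  intro c
  rw [Finset.sum_mul, Finset.mul_sum]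
  refine Finset.sum_congr rfl fun j hj => ?_
  have : j ≤ c := Nat.lt_succ_iff.1 (Finset.mem_range.1 hj)
  rw [pow_succ, ← Nat.add_sub_cancel' this, pow_add]
  simp only [Nat.add_sub_cancel_left]
  ring

open Classical in
/-- The number of `j < k` at which an ascent is followed by a descent at `j + 1 < k`. -/
noncomputable def turnCount (asc : ℕ → Prop) (k : ℕ) : ℕ :=
  ((Finset.range k).filter fun j => j ≠ 0 ∧ asc (j - 1) ∧ ¬ asc j).card

theorem sum_range_two_mul (F : ℕ → ℕ) (c : ℕ) :
    ∑ j ∈ Finset.range (2 * c), F j = ∑ j ∈ Finset.range c, (F (2 * j) + F (2 * j + 1)) := by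
  induction c with
  | zero => simp
  | succ c ih => rw [Nat.mul_succ, Finset.sum_range_succ, Finset.sum_range_succ, ih,
      Finset.sum_range_succ, add_assoc]

/-- Even and odd last letters are tracked separately. An ascent leaves U = tV and a descent leaves U
= V; the start behaves as if a descent preceded it. Each step multiplies U + V by (1+t)/(1-t),
except a descent met in the state U = tV, where the factor 4t/(1+t)² appears in addition. That
exceptional step is a peak. -/
theorem prefixCount_hasSum (asc : ℕ → Prop) {t : ℝ} (ht0 : 0 < t) (ht1 : t < 1) (k : ℕ) :
    ∃ U V : ℝ, HasSum (fun c => (prefixCount asc k (2 * c) : ℝ) * t ^ c) U ∧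
      HasSum (fun c => (prefixCount asc k (2 * c + 1) : ℝ) * t ^ c) V ∧
      U + V = 2 / (1 - t) * ((1 + t) / (1 - t)) ^ k * (4 * t / (1 + t) ^ 2) ^ turnCount asc k ∧
      (k ≠ 0 ∧ asc (k - 1) → U = t * V) ∧ (¬ (k ≠ 0 ∧ asc (k - 1)) → U = V) := by
  classical
  have h1t : 1 - t ≠ 0 := by linarith
  have h1t' : 1 + t ≠ 0 := by linarith
  induction k with
  | zero =>
    have hg := hasSum_geometric_of_lt_one ht0.le ht1
    refine ⟨(1 - t)⁻¹, (1 - t)⁻¹, ?_, ?_, ?_, ?_, ?_⟩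
    · simpa [prefixCount] using hg
    · simpa [prefixCount] using hg
    · simp [turnCount]; ring
    · simp
    · simp
  | succ k ih =>
    obtain ⟨U, V, hU, hV, hsum, hasc, hdesc⟩ := ih
    have hP : HasSum (fun c => ((∑ j ∈ Finset.range (2 * c), prefixCount asc k j : ℕ) : ℝ) * t ^ c)
        (t / (1 - t) * (U + V)) := by
      have := hasSum_partialSum_mul_pow
        (x := fun c => (prefixCount asc k (2 * c) : ℝ) + prefixCount asc k (2 * c + 1))
        (fun c => by positivity) ht0 ht1 (by simpa only [add_mul] using hU.add hV)
      refine this.congr_fun ?_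
      intro c
      rw [sum_range_two_mul]
      push_cast
      rfl
    have hturn : turnCount asc (k + 1) = turnCount asc k +
        if k ≠ 0 ∧ asc (k - 1) ∧ ¬ asc k then 1 else 0 := by
      rw [turnCount, turnCount, Finset.range_add_one, Finset.filter_insert]
      split_ifs with h
      · rw [Finset.card_insert_of_notMem (by simp)]
      · simp
    by_cases hk : asc k
    · refine ⟨t / (1 - t) * (U + V), t / (1 - t) * (U + V) + U + V, ?_, ?_, ?_, ?_, ?_⟩
      · refine hP.congr_fun fun c => ?_
        have : ¬ Odd (2 * c) := by simp
        simp [prefixCount, hk, this]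
      · refine ((hP.add hU).add hV).congr_fun ?_
        intro c
        simp only [prefixCount, hk, Finset.sum_range_succ]
        simp
        ring
      · rw [hturn]
        simp only [hk, not_true_eq_false, and_false, if_false, add_zero]
        rw [pow_succ]
        have : t / (1 - t) * (U + V) + (t / (1 - t) * (U + V) + U + V) =
          (1 + t) / (1 - t) * (U + V) := by field_simp; ring
        rw [this, hsum]; ring
      · intro _; field_simp; ring
      · intro h; exact absurd ⟨by simp, by simpa using hk⟩ h
    · refine ⟨t / (1 - t) * (U + V) + U, t / (1 - t) * (U + V) + U, ?_, ?_, ?_, ?_, ?_⟩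
      · refine (hP.add hU).congr_fun ?_
        intro c
        simp only [prefixCount, hk]
        simp
        ring
      · refine (hP.add hU).congr_fun ?_
        intro c
        simp only [prefixCount, hk, Finset.sum_range_succ]
        simp
        ring
      · rw [hturn]
        by_cases hk1 : k ≠ 0 ∧ asc (k - 1)
        · have e := hasc hk1
          simp only [hk1.1, hk1.2, hk, ne_eq, not_false_eq_true, true_and, if_true]
          have : t / (1 - t) * (U + V) + U + (t / (1 - t) * (U + V) + U) =
            (1 + t) / (1 - t) * (4 * t / (1 + t) ^ 2) * (U + V) := by
            rw [e]; field_simp; ring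
          rw [this, hsum]; ring
        · have e := hdesc hk1
          have : ¬ (k ≠ 0 ∧ asc (k - 1) ∧ ¬ asc k) := fun h => hk1 ⟨h.1, h.2.1⟩
          rw [if_neg this, add_zero]
          have : t / (1 - t) * (U + V) + U + (t / (1 - t) * (U + V) + U) =
            (1 + t) / (1 - t) * (U + V) := by
            rw [e]; field_simp; ring
          rw [this, hsum]; ring
      · rintro ⟨-, h⟩; exact absurd (by simpa using h) hk
      · intro _; rfl

theorem hasSum_sum_prefixCount (asc : ℕ → Prop) {t : ℝ} (ht0 : 0 < t) (ht1 : t < 1) (k : ℕ) :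
    HasSum (fun a => ((∑ l ∈ Finset.range (2 * a), prefixCount asc k l : ℕ) : ℝ) * t ^ a)
      (2 * t / (1 - t) ^ 2 * ((1 + t) / (1 - t)) ^ k *
        (4 * t / (1 + t) ^ 2) ^ turnCount asc k) := by
  obtain ⟨U, V, hU, hV, hsum, -, -⟩ := prefixCount_hasSum asc ht0 ht1 k
  have := hasSum_partialSum_mul_pow
    (x := fun c => (prefixCount asc k (2 * c) : ℝ) + prefixCount asc k (2 * c + 1))
    (fun c => by positivity) ht0 ht1 (by simpa only [add_mul] using hU.add hV)
  rw [hsum] at this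
  have h1t : 1 - t ≠ 0 := by linarith
  convert this using 1
  · funext a
    rw [sum_range_two_mul]
    push_cast
    rfl
  · field_simp

/-- The relation `x ≺ y` obtained by comparing letters first and breaking ties between equal
letters by the relation `r` on the images under `σ`: in the direction of `r` for odd letters and in
the opposite direction for even letters. -/
def SignedLex {α : Type*} (σ : Equiv.Perm α) (g : α → ℕ) (r : α → α → Prop) (x y : α) : Prop :=
  g x < g y ∨ g x = g y ∧ ((Odd (g x) ∧ r (σ x) (σ y)) ∨ (¬ Odd (g x) ∧ r (σ y) (σ x)))

theorem SignedLex.trans {α : Type*} {σ : Equiv.Perm α} {g : α → ℕ} {r : α → α → Prop}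
    (hr : ∀ x y z, r x y → r y z → r x z) {x y z : α} (h : SignedLex σ g r x y)
    (h' : SignedLex σ g r y z) : SignedLex σ g r x z := by
  rcases h with h | ⟨h, h1⟩
  · rcases h' with h' | ⟨h', -⟩
    · exact Or.inl (h.trans h')
    · exact Or.inl (h' ▸ h)
  · rcases h' with h' | ⟨h', h2⟩
    · exact Or.inl (h ▸ h')
    · refine Or.inr ⟨h.trans h', ?_⟩
      rw [← h] at h2
      rcases h1 with ⟨o, h1⟩ | ⟨o, h1⟩ <;> rcases h2 with ⟨o', h2⟩ | ⟨o', h2⟩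
      · exact Or.inl ⟨o, hr _ _ _ h1 h2⟩
      · exact absurd o o'
      · exact absurd o' o
      · exact Or.inr ⟨o, hr _ _ _ h2 h1⟩

/-- The letter sequences compatible with `π`, in the sense of enriched `P`-partitions. -/
def Enriched {n B : ℕ} (π : Equiv.Perm (Fin n)) (f : Fin n → Fin B) : Prop :=
  ∀ i j, i < j → SignedLex π (fun i => (f i : ℕ)) (· < ·) i j

/-- The number of compatible letter sequences with `B` letters. -/
noncomputable def enrichedCount {n : ℕ} (π : Equiv.Perm (Fin n)) (B : ℕ) : ℕ :=
  Nat.card {f : Fin n → Fin B // Enriched π f}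

/-- The ascent positions of a permutation. -/
def ascentAt {n : ℕ} (π : Equiv.Perm (Fin n)) (i : ℕ) : Prop :=
  ∃ (h : i + 1 < n), π ⟨i, by omega⟩ < π ⟨i + 1, h⟩

/-- The signed comparison is transitive, so compatibility need only be tested at neighbouring
positions. -/
theorem enriched_iff {k B : ℕ} (π : Equiv.Perm (Fin (k + 1))) (f : Fin (k + 1) → Fin B) :
    Enriched π f ↔ ∀ i : Fin k, LetterStep (ascentAt π) i (f i.castSucc) (f i.succ) := by
  have htr : IsTrans (Fin (k + 1)) (SignedLex π (fun i => (f i : ℕ)) (· < ·)) :=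
    ⟨fun x y z h h' => SignedLex.trans (fun a b c => lt_trans (a := a) (b := b) (c := c)) h h'⟩
  have h := Fin.liftFun_iff_succ (n := k) (SignedLex π (fun i => (f i : ℕ)) (· < ·)) (f := id)
  have h1 : Enriched π f ↔ Relator.LiftFun (· < ·) (SignedLex π (fun i => (f i : ℕ)) (· < ·))
    (id : Fin (k + 1) → _) id := Iff.rfl
  rw [h1, h]
  refine forall_congr' fun i => ?_
  unfold SignedLex LetterStep
  refine or_congr Iff.rfl (and_congr Iff.rfl ?_)
  have h2 : ascentAt π i ↔ π i.castSucc < π i.succ :=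
    ⟨fun ⟨_, h⟩ => h, fun h => ⟨by omega, h⟩⟩
  have h3 : π i.succ < π i.castSucc ↔ ¬ π i.castSucc < π i.succ := by
    rw [not_lt, le_iff_lt_or_eq]
    refine ⟨Or.inl, fun h => h.resolve_right fun h => ?_⟩
    exact absurd (π.injective h) (Fin.castSucc_lt_succ).ne'
  simp only [id, h2, h3]
  tauto

theorem enrichedCount_succ {k : ℕ} (π : Equiv.Perm (Fin (k + 1))) (B : ℕ) :
    enrichedCount π B = ∑ l ∈ Finset.range B, prefixCount (ascentAt π) k l := by
  classical
  rw [enrichedCount, Nat.card_congr (Equiv.subtypeEquivRight (enriched_iff π)),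
    Nat.card_eq_fintype_card]
  convert card_letterStep (ascentAt π) B k

/-- Monotonicity is all that will be used about alphabets too small for the asymptotics. -/
theorem enrichedCount_mono {n : ℕ} (hn : 0 < n) (π : Equiv.Perm (Fin n)) :
    Monotone (enrichedCount π) := by
  obtain ⟨k, rfl⟩ := Nat.exists_eq_succ_of_ne_zero hn.ne'
  intro a b h
  rw [enrichedCount_succ, enrichedCount_succ]
  exact Finset.sum_le_sum_of_subset (Finset.range_mono h)

theorem turnCount_ascentAt {k : ℕ} (π : Equiv.Perm (Fin (k + 1))) :
    turnCount (ascentAt π) k = peaks π := by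
  classical
  unfold turnCount peaks
  refine Finset.card_bij (fun j hj => ⟨j, by simp at hj; omega⟩) ?_ ?_ ?_
  · intro j hj
    simp only [Finset.mem_filter, Finset.mem_range] at hj
    obtain ⟨hjk, hj0, ⟨h1, h2⟩, h3⟩ := hj
    simp only [Finset.mem_filter, Finset.mem_univ, true_and]
    refine ⟨⟨j - 1, by omega⟩, ⟨j + 1, by omega⟩, by simp; omega, rfl, ?_, ?_⟩
    · convert h2 using 3; omega
    · by_contra h4
      refine h3 ⟨by omega, lt_of_le_of_ne (not_lt.1 h4) fun h => ?_⟩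
      have := π.injective h
      simp at this
  · intro a _ b _ h; simpa using h
  · rintro ⟨i, hi⟩ h
    simp only [Finset.mem_filter, Finset.mem_univ, true_and] at h
    obtain ⟨⟨j, hj'⟩, ⟨l, hl'⟩, hj, hl, h1, h2⟩ := h
    simp only at hj hl
    subst hj hl
    refine ⟨j + 1, ?_, rfl⟩
    simp only [Finset.mem_filter, Finset.mem_range]
    refine ⟨by omega, by omega, ⟨by omega, h1⟩, ?_⟩
    rintro ⟨_, h3⟩
    exact absurd h2 (not_lt.2 h3.le)

/-- Summing over the last letter gives 2t/(1-t)² = ½ · 4t/(1+t)² · ((1+t)/(1-t))², which explains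
the extra factor and the exponent `n + 1`. -/
theorem hasSum_enrichedCount {n : ℕ} (hn : 0 < n) (π : Equiv.Perm (Fin n)) {t : ℝ} (ht0 : 0 < t)
    (ht1 : t < 1) :
    HasSum (fun a => (enrichedCount π (2 * a) : ℝ) * t ^ a)
      ((4 * t / (1 + t) ^ 2) / 2 * ((1 + t) / (1 - t)) ^ (n + 1) *
        (4 * t / (1 + t) ^ 2) ^ peaks π) := by
  obtain ⟨k, rfl⟩ := Nat.exists_eq_succ_of_ne_zero hn.ne'
  have := hasSum_sum_prefixCount (ascentAt π) ht0 ht1 k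
  rw [turnCount_ascentAt] at this
  simp only [Nat.succ_eq_add_one, enrichedCount_succ]
  convert this using 2
  have h1t : 1 - t ≠ 0 := by linarith
  have h1t' : 1 + t ≠ 0 := by linarith
  generalize hX : ((1 + t) / (1 - t)) ^ k = X
  rw [pow_succ _ (k + 1), pow_succ _ k, hX]
  field_simp
  ring

/-! ### Invariant orders and ties. -/

/-- A strict total order `r` which is invariant under the operator `SignedLex σ g`. -/
structure SignedOrder {α : Type*} (σ : Equiv.Perm α) (g : α → ℕ) (r : α → α → Prop) : Prop where
  irrefl : ∀ x, ¬ r x x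
  trans : ∀ x y z, r x y → r y z → r x z
  total : ∀ x y, x ≠ y → r x y ∨ r y x
  lex : ∀ x y, r x y ↔ SignedLex σ g r x y

/-- Two points are tied if their `σ`-orbits read off the same word of letters. -/
def Tied {α : Type*} (σ : Equiv.Perm α) (g : α → ℕ) (x y : α) : Prop :=
  ∀ j : ℕ, g ((σ ^ j) x) = g ((σ ^ j) y)

namespace SignedOrder

variable {α : Type*} {σ : Equiv.Perm α} {g : α → ℕ} {r r₁ r₂ : α → α → Prop}

theorem asymm (h : SignedOrder σ g r) {x y : α} (hxy : r x y) : ¬ r y x :=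
  fun h' => h.irrefl x (h.trans _ _ _ hxy h')

theorem not_iff (h : SignedOrder σ g r) {x y : α} (hxy : x ≠ y) : ¬ r x y ↔ r y x :=
  ⟨fun h' => (h.total x y hxy).resolve_left h', fun h' h'' => h.asymm h' h''⟩

theorem iff_of_lt (h : SignedOrder σ g r) {x y : α} (hg : g x ≠ g y) : r x y ↔ g x < g y := by
  rw [h.lex, SignedLex]
  simp [hg]

theorem iff_of_odd (h : SignedOrder σ g r) {x y : α} (hg : g x = g y) (ho : Odd (g x)) :
    r x y ↔ r (σ x) (σ y) := by
  rw [h.lex, SignedLex]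
  simp only [hg, lt_irrefl, false_or, true_and]
  rw [← hg]; simp [ho]

theorem iff_of_not_odd (h : SignedOrder σ g r) {x y : α} (hg : g x = g y) (ho : ¬ Odd (g x)) :
    r x y ↔ r (σ y) (σ x) := by
  rw [h.lex, SignedLex]
  simp only [hg, lt_irrefl, false_or, true_and]
  rw [← hg]; simp only [ho, false_and, not_false_eq_true, true_and, false_or]

theorem agree_comm (h₁ : SignedOrder σ g r₁) (h₂ : SignedOrder σ g r₂) {x y : α} (hxy : x ≠ y) :
    (r₁ x y ↔ r₂ x y) ↔ (r₁ y x ↔ r₂ y x) := by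
  rw [← h₁.not_iff hxy, ← h₂.not_iff hxy]
  tauto

theorem agree_step (h₁ : SignedOrder σ g r₁) (h₂ : SignedOrder σ g r₂) {x y : α} (hxy : x ≠ y)
    (hg : g x = g y) : (r₁ x y ↔ r₂ x y) ↔ (r₁ (σ x) (σ y) ↔ r₂ (σ x) (σ y)) := by
  by_cases ho : Odd (g x)
  · rw [h₁.iff_of_odd hg ho, h₂.iff_of_odd hg ho]
  · rw [h₁.iff_of_not_odd hg ho, h₂.iff_of_not_odd hg ho,
      agree_comm h₁ h₂ (fun h => hxy (σ.injective h.symm))]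

theorem agree_pow (h₁ : SignedOrder σ g r₁) (h₂ : SignedOrder σ g r₂) {x y : α} (hxy : x ≠ y)
    (j : ℕ) (hg : ∀ i < j, g ((σ ^ i) x) = g ((σ ^ i) y)) :
    (r₁ x y ↔ r₂ x y) ↔ (r₁ ((σ ^ j) x) ((σ ^ j) y) ↔ r₂ ((σ ^ j) x) ((σ ^ j) y)) := by
  induction j with
  | zero => simp
  | succ j ih =>
    rw [ih fun i hi => hg i (hi.trans (Nat.lt_succ_self j)),
      agree_step h₁ h₂ (fun h => hxy ((σ ^ j).injective h)) (hg j (Nat.lt_succ_self j)), pow_succ']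
    rfl

/-- At the first index where the two words differ, the letters decide both orders alike. Each
earlier step preserves both comparisons or flips both, so agreement is carried back to `x` and `y`.
-/
theorem agree_of_not_tied (h₁ : SignedOrder σ g r₁) (h₂ : SignedOrder σ g r₂) {x y : α}
    (hxy : ¬ Tied σ g x y) : r₁ x y ↔ r₂ x y := by
  classical
  have hne : x ≠ y := fun h => hxy (by subst h; intro j; rfl)
  simp only [Tied, not_forall] at hxy
  rw [agree_pow h₁ h₂ hne (Nat.find hxy) fun i hi => not_not.1 (Nat.find_min hxy hi),
    h₁.iff_of_lt (Nat.find_spec hxy), h₂.iff_of_lt (Nat.find_spec hxy)]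

/-- On the points tied to `x`, every power of `σ` either preserves or reverses the order. -/
theorem pow_preserves_or_reverses (h : SignedOrder σ g r) (x : α) (j : ℕ) :
    (∀ y z, Tied σ g x y → Tied σ g x z → (r y z ↔ r ((σ ^ j) y) ((σ ^ j) z))) ∨
    (∀ y z, Tied σ g x y → Tied σ g x z → (r y z ↔ r ((σ ^ j) z) ((σ ^ j) y))) := by
  induction j with
  | zero => exact Or.inl fun y z _ _ => Iff.rfl
  | succ j ih =>
    simp only [pow_succ', Equiv.Perm.mul_apply]
    by_cases ho : Odd (g ((σ ^ j) x))
    · rcases ih with ih | ih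
      · refine Or.inl fun y z hy hz => ?_
        rw [ih y z hy hz, h.iff_of_odd ((hy j).symm.trans (hz j)) (hy j ▸ ho)]
      · refine Or.inr fun y z hy hz => ?_
        rw [ih y z hy hz, h.iff_of_odd ((hz j).symm.trans (hy j)) (hz j ▸ ho)]
    · rcases ih with ih | ih
      · refine Or.inr fun y z hy hz => ?_
        rw [ih y z hy hz, h.iff_of_not_odd ((hy j).symm.trans (hz j)) (hy j ▸ ho)]
      · refine Or.inl fun y z hy hz => ?_
        rw [ih y z hy hz, h.iff_of_not_odd ((hz j).symm.trans (hy j)) (hz j ▸ ho)]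

theorem tied_pow {σ : Equiv.Perm α} {x : α} {m : ℕ} (ht : Tied σ g x ((σ ^ m) x)) (k : ℕ) :
    Tied σ g x ((σ ^ (m * k)) x) := by
  induction k with
  | zero => intro j; simp
  | succ k ih =>
    intro j
    rw [ih j, mul_add, mul_one, add_comm, pow_add, Equiv.Perm.mul_apply, ← Equiv.Perm.mul_apply,
      ← Equiv.Perm.mul_apply, ← pow_add, ← Equiv.Perm.mul_apply, ← pow_add, ← pow_add]
    have := ht (j + m * k)
    rw [← Equiv.Perm.mul_apply, ← pow_add] at this
    rw [this]
    congr 2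
    ring_nf

/-- Otherwise the iterates of σ^m starting at `x` would form a strictly monotone chain, which cannot
return to `x`, although σ has finite order. -/
theorem pow_fixes_of_preserves [Finite α] (h : SignedOrder σ g r) {x : α} {m : ℕ}
    (ht : Tied σ g x ((σ ^ m) x))
    (hp : ∀ y z, Tied σ g x y → Tied σ g x z → (r y z ↔ r ((σ ^ m) y) ((σ ^ m) z))) :
    (σ ^ m) x = x := by
  by_contra hne
  have hstep : ∀ k, (r x ((σ ^ m) x) → r ((σ ^ (m * k)) x) ((σ ^ (m * (k + 1))) x)) ∧
      (r ((σ ^ m) x) x → r ((σ ^ (m * (k + 1))) x) ((σ ^ (m * k)) x)) := by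
    intro k
    induction k with
    | zero => simp
    | succ k ih =>
      have e : ∀ k, (σ ^ (m * (k + 1))) x = (σ ^ m) ((σ ^ (m * k)) x) := fun k => by
        rw [mul_add, mul_one, add_comm, pow_add]; rfl
      rw [e (k + 1), e k, ← hp _ _ (tied_pow ht k) (e k ▸ tied_pow ht (k + 1)),
        ← hp _ _ (e k ▸ tied_pow ht (k + 1)) (tied_pow ht k), ← e k]
      exact ih
  have hpow : (σ ^ (m * orderOf σ)) x = x := by
    rw [mul_comm, pow_mul, pow_orderOf_eq_one]; simp
  have hpos := orderOf_pos σ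
  rcases h.total x _ (Ne.symm hne) with h1 | h1
  · have : ∀ k, r x ((σ ^ (m * (k + 1))) x) := by
      intro k
      induction k with
      | zero => simpa using h1
      | succ k ih => exact h.trans _ _ _ ih ((hstep (k + 1)).1 h1)
    have h2 := this (orderOf σ - 1)
    rw [Nat.sub_add_cancel hpos, hpow] at h2
    exact h.irrefl x h2
  · have : ∀ k, r ((σ ^ (m * (k + 1))) x) x := by
      intro k
      induction k with
      | zero => simpa using h1
      | succ k ih => exact h.trans _ _ _ ((hstep (k + 1)).2 h1) ih
    have h2 := this (orderOf σ - 1)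
    rw [Nat.sub_add_cancel hpos, hpow] at h2
    exact h.irrefl x h2

/-- σ^m preserves or reverses the order on the tied class, so its square preserves it. Consequently
two distinct tied points of one cycle lie half a period apart. -/
theorem pow_two_mul_fixes [Finite α] (h : SignedOrder σ g r) {x : α} {m : ℕ}
    (ht : Tied σ g x ((σ ^ m) x)) : (σ ^ (2 * m)) x = x := by
  have hsh : ∀ y, Tied σ g x y → Tied σ g x ((σ ^ m) y) := by
    intro y hy j
    rw [ht j, ← Equiv.Perm.mul_apply, ← Equiv.Perm.mul_apply, ← pow_add]
    exact hy (j + m)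
  have e : ∀ y, (σ ^ (2 * m)) y = (σ ^ m) ((σ ^ m) y) := fun y => by
    rw [two_mul, pow_add]; rfl
  refine h.pow_fixes_of_preserves (by rw [mul_comm]; exact tied_pow ht 2) fun y z hy hz => ?_
  rw [e, e]
  rcases h.pow_preserves_or_reverses x m with hp | hp
  · rw [hp y z hy hz, hp _ _ (hsh y hy) (hsh z hz)]
  · rw [hp y z hy hz, hp _ _ (hsh z hz) (hsh y hy)]

end SignedOrder

open Classical in
/-- The pairs of a letter assignment and an order invariant under the associated operator. -/
noncomputable def signedConfigs {α : Type*} [Fintype α] (σ : Equiv.Perm α) (B : ℕ) :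
    Finset ((α → Fin B) × (α → α → Prop)) :=
  Finset.univ.filter fun p => SignedOrder σ (fun x => (p.1 x : ℕ)) p.2

/-! ### Upper bound: removing one cycle at a time. -/

section CycleRemoval

variable {α : Type*} {σ : Equiv.Perm α} {p : α → Prop} {B : ℕ}

theorem pow_mem_iff (hp : ∀ x, p (σ x) ↔ p x) (j : ℕ) (x : α) : p ((σ ^ j) x) ↔ p x := by
  induction j with
  | zero => simp
  | succ j ih => rw [pow_succ', Equiv.Perm.mul_apply, hp, ih]

theorem subtypePerm_pow_val (hp : ∀ x, p (σ x) ↔ p x) (j : ℕ) (x : {x // p x}) :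
    (((σ.subtypePerm hp) ^ j) x : α) = (σ ^ j) x := by
  rw [Equiv.Perm.subtypePerm_pow]; rfl

/-- Restriction of a configuration to an invariant subset. -/
def restrictConfig (p : α → Prop) (c : (α → Fin B) × (α → α → Prop)) :
    ({x // p x} → Fin B) × ({x // p x} → {x // p x} → Prop) :=
  (fun x => c.1 x, fun x y => c.2 x y)

theorem SignedOrder.restrict (hp : ∀ x, p (σ x) ↔ p x) {g : α → ℕ} {r : α → α → Prop}
    (h : SignedOrder σ g r) :
    SignedOrder (σ.subtypePerm hp) (fun x : {x // p x} => g x) (fun x y => r x y) where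
  irrefl x := h.irrefl x
  trans x y z := h.trans x y z
  total x y hxy := h.total x y fun h => hxy (Subtype.ext h)
  lex x y := h.lex x y

/-- The word `v` has even length and period half its length. -/
def HalfPeriodic {i B : ℕ} (v : Fin i → Fin B) : Prop :=
  Even i ∧ ∀ (j : ℕ) (h : j + i / 2 < i), v ⟨j, by omega⟩ = v ⟨j + i / 2, h⟩

open Classical in
theorem card_halfPeriodic_le (i B : ℕ) :
    (Finset.univ.filter fun v : Fin i → Fin B => HalfPeriodic v).card ≤ B ^ (i / 2) := by
  have hc : B ^ (i / 2) = (Finset.univ : Finset (Fin (i / 2) → Fin B)).card := by simp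
  rw [hc]
  refine Finset.card_le_card_of_injOn (fun v j => v ⟨j, by omega⟩) (fun _ _ => Finset.mem_coe.2 (Finset.mem_univ _)) ?_
  intro v hv v' hv' h
  simp only [Finset.coe_filter, Finset.mem_univ, true_and, Set.mem_ofPred_eq] at hv hv'
  obtain ⟨⟨k, hk⟩, hv⟩ := hv
  obtain ⟨-, hv'⟩ := hv'
  have h' : ∀ j (hj : j < i / 2), v ⟨j, by omega⟩ = v' ⟨j, by omega⟩ := fun j hj =>
    congrFun h ⟨j, hj⟩
  funext ⟨j, hj⟩
  by_cases hj2 : j < i / 2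
  · exact h' j hj2
  · have e : j = (j - i / 2) + i / 2 := by omega
    have h1 := hv (j - i / 2) (by omega)
    have h2 := hv' (j - i / 2) (by omega)
    have h3 := h' (j - i / 2) (by omega)
    simp only [← e] at h1 h2
    rw [← h1, ← h2, h3]

variable [Fintype α]

-- Once the restriction to `p` and the word `v` are fixed, the only freedom left is the place of
-- `x₀` among the points of `p` tied to it and, when `v` is half periodic, the order of `x₀` and its
-- antipode. All other comparisons are forced by letters or transported along the cycle.
open Classical in
theorem card_config_fiber_le (hp : ∀ x, p (σ x) ↔ p x) {x₀ : α} {i : ℕ}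
    (hcyc : ∀ x, ¬ p x → ∃ j, (σ ^ j) x₀ = x) (hi0 : 0 < i) (hi : (σ ^ i) x₀ = x₀)
    (himin : ∀ m, (σ ^ m) x₀ = x₀ → i ∣ m)
    (c₀ : ({x // p x} → Fin B) × ({x // p x} → {x // p x} → Prop)) (v : Fin i → Fin B) :
    ((signedConfigs σ B).filter fun c =>
      restrictConfig p c = c₀ ∧ (fun j : Fin i => c.1 ((σ ^ (j : ℕ)) x₀)) = v).card ≤
    ((Finset.univ.filter fun y : {x // p x} =>
        ∀ j : Fin i, c₀.1 (((σ.subtypePerm hp) ^ (j : ℕ)) y) = v j).card + 1) *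
      (if HalfPeriodic v then 2 else 1) := by
  set T := Finset.univ.filter fun y : {x // p x} =>
        ∀ j : Fin i, c₀.1 (((σ.subtypePerm hp) ^ (j : ℕ)) y) = v j with hT
  have hc : (T.card + 1) * (if HalfPeriodic v then 2 else 1) =
      (Finset.range (T.card + 1) ×ˢ
        (if HalfPeriodic v then (Finset.univ : Finset Prop) else {False})).card := by
    rw [Finset.card_product, Finset.card_range]
    split_ifs <;> simp
  have hmod : ∀ m, ∃ j < i, (σ ^ m) x₀ = (σ ^ j) x₀ := by
    intro m
    refine ⟨m % i, Nat.mod_lt _ hi0, ?_⟩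
    have hk : ∀ k, (σ ^ (i * k)) x₀ = x₀ := by
      intro k
      induction k with
      | zero => simp
      | succ k ih => rw [mul_add, mul_one, pow_add, Equiv.Perm.mul_apply, hi, ih]
    conv_lhs => rw [← Nat.mod_add_div m i, pow_add, Equiv.Perm.mul_apply, hk]
  rw [hc]
  -- A configuration is encoded by the number of tied points of `p` below `x₀` and one bit for the
  -- comparison with the antipode.
  refine Finset.card_le_card_of_injOn (fun c =>
    ((Finset.univ.filter fun y : {x // p x} =>
      Tied σ (fun x => (c.1 x : ℕ)) x₀ y ∧ c.2 y x₀).card,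
      HalfPeriodic v ∧ c.2 x₀ ((σ ^ (i / 2)) x₀))) ?_ ?_
  · rintro c hc
    simp only [Finset.coe_filter, Set.mem_ofPred_eq] at hc
    obtain ⟨-, hc, hcv⟩ := hc
    simp only [Finset.coe_product, Set.mem_prod, Finset.mem_coe, Finset.mem_range]
    constructor
    · refine Nat.lt_succ_of_le (Finset.card_le_card ?_)
      intro y hy
      simp only [Finset.mem_filter, Finset.mem_univ, true_and] at hy
      simp only [hT, Finset.mem_filter, Finset.mem_univ, true_and]
      intro j
      rw [← hc, ← hcv]
      simp only [restrictConfig, subtypePerm_pow_val]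
      exact Fin.ext (hy.1 j).symm
    · split_ifs with h
      · exact Finset.mem_univ _
      · simp [h]
  · rintro ⟨g, r₁⟩ hc₁ ⟨g', r₂⟩ hc₂ hcode
    simp only [Finset.coe_filter, Set.mem_ofPred_eq, signedConfigs, Finset.mem_filter,
      Finset.mem_univ, true_and] at hc₁ hc₂
    obtain ⟨h₁, hr₁, hv₁⟩ := hc₁
    obtain ⟨h₂, hr₂, hv₂⟩ := hc₂
    have hg : g = g' := by
      funext x
      by_cases hx : p x
      · exact congrFun (congrArg Prod.fst (hr₁.trans hr₂.symm)) ⟨x, hx⟩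
      · obtain ⟨m, rfl⟩ := hcyc x hx
        obtain ⟨j, hj, e⟩ := hmod m
        rw [e]
        exact congrFun (hv₁.trans hv₂.symm) ⟨j, hj⟩
    subst hg
    have hβ : ∀ x y, p x → p y → (r₁ x y ↔ r₂ x y) := fun x y hx hy =>
      iff_of_eq (congrFun (congrFun (congrArg Prod.snd (hr₁.trans hr₂.symm)) ⟨x, hx⟩) ⟨y, hy⟩)
    simp only [Prod.mk.injEq] at hcode
    obtain ⟨hcard, hbit⟩ := hcode
    -- The tied points of `p` below `x₀` form an initial segment for either order. The orders agree
    -- on `p`, so segments of equal size coincide.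
    have hsub : ∀ (r r' : α → α → Prop), SignedOrder σ (fun x => (g x : ℕ)) r →
        SignedOrder σ (fun x => (g x : ℕ)) r' → (∀ x y, p x → p y → (r x y ↔ r' x y)) →
        (Finset.univ.filter fun y : {x // p x} =>
          Tied σ (fun x => (g x : ℕ)) x₀ y ∧ r y x₀).card =
        (Finset.univ.filter fun y : {x // p x} =>
          Tied σ (fun x => (g x : ℕ)) x₀ y ∧ r' y x₀).card →
        ∀ y, p y → Tied σ (fun x => (g x : ℕ)) x₀ y → r y x₀ → x₀ ≠ y → r' y x₀ := by
      intro r r' h h' hrr hcard y hy hty hry hne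
      by_contra hn
      have : ¬ (Finset.univ.filter fun y : {x // p x} =>
          Tied σ (fun x => (g x : ℕ)) x₀ y ∧ r' y x₀) ⊆ (Finset.univ.filter fun y : {x // p x} =>
          Tied σ (fun x => (g x : ℕ)) x₀ y ∧ r y x₀) := by
        intro hss
        have e := Finset.eq_of_subset_of_card_le hss hcard.le
        have : (⟨y, hy⟩ : {x // p x}) ∈ (Finset.univ.filter fun y : {x // p x} =>
          Tied σ (fun x => (g x : ℕ)) x₀ y ∧ r y x₀) := by simp [hty, hry]
        rw [← e] at this
        simp [hn] at this
      rw [Finset.not_subset] at this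
      obtain ⟨z, hz, hz'⟩ := this
      simp only [Finset.mem_filter, Finset.mem_univ, true_and, not_and] at hz hz'
      have hz1 : ¬ r z x₀ := hz' hz.1
      by_cases hzx : (z : α) = x₀
      · exact h'.irrefl x₀ (by simpa [hzx] using hz.2)
      · have h1 : r x₀ z := (h.not_iff hzx).1 hz1
        have h2 : r' x₀ y := (h'.not_iff hne.symm).1 hn
        have h3 := h.trans _ _ _ hry h1
        have h4 := h'.trans _ _ _ hz.2 h2
        rw [hrr _ _ hy z.2] at h3
        exact h'.asymm h3 h4
    have hbase : ∀ y, x₀ ≠ y → Tied σ (fun x => (g x : ℕ)) x₀ y → (r₁ x₀ y ↔ r₂ x₀ y) := by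
      intro y hne ht
      by_cases hy : p y
      · rw [h₁.agree_comm h₂ hne]
        exact ⟨fun h => hsub r₁ r₂ h₁ h₂ hβ hcard y hy ht h hne,
          fun h => hsub r₂ r₁ h₂ h₁ (fun x y hx hy => (hβ x y hx hy).symm) hcard.symm y hy ht h hne⟩
      · obtain ⟨m, rfl⟩ := hcyc y hy
        obtain ⟨j, hj, e⟩ := hmod m
        rw [e] at ht hne ⊢
        -- A tie of `x₀` with its `j`-th iterate gives `i ∣ 2 * j`; since `0 < j < i`, only `i = 2 *
        -- j` remains.
        have h2 := himin _ (h₁.pow_two_mul_fixes ht)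
        have hj0 : j ≠ 0 := by rintro rfl; simp at hne
        have hij : i = 2 * j := by
          obtain ⟨k, hk⟩ := h2
          have hk1 : k = 1 := by
            have hk2 : k < 2 := by
              by_contra hk2
              have : i * 2 ≤ i * k := Nat.mul_le_mul_left i (by omega)
              omega
            have : k ≠ 0 := by rintro rfl; omega
            omega
          subst hk1; omega
        have hjh : i / 2 = j := by omega
        have hHP : HalfPeriodic v := by
          refine ⟨⟨j, by omega⟩, fun l hl => ?_⟩
          rw [← hv₁]
          simp only
          rw [pow_add, Equiv.Perm.mul_apply, hjh]
          exact Fin.ext (ht l)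
        simp only [hHP, true_and, hjh] at hbit
        exact iff_of_eq hbit
    have hleft : ∀ x y, ¬ p x → x ≠ y → (r₁ x y ↔ r₂ x y) := by
      intro x y hx hne
      by_cases ht : Tied σ (fun x => (g x : ℕ)) x y
      · obtain ⟨m, rfl⟩ := hcyc x hx
        obtain ⟨j, hj, e⟩ := hmod m
        rw [e] at ht hne ⊢
        -- A comparison at any point of the cycle is rotated on to one at `x₀`.
        have e2 : (σ ^ (i - j)) ((σ ^ j) x₀) = x₀ := by
          rw [← Equiv.Perm.mul_apply, ← pow_add, Nat.sub_add_cancel hj.le, hi]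
        rw [h₁.agree_pow h₂ hne (i - j) fun l _ => ht l, e2]
        refine hbase _ (fun h => hne ?_) fun l => ?_
        · exact (σ ^ (i - j)).injective (e2.trans h)
        · have := ht (l + (i - j))
          rw [pow_add, Equiv.Perm.mul_apply, Equiv.Perm.mul_apply, e2] at this
          exact this
      · exact h₁.agree_of_not_tied h₂ ht
    have hall : r₁ = r₂ := by
      funext x y
      refine propext ?_
      by_cases hxy : x = y
      · subst hxy
        exact iff_of_false (h₁.irrefl x) (h₂.irrefl x)
      by_cases hx : p x
      · by_cases hy : p y
        · exact hβ x y hx hy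
        · rw [h₁.agree_comm h₂ hxy]
          exact hleft y x hy (Ne.symm hxy)
      · exact hleft x y hx hxy
    rw [hall]

open Classical in
/-- Removing a cycle of length `i`. -/
theorem card_signedConfigs_le_mul (hp : ∀ x, p (σ x) ↔ p x) {x₀ : α} {i : ℕ}
    (hcyc : ∀ x, ¬ p x → ∃ j, (σ ^ j) x₀ = x) (hi0 : 0 < i) (hi : (σ ^ i) x₀ = x₀)
    (himin : ∀ m, (σ ^ m) x₀ = x₀ → i ∣ m) :
    (signedConfigs σ B).card ≤ (signedConfigs (σ.subtypePerm hp) B).card *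
      (B ^ i + B ^ (i / 2) + 2 * Fintype.card {x // p x}) := by
  have hmaps : ∀ c ∈ signedConfigs σ B, restrictConfig p c ∈ signedConfigs (σ.subtypePerm hp) B := by
    intro c hc
    simp only [signedConfigs, Finset.mem_filter, Finset.mem_univ, true_and] at hc ⊢
    exact hc.restrict hp
  rw [Finset.card_eq_sum_card_fiberwise hmaps, ← smul_eq_mul, ← Finset.sum_const]
  refine Finset.sum_le_sum fun c₀ _ => ?_
  rw [Finset.card_eq_sum_card_fiberwise (t := Finset.univ)
    (f := fun c => (fun j : Fin i => c.1 ((σ ^ (j : ℕ)) x₀))) (fun _ _ => Finset.mem_coe.2 (Finset.mem_univ _))]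
  simp only [Finset.filter_filter]
  -- Each remaining point reads exactly one word of length `i`, so the `τ v` add up to the number of
  -- remaining points: ties cost only an additive term.
  set τ : (Fin i → Fin B) → ℕ := fun v => (Finset.univ.filter fun y : {x // p x} =>
        ∀ j : Fin i, c₀.1 (((σ.subtypePerm hp) ^ (j : ℕ)) y) = v j).card with hτ
  have hτsum : ∑ v, τ v = Fintype.card {x // p x} := by
    have := Finset.card_eq_sum_card_fiberwise (s := (Finset.univ : Finset {x // p x}))
      (t := (Finset.univ : Finset (Fin i → Fin B)))
      (f := fun y (j : Fin i) => c₀.1 (((σ.subtypePerm hp) ^ (j : ℕ)) y)) (fun _ _ => Finset.mem_coe.2 (Finset.mem_univ _))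
    rw [Finset.card_univ] at this
    rw [this]
    refine Finset.sum_congr rfl fun v _ => ?_
    simp only [hτ, funext_iff]
  calc _ ≤ ∑ v : Fin i → Fin B, (τ v + 1) * (if HalfPeriodic v then 2 else 1) :=
        Finset.sum_le_sum fun v _ => card_config_fiber_le hp hcyc hi0 hi himin c₀ v
    _ ≤ ∑ v : Fin i → Fin B, (2 * τ v + 1 + if HalfPeriodic v then 1 else 0) := by
        refine Finset.sum_le_sum fun v _ => ?_
        split_ifs <;> omega
    _ = 2 * Fintype.card {x // p x} + B ^ i +
        (Finset.univ.filter fun v : Fin i → Fin B => HalfPeriodic v).card := by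
        rw [Finset.sum_add_distrib, Finset.sum_add_distrib, ← Finset.mul_sum, hτsum,
          Finset.card_filter]
        simp
    _ ≤ _ := by
        have := card_halfPeriodic_le i B
        omega

end CycleRemoval

/-! ### Conjugates and invariant orders. -/

theorem SignedLex.irrefl {α : Type*} {σ : Equiv.Perm α} {g : α → ℕ} {r : α → α → Prop}
    (hr : ∀ x, ¬ r x x) (x : α) : ¬ SignedLex σ g r x x := by
  simp [SignedLex, hr]

/-- Relabelling by τ carries the standard order and the letters of a compatible sequence back to the
points on which σ acts. Conversely, an invariant order ranks the points, and the ranking is τ. -/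
theorem sum_enrichedCount_conj {n : ℕ} (σ : Equiv.Perm (Fin n)) (B : ℕ) :
    ∑ τ : Equiv.Perm (Fin n), enrichedCount (τ * σ * τ⁻¹) B = (signedConfigs σ B).card := by
  classical
  simp only [enrichedCount]
  rw [← Nat.card_sigma, ← Fintype.card_coe (signedConfigs σ B), ← Nat.card_eq_fintype_card]
  have hconj : ∀ (τ : Equiv.Perm (Fin n)) (f : Fin n → Fin B) (x y : Fin n),
      SignedLex (τ * σ * τ⁻¹) (fun i => (f i : ℕ)) (· < ·) (τ x) (τ y) ↔
      SignedLex σ (fun x => (f (τ x) : ℕ)) (fun x y => τ x < τ y) x y := by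
    intro τ f x y
    simp [SignedLex]
  refine Nat.card_eq_of_bijective (fun q : (τ : Equiv.Perm (Fin n)) ×
      {f : Fin n → Fin B // Enriched (τ * σ * τ⁻¹) f} =>
    (⟨(fun x => q.2.1 (q.1 x), fun x y => q.1 x < q.1 y), ?_⟩ :
      {c // c ∈ signedConfigs σ B})) ⟨?_, ?_⟩
  · obtain ⟨τ, f, hf⟩ := q
    simp only [signedConfigs, Finset.mem_filter, Finset.mem_univ, true_and]
    refine ⟨fun x => lt_irrefl _, fun x y z => lt_trans, fun x y hxy => ?_, fun x y => ?_⟩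
    · exact lt_or_gt_of_ne fun h => hxy (τ.injective h)
    · rw [← hconj]
      -- Compatibility gives one implication; both relations being strict and total, the converse
      -- follows.
      refine ⟨hf _ _, fun h => ?_⟩
      by_contra hn
      have hirr := SignedLex.irrefl (σ := τ * σ * τ⁻¹) (g := fun i => (f i : ℕ))
        (r := fun x y : Fin n => x < y) (fun x => lt_irrefl x)
      rcases eq_or_lt_of_le (not_lt.1 hn) with h' | h'
      · rw [h'] at h
        exact hirr _ h
      · exact hirr _ (SignedLex.trans (fun a b c => lt_trans (a := a) (b := b) (c := c)) h
          (hf _ _ h'))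
  · rintro ⟨τ, f, hf⟩ ⟨τ', f', hf'⟩ h
    simp only [Subtype.mk.injEq, Prod.mk.injEq] at h
    obtain ⟨h1, h2⟩ := h
    have hτ : τ = τ' := by
      have hm : StrictMono (τ' * τ⁻¹) := by
        intro x y hxy
        have := congrFun (congrFun h2 (τ⁻¹ x)) (τ⁻¹ y)
        simp only [Equiv.Perm.inv_def, Equiv.apply_symm_apply, eq_iff_iff] at this
        exact this.1 hxy
      have e : ⇑(τ' * τ⁻¹) = id := by
        have := Subsingleton.elim (hm.orderIsoOfSurjective _ (τ' * τ⁻¹).surjective)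
          (OrderIso.refl (Fin n))
        funext x
        exact congrArg (fun e : Fin n ≃o Fin n => e x) this
      refine Equiv.ext fun x => ?_
      have := congrFun e (τ x)
      simpa using this.symm
    subst hτ
    have hff : f = f' := by
      funext x
      have := congrFun h1 (τ⁻¹ x)
      simpa using this
    subst hff
    rfl
  · rintro ⟨⟨g, r⟩, h⟩
    simp only [signedConfigs, Finset.mem_filter, Finset.mem_univ, true_and] at h
    -- The rank of a point is the number of points before it.
    set ρ : Fin n → Fin n := fun x => ⟨(Finset.univ.filter fun y => r y x).card, by
      have : (Finset.univ.filter fun y => r y x) ⊂ Finset.univ := by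
        rw [Finset.filter_ssubset]
        exact ⟨x, Finset.mem_univ _, h.irrefl x⟩
      simpa using Finset.card_lt_card this⟩ with hρ
    have hlt : ∀ x y, r x y → ρ x < ρ y := by
      intro x y hxy
      rw [Fin.lt_def]
      simp only [hρ]
      refine Finset.card_lt_card (Finset.ssubset_iff_subset_ne.2 ⟨?_, fun e => ?_⟩)
      · intro z hz
        simp only [Finset.mem_filter, Finset.mem_univ, true_and] at hz ⊢
        exact h.trans _ _ _ hz hxy
      · have : x ∈ Finset.univ.filter fun z => r z y := by simpa using hxy
        rw [← e] at this
        simp only [Finset.mem_filter, Finset.mem_univ, true_and] at this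
        exact h.irrefl x this
    have hiff : ∀ x y, ρ x < ρ y ↔ r x y := by
      refine fun x y => ⟨fun hxy => ?_, hlt x y⟩
      by_contra hn
      by_cases e : x = y
      · rw [e] at hxy; exact lt_irrefl _ hxy
      · exact lt_asymm hxy (hlt _ _ ((h.not_iff e).1 hn))
    have hinj : Function.Injective ρ := by
      intro x y hxy
      by_contra hne
      rcases h.total x y hne with h' | h'
      · exact (hlt _ _ h').ne hxy
      · exact (hlt _ _ h').ne hxy.symm
    let τ : Equiv.Perm (Fin n) := Equiv.ofBijective ρ (Finite.injective_iff_bijective.1 hinj)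
    have hτ : ∀ x, τ x = ρ x := fun x => rfl
    refine ⟨⟨τ, fun i => g (τ⁻¹ i), ?_⟩, ?_⟩
    · intro i j hij
      obtain ⟨x, rfl⟩ := τ.surjective i
      obtain ⟨y, rfl⟩ := τ.surjective j
      rw [hconj]
      simp only [Equiv.Perm.inv_def, Equiv.symm_apply_apply]
      have hr : (fun x y => τ x < τ y) = r := by
        funext x y; exact propext (by rw [hτ, hτ]; exact hiff x y)
      rw [hr, ← h.lex, ← hiff]
      exact hij
    · refine Subtype.ext (Prod.ext ?_ ?_)
      · funext x; simp
      · funext x y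
        exact propext (by simp only [hτ]; exact hiff x y)

theorem card_signedConfigs_le_of_equiv {α β : Type*} [Fintype α] [Fintype β] {σ : Equiv.Perm α}
    {σ' : Equiv.Perm β} (e : α ≃ β) (he : ∀ x, e (σ x) = σ' (e x)) (B : ℕ) :
    (signedConfigs σ B).card ≤ (signedConfigs σ' B).card := by
  classical
  refine Finset.card_le_card_of_injOn
    (fun c => (fun x => c.1 (e.symm x), fun x y => c.2 (e.symm x) (e.symm y))) ?_ ?_
  · rintro ⟨g, r⟩ h
    simp only [signedConfigs, Finset.coe_filter, Finset.mem_univ, true_and, Set.mem_ofPred_eq] at h ⊢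
    have he' : ∀ x, σ (e.symm x) = e.symm (σ' x) := fun x => by
      rw [Equiv.eq_symm_apply, he, Equiv.apply_symm_apply]
    refine ⟨fun x => h.irrefl _, fun x y z => h.trans _ _ _,
      fun x y hxy => h.total _ _ fun h => hxy (e.symm.injective h), fun x y => ?_⟩
    rw [h.lex]
    simp only [SignedLex, he']
  · rintro ⟨g, r⟩ - ⟨g', r'⟩ - h
    simp only [Prod.mk.injEq] at h
    refine Prod.ext ?_ ?_
    · funext x
      simpa using congrFun h.1 (e x)
    · funext x y
      simpa using congrFun (congrFun h.2 (e x)) (e y)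

/-- All conjugates of the identity coincide, which produces the factorial. -/
theorem card_signedConfigs_one {α : Type*} [Fintype α] (B : ℕ) :
    (signedConfigs (1 : Equiv.Perm α) B).card =
      (Fintype.card α).factorial * enrichedCount (1 : Equiv.Perm (Fin (Fintype.card α))) B := by
  classical
  have h := sum_enrichedCount_conj (1 : Equiv.Perm (Fin (Fintype.card α))) B
  simp only [mul_one, mul_inv_cancel, Finset.sum_const, Finset.card_univ, Fintype.card_perm,
    Fintype.card_fin, smul_eq_mul] at h
  rw [h]
  exact le_antisymm (card_signedConfigs_le_of_equiv (Fintype.equivFin α) (fun x => rfl) B)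
    (card_signedConfigs_le_of_equiv (Fintype.equivFin α).symm (fun x => rfl) B)

open Classical in
theorem exists_cycle_removal {α : Type*} [Fintype α] (σ : Equiv.Perm α) {x₀ : α}
    (hx₀ : σ x₀ ≠ x₀) :
    ∃ (p : α → Prop) (hp : ∀ x, p (σ x) ↔ p x) (i : ℕ), 2 ≤ i ∧
      Fintype.card {x // p x} + i = Fintype.card α ∧
      Nat.card {x : {x // p x} // (σ.subtypePerm hp) x = x} = Nat.card {x // σ x = x} ∧
      ∀ B, (signedConfigs σ B).card ≤ (signedConfigs (σ.subtypePerm hp) B).card *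
        (B ^ i + B ^ (i / 2) + 2 * Fintype.card {x // p x}) := by
  obtain ⟨p, hpdef⟩ : ∃ p : α → Prop, ∀ x, p x ↔ ¬ σ.SameCycle x₀ x := ⟨_, fun _ => Iff.rfl⟩
  have hp : ∀ x, p (σ x) ↔ p x := fun x => by simp [hpdef]
  set i := Function.minimalPeriod σ x₀ with hidef
  have hpowit : ∀ m, (σ ^ m) x₀ = σ^[m] x₀ := fun m => by rw [Equiv.Perm.iterate_eq_pow]
  have hiter : (σ ^ i) x₀ = x₀ := by
    rw [hpowit]; exact Function.iterate_minimalPeriod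
  have himin : ∀ m, (σ ^ m) x₀ = x₀ → i ∣ m := fun m hm => by
    rw [hpowit] at hm
    exact Function.IsPeriodicPt.minimalPeriod_dvd hm
  have hi0 : 0 < i := by
    refine Function.IsPeriodicPt.minimalPeriod_pos (orderOf_pos σ) ?_
    rw [Function.IsPeriodicPt, Function.IsFixedPt, ← hpowit, pow_orderOf_eq_one]; rfl
  have hi2 : 2 ≤ i := by
    by_contra h
    have : i = 1 := by omega
    rw [this] at hiter
    exact hx₀ (by simpa using hiter)
  have hcyc : ∀ x, ¬ p x → ∃ j, (σ ^ j) x₀ = x := fun x hx => by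
    obtain ⟨j, -, hj⟩ := (not_not.1 (mt (hpdef x).2 hx)).exists_pow_eq''
    exact ⟨j, hj.2⟩
  have hci : Fintype.card {x // ¬ p x} = i := by
    rw [← Fintype.card_fin i]
    refine (Fintype.card_of_bijective (f := fun j : Fin i => (⟨(σ ^ (j : ℕ)) x₀, ?_⟩ : {x // ¬ p x}))
      ⟨?_, ?_⟩).symm
    · simp only [hpdef, not_not]; exact ⟨j, by simp⟩
    · intro j l h
      simp only [Subtype.mk.injEq] at h
      have key : ∀ a b : ℕ, a < i → b < i → a < b → (σ ^ a) x₀ = (σ ^ b) x₀ → False := by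
        intro a b ha hb hab hh
        have : (σ ^ a) ((σ ^ (b - a)) x₀) = (σ ^ a) x₀ := by
          rw [← Equiv.Perm.mul_apply, ← pow_add, Nat.add_sub_cancel' hab.le, hh]
        have h2 := Nat.le_of_dvd (by omega) (himin _ ((σ ^ a).injective this))
        omega
      rcases lt_trichotomy (j : ℕ) l with h1 | h1 | h1
      · exact (key _ _ j.2 l.2 h1 h).elim
      · exact Fin.ext h1
      · exact (key _ _ l.2 j.2 h1 h.symm).elim
    · rintro ⟨x, hx⟩
      obtain ⟨k, rfl⟩ := hcyc x hx
      refine ⟨⟨k % i, Nat.mod_lt _ hi0⟩, Subtype.ext ?_⟩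
      simp only [hpowit]
      rw [hidef, Function.iterate_mod_minimalPeriod_eq]
  have hcard : Fintype.card {x // p x} + i = Fintype.card α := by
    rw [← hci, ← Fintype.card_sum]
    exact Fintype.card_congr (Equiv.sumCompl p)
  have hfixβ : Nat.card {x : {x // p x} // (σ.subtypePerm hp) x = x} =
      Nat.card {x // σ x = x} := by
    refine Nat.card_eq_of_bijective (fun x : {x : {x // p x} // (σ.subtypePerm hp) x = x} =>
      (⟨x.1.1, congrArg Subtype.val x.2⟩ : {x // σ x = x})) ⟨?_, ?_⟩
    · intro x y h
      exact Subtype.ext (Subtype.ext (congrArg (fun z : {x // σ x = x} => (z : α)) h))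
    · rintro ⟨x, hx⟩
      refine ⟨⟨⟨x, ?_⟩, Subtype.ext hx⟩, rfl⟩
      rw [hpdef]
      rintro ⟨k, hk⟩
      have : x₀ = x := by
        rw [Equiv.Perm.eq_inv_iff_eq.2 hk |>.trans]
        have : (σ ^ k)⁻¹ = σ ^ (-k) := by simp
        rw [this, Equiv.Perm.zpow_apply_eq_self_of_apply_eq_self hx]
      exact hx₀ (this ▸ hx)
  exact ⟨p, hp, i, hi2, hcard, hfixβ,
    fun B => card_signedConfigs_le_mul (B := B) hp hcyc hi0 hiter himin⟩

/-- The factor is at most B^i D with D = 1 + 1/B + 2N/B². Weakening D to D^i makes the bound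
multiplicative in the cycle length, so that only the total length of the nontrivial cycles matters.
-/
theorem cycle_factor_le {B N C i : ℕ} (hB : 0 < B) (hi : 2 ≤ i) (hC : C ≤ N) :
    ((B ^ i + B ^ (i / 2) + 2 * C : ℕ) : ℝ) ≤ ((B : ℝ) * (1 + 1 / B + 2 * N / B ^ 2)) ^ i := by
  have hBR : (1 : ℝ) ≤ B := by exact_mod_cast hB
  have hBR0 : (0 : ℝ) < B := by linarith
  set D : ℝ := 1 + 1 / B + 2 * N / B ^ 2 with hD
  have hD1 : 1 ≤ D := by
    have : (0 : ℝ) ≤ 1 / B + 2 * N / B ^ 2 := by positivity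
    linarith
  push_cast
  have h1 : (B : ℝ) ^ (i / 2) ≤ B ^ (i - 1) := pow_le_pow_right₀ hBR (by omega)
  have h2 : (C : ℝ) ≤ N := by exact_mod_cast hC
  have h3 : (1 : ℝ) ≤ B ^ (i - 2) := one_le_pow₀ hBR
  calc (B : ℝ) ^ i + B ^ (i / 2) + 2 * C
      ≤ B ^ i + B ^ (i - 1) + 2 * N * B ^ (i - 2) := by
        have : (2 : ℝ) * C ≤ 2 * N * B ^ (i - 2) := by
          calc (2 : ℝ) * C ≤ 2 * N * 1 := by linarith
            _ ≤ _ := by gcongr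
        linarith
    _ = B ^ i * D := by
        obtain ⟨k, hk⟩ : ∃ k, i = k + 2 := ⟨i - 2, by omega⟩
        rw [hk, hD]
        simp only [Nat.add_sub_cancel, show k + 2 - 1 = k + 1 by omega]
        field_simp
        ring
    _ ≤ B ^ i * D ^ i := by
        gcongr
        exact le_self_pow₀ hD1 (by omega)
    _ = _ := by rw [mul_pow]

open Classical in
/-- The number of configurations is at most the number for the fixed points alone, times a generic
factor. -/
theorem card_signedConfigs_le {B N : ℕ} (hB : 0 < B) (m : ℕ) :
    ∀ (M : ℕ) {α : Type*} [Fintype α] (σ : Equiv.Perm α), Fintype.card α = M → M ≤ N →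
    Nat.card {x // σ x = x} = m →
    ((signedConfigs σ B).card : ℝ) ≤
      (m.factorial * enrichedCount (1 : Equiv.Perm (Fin m)) B : ℕ) *
        ((B : ℝ) * (1 + 1 / B + 2 * N / B ^ 2)) ^ (M - m) := by
  intro M
  induction M using Nat.strong_induction_on with
  | _ M ih =>
  intro α _ σ hM hMN hm
  by_cases hfix : ∀ x, σ x = x
  · have h1 : σ = 1 := Equiv.ext hfix
    subst h1
    have hmM : m = M := by
      rw [← hm, ← hM, ← Nat.card_eq_fintype_card]
      exact Nat.card_congr (Equiv.subtypeUnivEquiv fun x => rfl)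
    subst hmM
    rw [card_signedConfigs_one, hM]
    simp
  · push Not at hfix
    obtain ⟨x₀, hx₀⟩ := hfix
    obtain ⟨p, hp, i, hi2, hcard, hfixβ, hstep⟩ := exists_cycle_removal σ hx₀
    have hih := ih (Fintype.card {x // p x}) (by omega) (σ.subtypePerm hp) rfl (by omega)
      (hfixβ.trans hm)
    have hmle : m ≤ Fintype.card {x // p x} := by
      rw [← hm, ← hfixβ, Nat.card_eq_fintype_card]; exact Fintype.card_subtype_le _
    have hfac := cycle_factor_le (N := N) hB hi2 (show Fintype.card {x // p x} ≤ N by omega)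
    have hstep' := (Nat.cast_le (α := ℝ)).2 (hstep B)
    rw [Nat.cast_mul] at hstep'
    refine (hstep'.trans (mul_le_mul hih hfac (Nat.cast_nonneg _) (by positivity))).trans_eq ?_
    rw [mul_assoc, ← pow_add]
    congr 2
    omega

/-! ### Lower bound: letter assignments without ties. -/

section GoodWords

variable {γ : Type*} [Fintype γ]

-- Overwriting the letter at `y` loses nothing, since it equals the letter at `x`.
open Classical in
theorem card_eq_letter_mul_le (B : ℕ) {x y : γ} (hxy : x ≠ y) :
    (Finset.univ.filter fun g : γ → Fin B => g x = g y).card * B ≤ B ^ Fintype.card γ := by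
  have h1 : B ^ Fintype.card γ = (Finset.univ : Finset (γ → Fin B)).card := by simp
  rw [h1, ← Finset.card_fin B, ← Finset.card_product, Finset.card_fin B]
  refine Finset.card_le_card_of_injOn (fun q => Function.update q.1 y q.2)
    (fun _ _ => Finset.mem_coe.2 (Finset.mem_univ _)) ?_
  rintro ⟨g, b⟩ hg ⟨g', b'⟩ hg' h
  simp only [Finset.coe_product, Set.mem_prod, Finset.mem_coe, Finset.mem_filter, Finset.mem_univ,
    true_and, and_true] at hg hg'
  have h' : ∀ z, Function.update g y b z = Function.update g' y b' z := congrFun h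
  have hx := h' x
  rw [Function.update_of_ne hxy, Function.update_of_ne hxy] at hx
  refine Prod.ext (funext fun z => ?_) (by simpa using h' y)
  by_cases hz : z = y
  · subst hz; simp only; rw [← hg, ← hg', hx]
  · simpa [Function.update_of_ne hz] using h' z

-- Both overwritten letters are recoverable: the one at `y` from `x`, then the one at `y'` from
-- `x'`, where `x' = y` is allowed.
open Classical in
theorem card_two_eq_letters_mul_le (B : ℕ) {x y x' y' : γ} (hyy : y ≠ y') (hxy : x ≠ y)
    (hxy' : x ≠ y') (hx' : x' ≠ y') :
    (Finset.univ.filter fun g : γ → Fin B => g x = g y ∧ g x' = g y').card * B ^ 2 ≤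
      B ^ Fintype.card γ := by
  have h1 : B ^ Fintype.card γ = (Finset.univ : Finset (γ → Fin B)).card := by simp
  have h2 : B ^ 2 = (Finset.univ : Finset (Fin B × Fin B)).card := by simp [sq]
  rw [h1, h2, ← Finset.card_product]
  refine Finset.card_le_card_of_injOn
    (fun q => Function.update (Function.update q.1 y q.2.1) y' q.2.2)
    (fun _ _ => Finset.mem_coe.2 (Finset.mem_univ _)) ?_
  rintro ⟨g, b, c⟩ hg ⟨g', b', c'⟩ hg' h
  simp only [Finset.coe_product, Set.mem_prod, Finset.mem_coe, Finset.mem_filter, Finset.mem_univ,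
    true_and, and_true] at hg hg'
  have h' : ∀ z, Function.update (Function.update g y b) y' c z =
    Function.update (Function.update g' y b') y' c' z := congrFun h
  have hrest : ∀ z, z ≠ y → z ≠ y' → g z = g' z := fun z hz hz' => by
    simpa [Function.update_of_ne hz, Function.update_of_ne hz'] using h' z
  have hy : g y = g' y := by rw [← hg.1, ← hg'.1, hrest x hxy hxy']
  have hx'' : g x' = g' x' := by
    by_cases e : x' = y
    · rw [e, hy]
    · exact hrest _ e hx'
  have hy' : g y' = g' y' := by rw [← hg.2, ← hg'.2, hx'']
  refine Prod.ext (funext fun z => ?_) (Prod.ext ?_ ?_)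
  · by_cases hz : z = y
    · subst hz; exact hy
    · by_cases hz' : z = y'
      · subst hz'; exact hy'
      · exact hrest z hz hz'
  · simpa [Function.update_of_ne hyy] using h' y
  · simpa using h' y'

open Classical in
/-- Almost all letter assignments have no ties, for a permutation without fixed points. -/
theorem card_untied_ge (σ : Equiv.Perm γ) (hσ : ∀ x, σ x ≠ x) {B : ℕ} (hB : 0 < B) :
    ∃ G : Finset (γ → Fin B), (∀ g ∈ G, ∀ x y, x ≠ y → ¬ Tied σ (fun x => (g x : ℕ)) x y) ∧
      (B : ℝ) ^ Fintype.card γ * (1 - Fintype.card γ / B - (Fintype.card γ : ℝ) ^ 2 / B ^ 2) ≤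
        G.card := by
  refine ⟨Finset.univ.filter fun g : γ → Fin B =>
    ∀ x y, x ≠ y → ¬ Tied σ (fun x => (g x : ℕ)) x y, fun g hg => (Finset.mem_filter.1 hg).2, ?_⟩
  have hB0 : (0 : ℝ) < B := by exact_mod_cast hB
  set k := Fintype.card γ with hk
  -- Only the first two letters of each word are compared. The two equations are independent and
  -- cost B², unless `x` and `y` form a 2-cycle; that leaves one equation, for at most one `y` per
  -- `x`.
  set bad : γ → γ → Finset (γ → Fin B) := fun x y =>
    if x = y then ∅ else Finset.univ.filter fun g => g x = g y ∧ g (σ x) = g (σ y) with hbad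
  have hbadle : ∀ x y, ((bad x y).card : ℝ) ≤
      (if y = σ x then (B : ℝ) ^ k / B else 0) + (B : ℝ) ^ k / B ^ 2 := by
    intro x y
    by_cases hxy : x = y
    · simp only [hbad, hxy, if_true, Finset.card_empty]
      simp only [(hσ y).symm, if_false, Nat.cast_zero]
      positivity
    simp only [hbad, hxy, if_false]
    by_cases h1 : y = σ x ∧ x = σ y
    · rw [if_pos h1.1]
      have h2 := card_eq_letter_mul_le B hxy
      have h3 : (Finset.univ.filter fun g : γ → Fin B => g x = g y ∧ g (σ x) = g (σ y)).card ≤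
        (Finset.univ.filter fun g : γ → Fin B => g x = g y).card :=
        Finset.card_le_card fun g hg => by
          simp only [Finset.mem_filter, Finset.mem_univ, true_and] at hg ⊢
          exact hg.1
      have h4 : ((Finset.univ.filter fun g : γ → Fin B => g x = g y).card : ℝ) ≤ (B : ℝ) ^ k / B := by
        rw [le_div_iff₀ hB0]; exact_mod_cast h2
      have h5 : (0 : ℝ) ≤ (B : ℝ) ^ k / B ^ 2 := by positivity
      have h6 : ((Finset.univ.filter fun g : γ → Fin B => g x = g y ∧ g (σ x) = g (σ y)).card : ℝ) ≤
        (Finset.univ.filter fun g : γ → Fin B => g x = g y).card := by exact_mod_cast h3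
      linarith
    · have h2 : (Finset.univ.filter fun g : γ → Fin B => g x = g y ∧ g (σ x) = g (σ y)).card * B ^ 2 ≤
          B ^ k := by
        by_cases h3 : x = σ y
        · have h4 : y ≠ σ x := fun h => h1 ⟨h, h3⟩
          have := card_two_eq_letters_mul_le B (x := y) (y := x) (x' := σ y) (y' := σ x)
            (hσ x).symm (Ne.symm hxy) h4 (fun h => hxy (σ.injective h.symm))
          refine le_trans (le_of_eq ?_) this
          congr 2
          ext g
          simp only [Finset.mem_filter, Finset.mem_univ, true_and]
          exact and_congr eq_comm eq_comm
        · exact card_two_eq_letters_mul_le B (hσ y).symm hxy h3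
            (fun h => hxy (σ.injective h))
      have h3 : ((Finset.univ.filter fun g : γ → Fin B => g x = g y ∧ g (σ x) = g (σ y)).card : ℝ) ≤
          (B : ℝ) ^ k / B ^ 2 := by
        rw [le_div_iff₀ (by positivity)]; exact_mod_cast h2
      have h5 : (0 : ℝ) ≤ if y = σ x then (B : ℝ) ^ k / B else 0 := by positivity
      linarith
  have hcover : (Finset.univ : Finset (γ → Fin B)) ⊆
      (Finset.univ.filter fun g : γ → Fin B =>
        ∀ x y, x ≠ y → ¬ Tied σ (fun x => (g x : ℕ)) x y) ∪
      (Finset.univ ×ˢ Finset.univ).biUnion fun q : γ × γ => bad q.1 q.2 := by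
    intro g _
    rw [Finset.mem_union]
    by_cases h : ∀ x y, x ≠ y → ¬ Tied σ (fun x => (g x : ℕ)) x y
    · left; simpa using h
    · right
      push Not at h
      obtain ⟨x, y, hxy, ht⟩ := h
      refine Finset.mem_biUnion.2 ⟨(x, y), by simp, ?_⟩
      simp only [hbad, hxy, if_false, Finset.mem_filter, Finset.mem_univ, true_and]
      exact ⟨Fin.ext (ht 0), Fin.ext (by simpa using ht 1)⟩
  have h1 := (Finset.card_le_card hcover).trans (Finset.card_union_le _ _)
  have h2 := h1.trans (Nat.add_le_add_left Finset.card_biUnion_le _)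
  rw [Finset.card_univ, Fintype.card_fun, Fintype.card_fin, ← hk] at h2
  have h3 : (B : ℝ) ^ k ≤ (Finset.univ.filter fun g : γ → Fin B =>
        ∀ x y, x ≠ y → ¬ Tied σ (fun x => (g x : ℕ)) x y).card +
      ∑ q ∈ (Finset.univ ×ˢ Finset.univ : Finset (γ × γ)), ((bad q.1 q.2).card : ℝ) := by
    exact_mod_cast h2
  have h4 : ∑ q ∈ (Finset.univ ×ˢ Finset.univ : Finset (γ × γ)), ((bad q.1 q.2).card : ℝ) ≤
      k * ((B : ℝ) ^ k / B) + k ^ 2 * ((B : ℝ) ^ k / B ^ 2) := by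
    rw [Finset.sum_product]
    calc _ ≤ ∑ x : γ, ∑ y : γ, ((if y = σ x then (B : ℝ) ^ k / B else 0) + (B : ℝ) ^ k / B ^ 2) :=
          Finset.sum_le_sum fun x _ => Finset.sum_le_sum fun y _ => hbadle x y
      _ = _ := by
          simp only [Finset.sum_add_distrib, Finset.sum_ite_eq', Finset.mem_univ, if_true,
            Finset.sum_const, Finset.card_univ, nsmul_eq_mul, ← hk]
          ring
  have h5 : (B : ℝ) ^ k * (1 - k / B - (k : ℝ) ^ 2 / B ^ 2) =
      (B : ℝ) ^ k - (k * ((B : ℝ) ^ k / B) + k ^ 2 * ((B : ℝ) ^ k / B ^ 2)) := by ring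
  rw [h5]
  linarith

end GoodWords

/-! ### Lower bound: extending orders from the fixed points. -/

section Extension

theorem SignedLex.total {α : Type*} {σ : Equiv.Perm α} {g : α → ℕ} {r : α → α → Prop}
    (hr : ∀ x y, x ≠ y → r x y ∨ r y x) {x y : α} (hxy : x ≠ y) :
    SignedLex σ g r x y ∨ SignedLex σ g r y x := by
  unfold SignedLex
  rcases lt_trichotomy (g x) (g y) with h | h | h
  · exact Or.inl (Or.inl h)
  · have h1 := hr (σ x) (σ y) fun h => hxy (σ.injective h)
    rw [h]
    simp only [lt_irrefl, false_or, true_and]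
    tauto
  · exact Or.inr (Or.inl h)

/-- Applying the operator more than `j` times exposes the `j`-th letters, so the starting relation
is forgotten where they differ. -/
theorem iterate_signedLex_agree {α : Type*} {σ : Equiv.Perm α} {g : α → ℕ} (s s' : α → α → Prop)
    (j : ℕ) : ∀ (k : ℕ) (x y : α), j < k → g ((σ ^ j) x) ≠ g ((σ ^ j) y) →
    ((SignedLex σ g)^[k] s x y ↔ (SignedLex σ g)^[k] s' x y) := by
  induction j with
  | zero =>
    intro k x y hk hg
    obtain ⟨k, rfl⟩ := Nat.exists_eq_succ_of_ne_zero hk.ne'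
    simp only [Function.iterate_succ_apply']
    simp only [pow_zero, Equiv.Perm.one_apply] at hg
    simp [SignedLex, hg]
  | succ j ih =>
    intro k x y hk hg
    obtain ⟨k, rfl⟩ := Nat.exists_eq_succ_of_ne_zero (by omega : k ≠ 0)
    simp only [Function.iterate_succ_apply']
    rw [pow_succ, Equiv.Perm.mul_apply, Equiv.Perm.mul_apply] at hg
    have h1 := ih k (σ x) (σ y) (by omega) hg
    have h2 := ih k (σ y) (σ x) (by omega) hg.symm
    simp only [SignedLex, h1, h2]

/-- Any total order extending `r₁` is iterated `orderOf σ` times under the operator. Words that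
differ do so within `orderOf σ` letters, so untied pairs have stabilised. Tied pairs of distinct
points consist of fixed points, on which the operator changes nothing. -/
theorem exists_signedOrder_extension {n : ℕ} (σ : Equiv.Perm (Fin n)) (g : Fin n → ℕ)
    (r₁ : {x // σ x = x} → {x // σ x = x} → Prop)
    (h₁ : SignedOrder (1 : Equiv.Perm {x // σ x = x}) (fun x => g x) r₁)
    (hgood : ∀ x y, σ x ≠ x → σ y ≠ y → x ≠ y → ¬ Tied σ g x y) :
    ∃ r, SignedOrder σ g r ∧ ∀ x y : {x // σ x = x}, r x y ↔ r₁ x y := by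
  classical
  set r₀ : Fin n → Fin n → Prop := fun x y =>
    (∃ (hx : σ x = x) (hy : σ y = y), r₁ ⟨x, hx⟩ ⟨y, hy⟩) ∨ (σ x = x ∧ σ y ≠ y) ∨
      (σ x ≠ x ∧ σ y ≠ y ∧ x < y) with hr₀
  set Λ := SignedLex σ g with hΛ
  have hst : ∀ k, (∀ x, ¬ Λ^[k] r₀ x x) ∧
      (∀ x y z, Λ^[k] r₀ x y → Λ^[k] r₀ y z → Λ^[k] r₀ x z) ∧
      (∀ x y, x ≠ y → Λ^[k] r₀ x y ∨ Λ^[k] r₀ y x) := by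
    intro k
    induction k with
    | zero =>
      simp only [Function.iterate_zero, id]
      refine ⟨fun x => ?_, fun x y z => ?_, fun x y hxy => ?_⟩
      · rintro (⟨hx, hy, h⟩ | ⟨h, h'⟩ | ⟨_, _, h⟩)
        · exact h₁.irrefl _ h
        · exact h' h
        · exact lt_irrefl _ h
      · rintro (⟨hx, hy, h⟩ | ⟨h, h'⟩ | ⟨hx, hy, h⟩) (⟨hx', hy', h2⟩ | ⟨h2, h2'⟩ | ⟨hx', hy', h2⟩)
        · exact Or.inl ⟨hx, hy', h₁.trans _ _ _ h h2⟩
        · exact Or.inr (Or.inl ⟨hx, h2'⟩)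
        · exact absurd hy hx'
        · exact absurd hx' h'
        · exact absurd h2 h'
        · exact Or.inr (Or.inl ⟨h, hy'⟩)
        · exact absurd hx' hy
        · exact absurd h2 hy
        · exact Or.inr (Or.inr ⟨hx, hy', h.trans h2⟩)
      · by_cases hx : σ x = x <;> by_cases hy : σ y = y
        · rcases h₁.total ⟨x, hx⟩ ⟨y, hy⟩ (fun h => hxy (congrArg Subtype.val h)) with h | h
          · exact Or.inl (Or.inl ⟨hx, hy, h⟩)
          · exact Or.inr (Or.inl ⟨hy, hx, h⟩)
        · exact Or.inl (Or.inr (Or.inl ⟨hx, hy⟩))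
        · exact Or.inr (Or.inr (Or.inl ⟨hy, hx⟩))
        · rcases lt_or_gt_of_ne hxy with h | h
          · exact Or.inl (Or.inr (Or.inr ⟨hx, hy, h⟩))
          · exact Or.inr (Or.inr (Or.inr ⟨hy, hx, h⟩))
    | succ k ih =>
      simp only [Function.iterate_succ_apply']
      exact ⟨SignedLex.irrefl ih.1, fun x y z h h' => SignedLex.trans ih.2.1 h h',
        fun x y hxy => SignedLex.total ih.2.2 hxy⟩
  -- With an even letter, invariance on two fixed points would read `r₁ x y ↔ r₁ y x`.
  have hodd : ∀ x y (hx : σ x = x) (hy : σ y = y), x ≠ y → g x = g y → Odd (g x) := by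
    intro x y hx hy hxy hg
    by_contra ho
    have := h₁.iff_of_not_odd (x := ⟨x, hx⟩) (y := ⟨y, hy⟩) hg ho
    simp only [Equiv.Perm.one_apply] at this
    rcases h₁.total ⟨x, hx⟩ ⟨y, hy⟩ (fun h => hxy (congrArg Subtype.val h)) with h | h
    · exact h₁.asymm h (this.1 h)
    · exact h₁.asymm h (this.2 h)
  have hstepfix : ∀ s x y, σ x = x → σ y = y → x ≠ y → g x = g y → (Λ s x y ↔ s x y) := by
    intro s x y hx hy hxy hg
    have ho := hodd x y hx hy hxy hg
    simp only [hΛ, SignedLex, hx, hy]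
    rw [← hg]
    simp [ho]
  have hfixr : ∀ k x y, σ x = x → σ y = y → x ≠ y → g x = g y → (Λ^[k] r₀ x y ↔ r₀ x y) := by
    intro k x y hx hy hxy hg
    induction k with
    | zero => rfl
    | succ k ih => rw [Function.iterate_succ_apply', hstepfix _ x y hx hy hxy hg, ih]
  have hr₀r₁ : ∀ x y : {x // σ x = x}, r₀ x y ↔ r₁ x y := by
    intro x y
    simp only [hr₀, x.2, y.2, ne_eq, not_true_eq_false, and_false, false_and, or_false,
      Subtype.coe_eta, exists_const]
  obtain ⟨hirr, htr, htot⟩ := hst (orderOf σ)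
  have hlex : ∀ x y, Λ^[orderOf σ] r₀ x y ↔ Λ (Λ^[orderOf σ] r₀) x y := by
    intro x y
    by_cases hxy : x = y
    · subst hxy
      exact iff_of_false (hirr x) (SignedLex.irrefl hirr x)
    by_cases ht : Tied σ g x y
    -- A point tied to a fixed point has a constant word, hence is tied to its own image.
    · have hmixed : ∀ x y, σ x = x → Tied σ g x y → σ y = y := by
        intro x y hx ht
        by_contra hy
        refine hgood y (σ y) hy (fun h => hy (σ.injective h)) (Ne.symm hy) fun j => ?_
        have hxj : ∀ j, (σ ^ j) x = x := fun j =>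
          Equiv.Perm.pow_apply_eq_self_of_apply_eq_self hx j
        have e1 := ht j
        have e2 := ht (j + 1)
        rw [hxj] at e1 e2
        rw [← Equiv.Perm.mul_apply, ← pow_succ, ← e1, ← e2]
      by_cases hx : σ x = x
      · rw [hstepfix _ x y hx (hmixed x y hx ht) hxy (by simpa using ht 0)]
      · by_cases hy : σ y = y
        · exact absurd (hmixed y x hy fun j => (ht j).symm) hx
        · exact absurd ht (hgood x y hx hy hxy)
    · have hdiff : ∃ j < orderOf σ, g ((σ ^ j) x) ≠ g ((σ ^ j) y) := by
        simp only [Tied, not_forall] at ht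
        obtain ⟨j, hj⟩ := ht
        refine ⟨j % orderOf σ, Nat.mod_lt _ (orderOf_pos σ), ?_⟩
        rwa [pow_mod_orderOf]
      obtain ⟨j, hjlt, hj⟩ := hdiff
      rw [← Function.iterate_succ_apply' Λ, Function.iterate_succ_apply]
      exact iterate_signedLex_agree _ _ j _ x y hjlt hj
  refine ⟨Λ^[orderOf σ] r₀, ⟨hirr, htr, htot, hlex⟩, fun x y => ?_⟩
  by_cases hxy : x = y
  · subst hxy
    exact iff_of_false (hirr _) (h₁.irrefl _)
  have hxy' : (x : Fin n) ≠ y := fun h => hxy (Subtype.ext h)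
  by_cases hg : g x = g y
  · rw [hfixr _ _ _ x.2 y.2 hxy' hg, hr₀r₁]
  · rw [hlex, h₁.iff_of_lt hg]
    simp [hΛ, SignedLex, hg]

-- Gluing is injective because the extended order restricts to the given one on the fixed points.
open Classical in
theorem card_fixed_mul_card_untied_le {n : ℕ} (σ : Equiv.Perm (Fin n)) (B : ℕ)
    (hq : ∀ x, σ (σ x) ≠ σ x ↔ σ x ≠ x) (G : Finset ({x // σ x ≠ x} → Fin B))
    (hG : ∀ g ∈ G, ∀ x y, x ≠ y → ¬ Tied (σ.subtypePerm (p := fun x => σ x ≠ x) hq)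
      (fun x => (g x : ℕ)) x y) :
    (signedConfigs (1 : Equiv.Perm {x // σ x = x}) B).card * G.card ≤
      (signedConfigs σ B).card := by
  have hex : ∀ q : (({x // σ x = x} → Fin B) × ({x // σ x = x} → {x // σ x = x} → Prop)) ×
      ({x // σ x ≠ x} → Fin B), q ∈ signedConfigs (1 : Equiv.Perm {x // σ x = x}) B ×ˢ G →
      ∃ r, SignedOrder σ (fun x => ((if h : σ x = x then q.1.1 ⟨x, h⟩ else q.2 ⟨x, h⟩ : Fin B) : ℕ)) r ∧
        ∀ x y : {x // σ x = x}, r x y ↔ q.1.2 x y := by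
    rintro ⟨⟨g₁, r₁⟩, g₂⟩ hq'
    simp only [signedConfigs, Finset.mem_product, Finset.mem_filter, Finset.mem_univ,
      true_and] at hq'
    obtain ⟨h1, h2⟩ := hq'
    replace h2 := hG _ h2
    refine exists_signedOrder_extension σ _ r₁ ?_ ?_
    · convert h1 using 3 with x
      rw [dif_pos x.2]
    · intro x y hx hy hxy ht
      refine h2 ⟨x, hx⟩ ⟨y, hy⟩ (fun h => hxy (congrArg Subtype.val h)) fun j => ?_
      have := ht j
      simp only at this
      have hnf : ∀ x, σ x ≠ x → σ ((σ ^ j) x) ≠ (σ ^ j) x := fun x hx =>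
        (pow_mem_iff (p := fun x => σ x ≠ x) hq j x).2 hx
      rw [dif_neg (hnf x hx), dif_neg (hnf y hy)] at this
      have e : ∀ x (hx : σ x ≠ x), ((σ.subtypePerm (p := fun x => σ x ≠ x) hq) ^ j) ⟨x, hx⟩ =
          ⟨(σ ^ j) x, hnf x hx⟩ := fun x hx =>
        Subtype.ext (subtypePerm_pow_val (p := fun x => σ x ≠ x) hq j ⟨x, hx⟩)
      rw [e x hx, e y hy]
      exact this
  choose! R hR1 hR2 using hex
  rw [← Finset.card_product]
  refine Finset.card_le_card_of_injOn (fun q =>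
    ((fun x => if h : σ x = x then q.1.1 ⟨x, h⟩ else q.2 ⟨x, h⟩), R q)) ?_ ?_
  · intro q hq'
    simp only [signedConfigs, Finset.coe_filter, Finset.mem_univ, true_and, Set.mem_ofPred_eq]
    exact hR1 q hq'
  · intro q hq1 q' hq1' h
    simp only [Prod.mk.injEq] at h
    obtain ⟨h1, h2⟩ := h
    refine Prod.ext (Prod.ext ?_ ?_) ?_
    · funext x
      have := congrFun h1 x
      simpa only [dif_pos x.2] using this
    · funext x y
      refine propext ?_
      rw [← hR2 q hq1, ← hR2 q' hq1', h2]
    · funext x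
      have := congrFun h1 x
      simpa only [dif_neg x.2] using this

theorem card_signedConfigs_ge {n : ℕ} (σ : Equiv.Perm (Fin n)) {B : ℕ} (hB : 0 < B) {m : ℕ}
    (hm : Nat.card {x // σ x = x} = m) :
    (m.factorial * enrichedCount (1 : Equiv.Perm (Fin m)) B : ℕ) *
      ((B : ℝ) ^ (n - m) * (1 - n / B - (n : ℝ) ^ 2 / B ^ 2)) ≤ (signedConfigs σ B).card := by
  classical
  have hq : ∀ x, σ (σ x) ≠ σ x ↔ σ x ≠ x := fun x => by rw [ne_eq, σ.injective.eq_iff]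
  obtain ⟨G, hG, hgood⟩ := card_untied_ge (σ.subtypePerm (p := fun x => σ x ≠ x) hq)
    (fun x h => x.2 (congrArg Subtype.val h)) hB
  have hle := card_fixed_mul_card_untied_le σ B hq G hG
  have hm' : Fintype.card {x // σ x = x} = m := by rw [← hm, Nat.card_eq_fintype_card]
  rw [card_signedConfigs_one, hm'] at hle
  have hk : Fintype.card {x // σ x ≠ x} = n - m := by
    have := Fintype.card_subtype_compl (fun x => σ x = x)
    rw [Fintype.card_fin, hm'] at this
    exact this
  rw [hk] at hgood
  have hle' := (Nat.cast_le (α := ℝ)).2 hle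
  rw [Nat.cast_mul] at hle'
  refine le_trans (mul_le_mul_of_nonneg_left (le_trans ?_ hgood) (Nat.cast_nonneg _)) hle'
  have hnm : ((n - m : ℕ) : ℝ) ≤ n := by exact_mod_cast Nat.sub_le n m
  gcongr

end Extension

/-! ### Averages over a conjugacy class. -/

section ClassAverage

variable {n : ℕ}

theorem cycleClass_conj_mem (lam : n.Partition) (τ σ : Equiv.Perm (Fin n)) :
    τ * σ * τ⁻¹ ∈ cycleClass lam ↔ σ ∈ cycleClass lam := by
  have h : (τ * σ * τ⁻¹).partition = σ.partition :=
    Equiv.Perm.partition_eq_of_isConj.1 (isConj_iff.2 ⟨τ⁻¹, by group⟩)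
  simp only [cycleClass, Finset.mem_filter, Finset.mem_univ, true_and, h]

/-- Conjugation by any τ permutes the class, so all n! values of τ give the same sum. -/
theorem factorial_mul_sum_enrichedCount (lam : n.Partition) (B : ℕ) :
    n.factorial * ∑ π ∈ cycleClass lam, enrichedCount π B =
      ∑ σ ∈ cycleClass lam, (signedConfigs σ B).card := by
  simp only [← sum_enrichedCount_conj]
  rw [Finset.sum_comm]
  have h : ∀ τ : Equiv.Perm (Fin n), ∑ σ ∈ cycleClass lam, enrichedCount (τ * σ * τ⁻¹) B =
      ∑ π ∈ cycleClass lam, enrichedCount π B := fun τ =>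
    Finset.sum_equiv (MulAut.conj τ).toEquiv
      (fun σ => (cycleClass_conj_mem lam τ σ).symm) (fun σ _ => rfl)
  rw [Finset.sum_congr rfl fun τ _ => h τ, Finset.sum_const, Finset.card_univ, Fintype.card_perm,
    Fintype.card_fin, smul_eq_mul]

theorem card_fixed_of_mem_cycleClass {lam : n.Partition} {σ : Equiv.Perm (Fin n)}
    (hσ : σ ∈ cycleClass lam) : Nat.card {x // σ x = x} = lam.parts.count 1 := by
  classical
  simp only [cycleClass, Finset.mem_filter, Finset.mem_univ, true_and] at hσ
  rw [← hσ, Equiv.Perm.parts_partition, Multiset.count_add, Multiset.count_replicate_self,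
    Multiset.count_eq_zero.2 (fun h => by have := Equiv.Perm.two_le_of_mem_cycleType h; omega),
    zero_add, Nat.card_eq_fintype_card, Fintype.card_subtype, ← Finset.card_compl]
  congr 1
  ext x
  simp

theorem cycleClass_nonempty (lam : n.Partition) : (cycleClass lam).Nonempty := by
  classical
  set M := lam.parts.filter (fun x => 2 ≤ x) with hM
  have hsplit : M + Multiset.replicate (lam.parts.count 1) 1 = lam.parts := by
    conv_rhs => rw [← Multiset.filter_add_not (fun x => 2 ≤ x) lam.parts]
    congr 1
    rw [← Multiset.filter_eq']
    refine Multiset.filter_congr fun x hx => ?_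
    have := lam.parts_pos hx
    omega
  have hsum : M.sum + lam.parts.count 1 = n := by
    have := congrArg Multiset.sum hsplit
    rw [Multiset.sum_add, Multiset.sum_replicate, lam.parts_sum, smul_eq_mul, mul_one] at this
    exact this
  obtain ⟨σ, hσ⟩ := (Equiv.Perm.exists_with_cycleType_iff (Fin n) (m := M)).2
    ⟨by rw [Fintype.card_fin]; omega, fun a ha => (Multiset.mem_filter.1 ha).2⟩
  refine ⟨σ, ?_⟩
  simp only [cycleClass, Finset.mem_filter, Finset.mem_univ, true_and]
  rw [Equiv.Perm.parts_partition, ← Equiv.Perm.sum_cycleType, hσ, Fintype.card_fin]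
  conv_rhs => rw [← hsplit]
  congr 2
  omega

/-- The mean number of compatible letter sequences with `2 * a` letters over a conjugacy class. -/
noncomputable def meanCount (lam : n.Partition) (a : ℕ) : ℝ :=
  uniformExp (cycleClass lam) fun π => (enrichedCount π (2 * a) : ℝ)

theorem meanCount_mono (hn : 0 < n) (lam : n.Partition) : Monotone (meanCount lam) := by
  intro a b h
  unfold meanCount uniformExp
  gcongr with π
  simp only [Nat.cast_le]
  exact enrichedCount_mono hn π (by omega)

theorem meanCount_nonneg (lam : n.Partition) (a : ℕ) : 0 ≤ meanCount lam a := by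
  unfold meanCount uniformExp; positivity

theorem meanCount_hasSum (hn : 0 < n) (lam : n.Partition) {t : ℝ} (ht0 : 0 < t) (ht1 : t < 1) :
    HasSum (fun a => meanCount lam a * t ^ a)
      ((4 * t / (1 + t) ^ 2) / 2 * ((1 + t) / (1 - t)) ^ (n + 1) *
        uniformExp (cycleClass lam) fun π => (4 * t / (1 + t) ^ 2) ^ peaks π) := by
  have h := (hasSum_sum (s := cycleClass lam)
    fun π _ => hasSum_enrichedCount hn π ht0 ht1).div_const ((cycleClass lam).card : ℝ)
  unfold meanCount uniformExp
  rw [← Finset.mul_sum, mul_div_assoc] at h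
  refine h.congr_fun fun a => ?_
  rw [div_mul_eq_mul_div, Finset.sum_mul]

theorem meanCount_bounds (lam : n.Partition) {a m : ℕ} (ha : 0 < a) (hm : lam.parts.count 1 = m) :
    (m.factorial * enrichedCount (1 : Equiv.Perm (Fin m)) (2 * a) : ℕ) *
      (((2 * a : ℕ) : ℝ) ^ (n - m) * (1 - n / (2 * a : ℕ) - (n : ℝ) ^ 2 / (2 * a : ℕ) ^ 2)) ≤
      n.factorial * meanCount lam a ∧
    n.factorial * meanCount lam a ≤
      (m.factorial * enrichedCount (1 : Equiv.Perm (Fin m)) (2 * a) : ℕ) *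
        (((2 * a : ℕ) : ℝ) * (1 + 1 / (2 * a : ℕ) + 2 * n / (2 * a : ℕ) ^ 2)) ^ (n - m) := by
  have hcard : (0 : ℝ) < (cycleClass lam).card := by
    exact_mod_cast Finset.card_pos.2 (cycleClass_nonempty lam)
  have h : (n.factorial : ℝ) * meanCount lam a =
      (∑ σ ∈ cycleClass lam, ((signedConfigs σ (2 * a)).card : ℝ)) / (cycleClass lam).card := by
    have := factorial_mul_sum_enrichedCount lam (2 * a)
    unfold meanCount uniformExp
    rw [← mul_div_assoc]
    congr 1
    simp only
    exact_mod_cast this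
  rw [h, le_div_iff₀ hcard, div_le_iff₀ hcard]
  have hconst : ∀ x : ℝ, x * (cycleClass lam).card = ∑ _σ ∈ cycleClass lam, x := fun x => by
    rw [Finset.sum_const, nsmul_eq_mul, mul_comm]
  rw [hconst, hconst]
  exact ⟨Finset.sum_le_sum fun σ hσ => card_signedConfigs_ge σ (by omega)
      ((card_fixed_of_mem_cycleClass hσ).trans hm),
    Finset.sum_le_sum fun σ hσ => card_signedConfigs_le (by omega) m n σ (Fintype.card_fin n)
      le_rfl ((card_fixed_of_mem_cycleClass hσ).trans hm)⟩

end ClassAverage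

/-! ### The count for the identity and its recursion. -/

section FixedPoints

/-- The normalized number of compatible letter sequences for the identity, by its three-term
recursion. -/
noncomputable def fixedFactor (b : ℝ) : ℕ → ℝ
  | 0 => 1
  | 1 => 1
  | k + 2 => fixedFactor b (k + 1) + (k + 1) * k / b * fixedFactor b k

/-- The number of compatible letter sequences of length `m` with `2 * a` letters for the
identity. -/
noncomputable def identityCount : ℕ → ℕ → ℕ
  | 0, _ => 1
  | k + 1, a => ∑ l ∈ Finset.range (2 * a), prefixCount (fun _ => True) k l

theorem prefixCount_congr {asc asc' : ℕ → Prop} {k : ℕ} (h : ∀ i < k, asc i ↔ asc' i) (l : ℕ) :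
    prefixCount asc k l = prefixCount asc' k l := by
  induction k generalizing l with
  | zero => rfl
  | succ k ih =>
    have ih' := ih fun i hi => h i (by omega)
    have hk : asc k = asc' k := propext (h k (Nat.lt_succ_self k))
    simp only [prefixCount, ih']
    congr 1
    split_ifs <;> simp_all

theorem enrichedCount_one (m a : ℕ) :
    enrichedCount (1 : Equiv.Perm (Fin m)) (2 * a) = identityCount m a := by
  cases m with
  | zero =>
    rw [enrichedCount, identityCount]
    have : Unique {f : Fin 0 → Fin (2 * a) // Enriched (1 : Equiv.Perm (Fin 0)) f} :=
      { default := ⟨Fin.elim0, fun i => i.elim0⟩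
        uniq := fun f => Subtype.ext (Subsingleton.elim _ _) }
    exact Nat.card_unique
  | succ k =>
    rw [enrichedCount_succ, identityCount]
    refine Finset.sum_congr rfl fun l _ => prefixCount_congr (fun i hi => ?_) l
    simp only [iff_true]
    exact ⟨by omega, by simp⟩

/-- The two new letters are treated by the last letter of the sequence: deleting a final `2 * a`,
which cannot repeat, leaves smaller letters only, while a final `2 * a + 1` may repeat. -/
theorem identityCount_step (m a : ℕ) : identityCount (m + 1) (a + 1) =
    identityCount (m + 1) a + (identityCount m (a + 1) + identityCount m a) := by
  cases m with
  | zero => simp [identityCount, prefixCount]; ring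
  | succ k =>
    rw [identityCount, identityCount, Nat.mul_succ, Finset.sum_range_succ, Finset.sum_range_succ,
      identityCount, identityCount, Nat.mul_succ, Finset.sum_range_succ, Finset.sum_range_succ]
    have h1 : ¬ Odd (2 * a) := by simp
    have h2 : Odd (2 * a + 1) := by simp
    simp only [prefixCount, h1, h2, Finset.sum_range_succ]
    simp
    ring

/-- These counts are the coefficients of y = ((1+x)/(1-x))^a, and the recursion is the coefficient
form of (1-x²)y' = 2ay. The proof is a double induction from `identityCount_step`. -/
theorem identityCount_recursion (m a : ℕ) :
    (m + 2) * identityCount (m + 2) a = 2 * a * identityCount (m + 1) a + m * identityCount m a := by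
  have h1 : ∀ a, identityCount 1 a = 2 * a := fun a => by simp [identityCount, prefixCount]
  induction m generalizing a with
  | zero =>
    induction a with
    | zero => simp [identityCount]
    | succ a ih =>
      rw [identityCount_step]
      simp only [h1, zero_mul, add_zero, zero_add] at ih ⊢
      nlinarith
  | succ m ihm =>
    induction a with
    | zero => cases m <;> simp [identityCount]
    | succ a ih =>
      have e1 := identityCount_step (m + 2) a
      have e2 := identityCount_step (m + 1) a
      have e3 := identityCount_step m a
      have e4 := ihm a
      have e5 := ihm (a + 1)
      zify at *
      rw [show (m : ℤ) + 1 + 2 = m + 3 by ring] at *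
      simp only [show m + 1 + 2 = m + 2 + 1 by ring, show m + 1 + 1 = m + 2 by ring] at *
      linear_combination (m + 3 : ℤ) * e1 + ih + e4 + e5 - (2 * a + 1 : ℤ) * e2 - (m : ℤ) * e3

theorem factorial_mul_identityCount (m : ℕ) {a : ℕ} (ha : 0 < a) :
    ((m.factorial * identityCount m a : ℕ) : ℝ) =
      ((2 * a : ℕ) : ℝ) ^ m * fixedFactor (4 * (a : ℝ) ^ 2) m := by
  have ha' : (a : ℝ) ≠ 0 := by positivity
  induction m using Nat.strong_induction_on with
  | _ m ih =>
  match m with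
  | 0 => simp [identityCount, fixedFactor]
  | 1 => simp [identityCount, fixedFactor, prefixCount]
  | m + 2 =>
    have h1 := ih m (by omega)
    have h2 := ih (m + 1) (by omega)
    have h3 := identityCount_recursion m a
    have h3' : ((m : ℝ) + 2) * identityCount (m + 2) a =
      2 * a * identityCount (m + 1) a + m * identityCount m a := by exact_mod_cast h3
    rw [fixedFactor, mul_add]
    rw [Nat.factorial_succ, Nat.factorial_succ] at *
    push_cast at *
    have e1 : (2 * (a : ℝ)) ^ (m + 2) * fixedFactor (4 * (a : ℝ) ^ 2) (m + 1) =
      2 * a * (((m : ℝ) + 1) * m.factorial * identityCount (m + 1) a) := by rw [h2]; ring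
    have e2 : (2 * (a : ℝ)) ^ (m + 2) * (((m : ℝ) + 1) * m / (4 * (a : ℝ) ^ 2) *
        fixedFactor (4 * (a : ℝ) ^ 2) m) =
      ((m : ℝ) + 1) * m * (m.factorial * identityCount m a) := by
      rw [h1]; field_simp; ring
    rw [e1, e2]
    linear_combination ((m : ℝ) + 1) * m.factorial * h3'

end FixedPoints

/-! ### Asymptotics of the fixed-point factor. -/

section FixedFactor

theorem abs_log_one_add_sub_le {v : ℝ} (hv : |v| ≤ 1 / 2) :
    |Real.log (1 + v) - (v - v ^ 2 / 2)| ≤ 2 * |v| ^ 3 := by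
  have h := Real.abs_log_sub_add_sum_range_le (x := -v) (by rw [abs_neg]; linarith) 2
  simp only [Finset.sum_range_succ, Finset.range_zero, Finset.sum_empty, abs_neg] at h
  have h2 : |v| ^ (2 + 1) / (1 - |v|) ≤ 2 * |v| ^ 3 := by
    rw [div_le_iff₀ (by linarith)]
    have : 0 ≤ |v| ^ 3 := by positivity
    norm_num
    nlinarith
  refine le_trans (le_of_eq ?_) (h.trans h2)
  congr 1
  push_cast
  ring_nf

theorem fixedFactor_ge_one {b : ℝ} (hb : 0 < b) (k : ℕ) :
    1 ≤ fixedFactor b k ∧ fixedFactor b k ≤ fixedFactor b (k + 1) := by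
  induction k with
  | zero => simp [fixedFactor]
  | succ k ih =>
    have h1 : 1 ≤ fixedFactor b (k + 1) := ih.1.trans ih.2
    refine ⟨h1, ?_⟩
    rw [fixedFactor]
    have : 0 ≤ ((k : ℝ) + 1) * k / b * fixedFactor b k := by
      have := ih.1
      positivity
    linarith

/-- The argument of the logarithm is a ratio recursion unrolled twice. With z, z' ≈ x the increment
is v ≈ x - x², and v - v²/2 gives x - 3x²/2. -/
theorem log_step_bound {x e z z' ρ : ℝ} (hx1 : x ≤ 1 / 2) (he : 0 ≤ e)
    (hz0 : 0 ≤ z) (hz1 : x - e ≤ z) (hz2 : z ≤ x) (hz0' : 0 ≤ z') (hz1' : x - 3 * e ≤ z')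
    (hz2' : z' ≤ x) (hρ1 : 1 ≤ ρ) (hρ2 : ρ ≤ 1 + x) :
    |Real.log (1 + z / (1 + z' / ρ)) - (x - 3 / 2 * x ^ 2)| ≤ 4 * e + 5 * x ^ 3 := by
  have hx0 : 0 ≤ x := hz0.trans hz2
  have hρ0 : 0 < ρ := by linarith
  set u := z' / ρ with hu
  have hu0 : 0 ≤ u := by positivity
  have huρ : u * ρ = z' := by rw [hu]; field_simp
  have hux : u ≤ x := by
    have : u ≤ u * ρ := le_mul_of_one_le_right hu0 hρ1
    linarith
  have hul : x - 3 * e - x ^ 2 ≤ u := by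
    have h1 : u * ρ ≤ u * (1 + x) := mul_le_mul_of_nonneg_left hρ2 hu0
    have h2 : u * x ≤ x * x := mul_le_mul_of_nonneg_right hux hx0
    nlinarith
  set v := z / (1 + u) with hv
  have hv0 : 0 ≤ v := by positivity
  have hvz : v * (1 + u) = z := by rw [hv]; field_simp
  have hvx : v ≤ x := by
    have : 0 ≤ v * u := by positivity
    nlinarith
  have huv : u * v ≤ x * x := mul_le_mul hux hvx hv0 hx0
  have hvl : x - e - x ^ 2 ≤ v := by nlinarith
  have h1 : |u * v - x ^ 2| ≤ 4 * e * x + 2 * x ^ 3 := by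
    rw [abs_le]
    constructor
    · have e1 : (x - u) * v ≤ (3 * e + x ^ 2) * x :=
        mul_le_mul (by linarith) hvx hv0 (by positivity)
      have e2 : x * (x - v) ≤ x * (e + x ^ 2) := mul_le_mul_of_nonneg_left (by linarith) hx0
      nlinarith
    · have : 0 ≤ 4 * e * x + 2 * x ^ 3 := by positivity
      nlinarith
  have hex : e * x ≤ e * (1 / 2) := mul_le_mul_of_nonneg_left hx1 he
  have h2 : |v - (x - x ^ 2)| ≤ 3 * e + 2 * x ^ 3 := by
    rw [abs_le] at h1 ⊢
    have : v = z - u * v := by linarith [hvz]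
    constructor <;> nlinarith
  have h3 : |v ^ 2 - x ^ 2| ≤ 2 * x * (e + x ^ 2) := by
    rw [abs_le]
    constructor
    · have e1 : (x - v) * (x + v) ≤ (e + x ^ 2) * (2 * x) :=
        mul_le_mul (by linarith) (by linarith) (by linarith) (by positivity)
      nlinarith
    · have : 0 ≤ 2 * x * (e + x ^ 2) := by positivity
      nlinarith
  have h4 := abs_log_one_add_sub_le (v := v) (by rw [abs_of_nonneg hv0]; linarith)
  rw [abs_of_nonneg hv0] at h4
  have h5 : v ^ 3 ≤ x ^ 3 := pow_le_pow_left₀ hv0 hvx 3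
  rw [abs_le] at h2 h3 h4 ⊢
  have hx3 : 0 ≤ x ^ 3 := by positivity
  constructor <;> nlinarith

/-- Consecutive ratios satisfy R_{k+1} = 1 + (k+1)k/(b R_k). Two uses of this reduce to
`log_step_bound`, the shifts of the index costing O(n/b). -/
theorem fixedFactor_log_step {b : ℝ} (hb : 0 < b) {n k : ℕ} (hk : k + 1 ≤ n)
    (hZ : (n : ℝ) ^ 2 / b ≤ 1 / 2) :
    |Real.log (fixedFactor b (k + 1)) - Real.log (fixedFactor b k) -
      ((k : ℝ) ^ 2 / b - 3 / 2 * ((k : ℝ) ^ 2 / b) ^ 2)| ≤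
      4 * (n / b) + 5 * ((n : ℝ) ^ 2 / b) ^ 3 := by
  have hA : ∀ k, 0 < fixedFactor b k := fun k => lt_of_lt_of_le one_pos (fixedFactor_ge_one hb k).1
  rw [← Real.log_div (hA _).ne' (hA _).ne']
  set R : ℕ → ℝ := fun k => fixedFactor b (k + 1) / fixedFactor b k with hR
  have hR1 : ∀ k, 1 ≤ R k := fun k => (one_le_div (hA k)).2 (fixedFactor_ge_one hb k).2
  have hRs : ∀ k : ℕ, R (k + 1) = 1 + (k + 1) * k / b / R k := by
    intro k
    have h1 := (hA k).ne'
    have h2 := (hA (k + 1)).ne'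
    simp only [hR]
    rw [fixedFactor]
    field_simp
  have hkn : (k : ℝ) + 1 ≤ n := by exact_mod_cast hk
  have hn1 : (1 : ℝ) ≤ n := by have : (0 : ℝ) ≤ k := by positivity
                               linarith
  have hn0 : (0 : ℝ) ≤ n / b := by positivity
  change |Real.log (R k) - _| ≤ _
  have hxZ : (k : ℝ) ^ 2 / b ≤ (n : ℝ) ^ 2 / b := by gcongr; linarith
  have hx3 : ((k : ℝ) ^ 2 / b) ^ 3 ≤ ((n : ℝ) ^ 2 / b) ^ 3 := by gcongr
  match k with
  | 0 =>
    have : R 0 = 1 := by simp [hR, fixedFactor]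
    rw [this]
    simp
    positivity
  | 1 =>
    have : R 1 = 1 := by rw [hRs 0]; simp
    rw [this]
    simp only [Nat.cast_one, one_pow, Real.log_one, zero_sub, abs_neg] at *
    have h1 : 1 / b ≤ n / b := by gcongr
    have h2 : (0 : ℝ) < 1 / b := by positivity
    have h3 : (0 : ℝ) ≤ ((n : ℝ) ^ 2 / b) ^ 3 := by positivity
    rw [abs_le]
    constructor <;> nlinarith
  | k + 2 =>
    have hRle : R k ≤ 1 + ((k + 2 : ℕ) : ℝ) ^ 2 / b := by
      have hx0 : 0 ≤ ((k + 2 : ℕ) : ℝ) ^ 2 / b := by positivity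
      match k with
      | 0 =>
        have : R 0 = 1 := by simp [hR, fixedFactor]
        rw [this]; linarith
      | k + 1 =>
        rw [hRs]
        have h1 : ((k : ℝ) + 1) * k / b / R k ≤ ((k : ℝ) + 1) * k / b := div_le_self (by positivity) (hR1 k)
        have h2 : ((k : ℝ) + 1) * k / b ≤ ((k + 1 + 2 : ℕ) : ℝ) ^ 2 / b := by
          push_cast
          gcongr
          nlinarith [(Nat.cast_nonneg k : (0 : ℝ) ≤ k)]
        linarith
    rw [hRs (k + 1), hRs k]
    have hk0 : (0 : ℝ) ≤ k := Nat.cast_nonneg k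
    push_cast at *
    have := log_step_bound (x := ((k : ℝ) + 2) ^ 2 / b) (e := n / b)
      (z := ((k : ℝ) + 1 + 1) * (k + 1) / b) (z' := ((k : ℝ) + 1) * k / b) (ρ := R k)
      (hxZ.trans hZ) hn0 (by positivity)
      (by rw [← sub_div, div_le_div_iff_of_pos_right hb]; nlinarith)
      (by rw [div_le_div_iff_of_pos_right hb]; nlinarith) (by positivity)
      (by rw [← mul_div_assoc, ← sub_div, div_le_div_iff_of_pos_right hb]; nlinarith)
      (by rw [div_le_div_iff_of_pos_right hb]; nlinarith) (hR1 k) hRle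
    linarith

/-- The steps telescope: k²/b and (3/2)k⁴/b² sum to m³/(3b) and 3m⁵/(10b²), with a discretisation
error O(n/b) per step. -/
theorem abs_log_fixedFactor_le {b : ℝ} (hb : 0 < b) {n m : ℕ} (hm : m ≤ n)
    (hZ : (n : ℝ) ^ 2 / b ≤ 1 / 2) :
    |Real.log (fixedFactor b m) - ((m : ℝ) ^ 3 / (3 * b) - 3 * (m : ℝ) ^ 5 / (10 * b ^ 2))| ≤
      20 * ((n : ℝ) ^ 2 / b + n * ((n : ℝ) ^ 2 / b) ^ 3) := by
  have hkey : |Real.log (fixedFactor b m) -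
      ((m : ℝ) ^ 3 / (3 * b) - 3 * (m : ℝ) ^ 5 / (10 * b ^ 2))| ≤
      m * (20 * (n / b + ((n : ℝ) ^ 2 / b) ^ 3)) := by
    induction m with
    | zero => simp [fixedFactor]
    | succ k ih =>
      have ih' := ih (by omega)
      have hs := fixedFactor_log_step hb hm hZ
      have hkn : (k : ℝ) + 1 ≤ n := by exact_mod_cast hm
      have hk0 : (0 : ℝ) ≤ k := Nat.cast_nonneg k
      have hn1 : (1 : ℝ) ≤ n := by linarith
      set E := (k : ℝ) ^ 2 / b - 3 / 2 * ((k : ℝ) ^ 2 / b) ^ 2 with hE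
      have hd : |((k : ℝ) + 1) ^ 3 / (3 * b) - 3 * ((k : ℝ) + 1) ^ 5 / (10 * b ^ 2) -
          ((k : ℝ) ^ 3 / (3 * b) - 3 * (k : ℝ) ^ 5 / (10 * b ^ 2)) - E| ≤ 15 * (n / b) := by
        have e1 : ((k : ℝ) + 1) ^ 3 / (3 * b) - 3 * ((k : ℝ) + 1) ^ 5 / (10 * b ^ 2) -
          ((k : ℝ) ^ 3 / (3 * b) - 3 * (k : ℝ) ^ 5 / (10 * b ^ 2)) - E =
          (k + 1 / 3) / b - 3 / 10 * ((10 * (k : ℝ) ^ 3 + 10 * k ^ 2 + 5 * k + 1) / b ^ 2) := by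
          rw [hE]; field_simp; ring
        have e2 : ((k : ℝ) + 1 / 3) / b ≤ n / b := by gcongr; linarith
        have e3 : (10 * (k : ℝ) ^ 3 + 10 * k ^ 2 + 5 * k + 1) / b ^ 2 ≤ 26 * (n / b) * (n ^ 2 / b) := by
          rw [show 26 * ((n : ℝ) / b) * (n ^ 2 / b) = 26 * (n : ℝ) ^ 3 / b ^ 2 by field_simp]
          gcongr
          have h1 : (k : ℝ) ^ 3 ≤ n ^ 3 := by gcongr; linarith
          have h2 : (k : ℝ) ^ 2 ≤ n ^ 2 := by gcongr; linarith
          have h3 : (n : ℝ) ^ 2 ≤ n ^ 3 := pow_le_pow_right₀ hn1 (by norm_num)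
          have h4 : (n : ℝ) ≤ n ^ 3 := le_self_pow₀ hn1 (by norm_num)
          linarith
        have e4 : 26 * ((n : ℝ) / b) * (n ^ 2 / b) ≤ 26 * (n / b) * (1 / 2) := by gcongr
        have e5 : 0 ≤ ((k : ℝ) + 1 / 3) / b := by positivity
        have e6 : 0 ≤ (10 * (k : ℝ) ^ 3 + 10 * k ^ 2 + 5 * k + 1) / b ^ 2 := by positivity
        have e7 : 0 ≤ (n : ℝ) / b := by positivity
        rw [e1, abs_le]
        constructor <;> linarith
      push_cast
      have h3 : (0 : ℝ) ≤ ((n : ℝ) ^ 2 / b) ^ 3 := by positivity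
      have e7 : 0 ≤ (n : ℝ) / b := by positivity
      rw [abs_le] at *
      constructor <;> linarith
  refine hkey.trans ?_
  have h3 : (0 : ℝ) ≤ ((n : ℝ) ^ 2 / b) ^ 3 := by positivity
  have e7 : 0 ≤ (n : ℝ) / b := by positivity
  calc (m : ℝ) * (20 * (n / b + ((n : ℝ) ^ 2 / b) ^ 3)) ≤
      n * (20 * (n / b + ((n : ℝ) ^ 2 / b) ^ 3)) := by gcongr
    _ = _ := by ring

end FixedFactor

/-! ### Power sums against an exponential. -/

section PowerSums

-- This is the Lipschitz formula for Σ 1/(z+n)^{N+1} at z = iθ/2π. The term n = 0 is the main term;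
-- relative to it the others are at most θ²/n², uniformly in N ≥ 1.
open Complex in
theorem exists_powerSum_bound : ∃ C : ℝ, 0 < C ∧ ∀ (N : ℕ) (θ : ℝ), 1 ≤ N → 0 < θ → θ ≤ 1 →
    |(∑' a : ℕ, (a : ℝ) ^ N * Real.exp (-θ) ^ a) * θ ^ (N + 1) / N.factorial - 1| ≤ C * θ ^ 2 := by
  have hs2 : Summable fun n : ℤ => 1 / (n : ℝ) ^ 2 := Real.summable_one_div_int_pow.2 (by norm_num)
  refine ⟨(∑' n : ℤ, 1 / (n : ℝ) ^ 2) + 1, ?_, ?_⟩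
  · have : 0 ≤ ∑' n : ℤ, 1 / (n : ℝ) ^ 2 := tsum_nonneg fun n => by positivity
    linarith
  intro N θ hN hθ hθ1
  have hpi := Real.pi_pos
  set y : ℝ := θ / (2 * Real.pi) with hy
  have hy0 : 0 < y := by positivity
  have hyθ : y ≤ θ := by
    rw [hy, div_le_iff₀ (by positivity)]
    nlinarith [Real.pi_gt_three]
  let z : UpperHalfPlane := ⟨y * I, by simpa using hy0⟩
  have hz : (z : ℂ) = y * I := rfl
  have h := EisensteinSeries.qExpansion_identity hN z
  have hexp : cexp (2 * Real.pi * I * z) = (Real.exp (-θ) : ℝ) := by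
    rw [hz, Complex.ofReal_exp]
    congr 1
    rw [hy]
    push_cast
    field_simp
    rw [I_sq]
    ring
  rw [hexp] at h
  set S : ℝ := ∑' a : ℕ, (a : ℝ) ^ N * Real.exp (-θ) ^ a with hS
  have hSc : ∑' n : ℕ, (n : ℂ) ^ N * ((Real.exp (-θ) : ℝ) : ℂ) ^ n = (S : ℂ) := by
    rw [hS, Complex.ofReal_tsum]
    push_cast
    rfl
  rw [hSc] at h
  have hz0 : (z : ℂ) ≠ 0 := by rw [hz]; simp [hy0.ne']
  have hnorm : ∀ n : ℤ, |(n : ℝ)| ≤ ‖(z : ℂ) + n‖ := fun n => by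
    have := Complex.abs_re_le_norm ((z : ℂ) + n)
    simpa [hz] using this
  have hnormz : ‖(z : ℂ)‖ = y := by rw [hz]; simp [abs_of_pos hy0]
  have hterm : ∀ n : ℤ, n ≠ 0 → ‖(z : ℂ) ^ (N + 1) * (1 / ((z : ℂ) + n) ^ (N + 1))‖ ≤
      θ ^ 2 * (1 / (n : ℝ) ^ 2) := by
    intro n hn
    have hn1 : (1 : ℝ) ≤ |(n : ℝ)| := by exact_mod_cast Int.one_le_abs hn
    have hb : 0 < ‖(z : ℂ) + n‖ := lt_of_lt_of_le (by linarith) (hnorm n)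
    rw [norm_mul, norm_div, norm_one, norm_pow, norm_pow, hnormz]
    have h1 : y ^ (N + 1) ≤ θ ^ 2 := by
      calc y ^ (N + 1) ≤ θ ^ (N + 1) := by gcongr
        _ ≤ θ ^ 2 := pow_le_pow_of_le_one hθ.le hθ1 (by omega)
    have h2 : (n : ℝ) ^ 2 ≤ ‖(z : ℂ) + n‖ ^ (N + 1) := by
      rw [← sq_abs]
      calc |(n : ℝ)| ^ 2 ≤ |(n : ℝ)| ^ (N + 1) := pow_le_pow_right₀ hn1 (by omega)
        _ ≤ _ := by gcongr; exact hnorm n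
    have h3 : (0 : ℝ) < (n : ℝ) ^ 2 := by positivity
    gcongr
  have hsumm : Summable fun n : ℤ => (z : ℂ) ^ (N + 1) * (1 / ((z : ℂ) + n) ^ (N + 1)) := by
    refine Summable.of_norm_bounded_eventually (g := fun n : ℤ => θ ^ 2 * (1 / (n : ℝ) ^ 2))
      (hs2.mul_left _) ?_
    rw [Filter.eventually_cofinite]
    refine (Set.finite_singleton (0 : ℤ)).subset fun n hn => ?_
    by_contra h0
    exact hn (hterm n h0)
  have hmain : (S : ℂ) * θ ^ (N + 1) / N.factorial =
      ∑' n : ℤ, (z : ℂ) ^ (N + 1) * (1 / ((z : ℂ) + n) ^ (N + 1)) := by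
    rw [tsum_mul_left, h, ← mul_assoc, ← mul_div_assoc, ← mul_pow]
    have : (z : ℂ) * (-2 * Real.pi * I) = θ := by
      rw [hz, hy]; push_cast; field_simp; rw [I_sq]; ring
    rw [this]
    ring
  rw [hsumm.tsum_eq_add_tsum_ite 0] at hmain
  have hz00 : (z : ℂ) ^ (N + 1) * (1 / ((z : ℂ) + (0 : ℤ)) ^ (N + 1)) = 1 := by
    simp only [Int.cast_zero, add_zero]
    field_simp
  rw [hz00] at hmain
  have hb : ‖∑' n : ℤ, if n = 0 then (0 : ℂ) else (z : ℂ) ^ (N + 1) * (1 / ((z : ℂ) + n) ^ (N + 1))‖ ≤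
      ∑' n : ℤ, θ ^ 2 * (1 / (n : ℝ) ^ 2) := by
    refine tsum_of_norm_bounded (hs2.mul_left _).hasSum fun n => ?_
    split_ifs with h0
    · simp [h0]
    · exact hterm n h0
  have hcast : ((S * θ ^ (N + 1) / N.factorial - 1 : ℝ) : ℂ) =
      ∑' n : ℤ, if n = 0 then (0 : ℂ) else (z : ℂ) ^ (N + 1) * (1 / ((z : ℂ) + n) ^ (N + 1)) := by
    push_cast
    rw [hmain]
    ring
  rw [← Real.norm_eq_abs, ← Complex.norm_real, hcast]
  refine hb.trans ?_
  rw [tsum_mul_left]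
  nlinarith [sq_nonneg θ]

end PowerSums

/-! ### Comparing the weight with a pure power. -/

section Laplace

theorem abs_exp_sub_one_le_mul {x M : ℝ} (hM : 1 ≤ M) (hx : Real.exp x ≤ M) :
    |Real.exp x - 1| ≤ M * |x| := by
  have h1 := Real.add_one_le_exp x
  have h2 := Real.add_one_le_exp (-x)
  have h3 : Real.exp x - 1 ≤ x * Real.exp x := by
    have : Real.exp x * Real.exp (-x) = 1 := by rw [← Real.exp_add]; simp
    nlinarith [Real.exp_pos x]
  rcases le_total 0 x with h | h
  · rw [abs_of_nonneg h, abs_of_nonneg (by linarith)]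
    nlinarith
  · rw [abs_of_nonpos h, abs_of_nonpos (by have := Real.exp_le_one_iff.2 h; linarith)]
    nlinarith

theorem abs_exp_sub_one_sub_le_mul {x M : ℝ} (hM : 1 ≤ M) (hx : Real.exp x ≤ M) :
    |Real.exp x - 1 - x| ≤ M * x ^ 2 := by
  have h1 := Real.add_one_le_exp x
  have h2 := Real.add_one_le_exp (-x)
  have h3 : Real.exp x - 1 ≤ x * Real.exp x := by
    have : Real.exp x * Real.exp (-x) = 1 := by rw [← Real.exp_add]; simp
    nlinarith [Real.exp_pos x]
  rw [abs_of_nonneg (by linarith)]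
  have h4 : Real.exp x - 1 - x ≤ x * (Real.exp x - 1) := by linarith
  refine h4.trans ?_
  have h5 : x * (Real.exp x - 1) ≤ |x| * |Real.exp x - 1| := by
    rw [← abs_mul]; exact le_abs_self _
  have h6 := mul_le_mul_of_nonneg_left (abs_exp_sub_one_le_mul hM hx) (abs_nonneg x)
  calc _ ≤ _ := h5
    _ ≤ _ := h6
    _ = _ := by rw [← sq_abs x]; ring

/-- Here l = log ρ with ρ ≥ 1/8, whence 64 = 8² and 4096 = 8⁴. Since j ≈ 2c, the terms of order Q·l
cancel: the quadratic bound serves small l, the linear one large l. The constant is 16515 = 130 +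
16384 + 1. -/
theorem abs_tilt_exponent_le {K Q c d j l : ℝ} (hK : 1 ≤ K) (hQ : 1 ≤ Q) (hc0 : 0 ≤ c)
    (hc : c ≤ K * Q) (hd0 : 0 ≤ d) (hd : d ≤ K) (hj : |j - 2 * c| ≤ 1)
    (b2 : Real.exp (-2 * l) ≤ 64) (b4 : Real.exp (-4 * l) ≤ 4096) :
    |c * (Real.exp (-2 * l) - 1) - d * (Real.exp (-4 * l) - 1) + j * l| ≤
      16515 * K * (Q * |l|) ∧
    |c * (Real.exp (-2 * l) - 1) - d * (Real.exp (-4 * l) - 1) + j * l| ≤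
      16515 * K * ((Q * |l|) ^ 2 + Q * |l|) / Q := by
  set r := c * (Real.exp (-2 * l) - 1) - d * (Real.exp (-4 * l) - 1) + j * l with hr
  have hr' : r = c * (Real.exp (-2 * l) - 1 - (-2 * l)) - d * (Real.exp (-4 * l) - 1) +
      (j - 2 * c) * l := by rw [hr]; ring
  have q1 := abs_exp_sub_one_sub_le_mul (by norm_num) b2
  have q2 := abs_exp_sub_one_le_mul (by norm_num) b2
  have q3 := abs_exp_sub_one_le_mul (by norm_num) b4
  have hl2 : |-2 * l| = 2 * |l| := by rw [abs_mul]; norm_num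
  have hl4 : |-4 * l| = 4 * |l| := by rw [abs_mul]; norm_num
  rw [hl2] at q2
  rw [hl4] at q3
  have q4 : |Real.exp (-2 * l) - 1 - (-2 * l)| ≤ 130 * |l| := by
    have := abs_sub (Real.exp (-2 * l) - 1) (-2 * l)
    rw [hl2] at this
    linarith
  have habs : |r| ≤ c * |Real.exp (-2 * l) - 1 - (-2 * l)| + d * (16384 * |l|) + |l| := by
    rw [hr']
    have a1 : |(j - 2 * c) * l| ≤ |l| := by
      rw [abs_mul]
      exact mul_le_of_le_one_left (abs_nonneg l) hj
    have a2 : |d * (Real.exp (-4 * l) - 1)| ≤ d * (16384 * |l|) := by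
      rw [abs_mul, abs_of_nonneg hd0]
      gcongr
      linarith
    have a3 : |c * (Real.exp (-2 * l) - 1 - (-2 * l))| =
        c * |Real.exp (-2 * l) - 1 - (-2 * l)| := by rw [abs_mul, abs_of_nonneg hc0]
    have a4 := abs_add_le (c * (Real.exp (-2 * l) - 1 - (-2 * l)) - d * (Real.exp (-4 * l) - 1))
      ((j - 2 * c) * l)
    have a5 := abs_sub (c * (Real.exp (-2 * l) - 1 - (-2 * l))) (d * (Real.exp (-4 * l) - 1))
    linarith
  set y := Q * |l| with hy
  have hl0 := abs_nonneg l
  have hy0 : 0 ≤ y := by positivity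
  have hly : |l| ≤ y := le_mul_of_one_le_left hl0 hQ
  have hdl : d * (16384 * |l|) ≤ K * (16384 * |l|) := by gcongr
  have hll : |l| ≤ K * |l| := le_mul_of_one_le_left hl0 hK
  set K1 := 16515 * K with hK1
  constructor
  · have a1 : c * |Real.exp (-2 * l) - 1 - (-2 * l)| ≤ K * Q * (130 * |l|) := by gcongr
    have a2 : K * |l| ≤ K * y := by gcongr
    rw [hK1]
    have : K * Q * (130 * |l|) = 130 * (K * y) := by rw [hy]; ring
    linarith
  · have a1 : c * |Real.exp (-2 * l) - 1 - (-2 * l)| ≤ K * Q * (64 * (-2 * l) ^ 2) := by gcongr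
    have a3 : K * Q * (64 * (-2 * l) ^ 2) = 256 * K * (y ^ 2 / Q) := by
      rw [hy, mul_pow Q, sq_abs]; field_simp; ring
    have a4 : |l| = y / Q := by rw [hy]; field_simp
    have a5 : K1 * (y ^ 2 + y) / Q = K1 * (y ^ 2 / Q) + K1 * |l| := by rw [a4]; ring
    have a6 : 0 ≤ K * (y ^ 2 / Q) := by positivity
    have a7 : 0 ≤ K * |l| := by positivity
    rw [a5, hK1]
    linarith

/-- With r the exponent, |e^r - 1| ≤ e^{|r|}|r| is at most a multiple of (1/Q + η) times an
exponential in Q|log ρ|. The latter is dominated by ρ^V + ρ^{-V}, so the error is again made of pure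
powers. -/
theorem tilt_bound {K Q c d j η δ ρ : ℝ} {V : ℕ} (hK : 1 ≤ K) (hQ : 1 ≤ Q) (hc0 : 0 ≤ c)
    (hc : c ≤ K * Q) (hd0 : 0 ≤ d) (hd : d ≤ K) (hj : |j - 2 * c| ≤ 1) (hη : η ≤ 1)
    (hδ : |δ| ≤ η) (hρ : 1 / 8 ≤ ρ) (hV : (16515 * K + 2) * Q ≤ V) :
    |Real.exp (c * (ρ⁻¹ ^ 2 - 1) - d * (ρ⁻¹ ^ 4 - 1) + j * Real.log ρ + δ) - 1| ≤
      6 * (16515 * K) * (1 / Q + η) * (ρ ^ V + ρ⁻¹ ^ V) := by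
  have hρ0 : 0 < ρ := by linarith
  have hη0 : 0 ≤ η := (abs_nonneg δ).trans hδ
  set l := Real.log ρ with hl
  have hρl : ρ = Real.exp l := (Real.exp_log hρ0).symm
  have hρi : ρ⁻¹ = Real.exp (-l) := by rw [hρl, Real.exp_neg]
  have hρ8 : ρ⁻¹ ≤ 8 := by
    rw [inv_le_comm₀ hρ0 (by norm_num)]; linarith
  have e2 : ρ⁻¹ ^ 2 = Real.exp (-2 * l) := by
    rw [hρi, ← Real.exp_nat_mul]; congr 1; push_cast; ring
  have e4 : ρ⁻¹ ^ 4 = Real.exp (-4 * l) := by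
    rw [hρi, ← Real.exp_nat_mul]; congr 1; push_cast; ring
  have hi0 : 0 ≤ ρ⁻¹ := by positivity
  have b2 : Real.exp (-2 * l) ≤ 64 := by
    rw [← e2]; calc ρ⁻¹ ^ 2 ≤ 8 ^ 2 := by gcongr
      _ = 64 := by norm_num
  have b4 : Real.exp (-4 * l) ≤ 4096 := by
    rw [← e4]; calc ρ⁻¹ ^ 4 ≤ 8 ^ 4 := by gcongr
      _ = 4096 := by norm_num
  set K1 := 16515 * K with hK1
  set y := Q * |l| with hy
  obtain ⟨hr1, hr2⟩ := abs_tilt_exponent_le hK hQ hc0 hc hd0 hd hj b2 b4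
  rw [e2, e4]
  set r := c * (Real.exp (-2 * l) - 1) - d * (Real.exp (-4 * l) - 1) + j * l with hr
  clear_value r
  have hy0 : 0 ≤ y := by positivity
  have hexpy : 1 ≤ Real.exp y := Real.one_le_exp hy0
  have hye : y ≤ Real.exp y := by linarith [Real.add_one_le_exp y]
  have hyy : y ^ 2 + y ≤ 2 * Real.exp (2 * y) := by
    have : Real.exp (2 * y) = Real.exp y ^ 2 := by rw [← Real.exp_nat_mul]; norm_num
    rw [this]; nlinarith
  have hK10 : 1 ≤ K1 := by rw [hK1]; linarith
  have hrd : |r + δ| ≤ 2 * K1 * (1 / Q + η) * Real.exp (2 * y) := by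
    have a1 : K1 * (y ^ 2 + y) / Q ≤ 2 * K1 * (1 / Q) * Real.exp (2 * y) := by
      rw [show 2 * K1 * (1 / Q) * Real.exp (2 * y) = K1 * (2 * Real.exp (2 * y)) / Q by ring]
      gcongr
    have a2 : η ≤ 2 * K1 * η * Real.exp (2 * y) := by
      have : 1 ≤ Real.exp (2 * y) := Real.one_le_exp (by positivity)
      have h2 : 1 ≤ 2 * K1 * Real.exp (2 * y) :=
        one_le_mul_of_one_le_of_one_le (by linarith) this
      calc η ≤ η * (2 * K1 * Real.exp (2 * y)) := le_mul_of_one_le_right hη0 h2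
        _ = _ := by ring
    have a3 := abs_add_le r δ
    have a4 : 2 * K1 * (1 / Q + η) * Real.exp (2 * y) = 2 * K1 * (1 / Q) * Real.exp (2 * y) +
      2 * K1 * η * Real.exp (2 * y) := by ring
    linarith
  have hexp3 : Real.exp |r + δ| ≤ 3 * Real.exp (K1 * y) := by
    have a3 := abs_add_le r δ
    calc Real.exp |r + δ| ≤ Real.exp (1 + K1 * y) := Real.exp_le_exp.2 (by linarith)
      _ = Real.exp 1 * Real.exp (K1 * y) := Real.exp_add _ _
      _ ≤ 3 * Real.exp (K1 * y) := by
        gcongr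
        exact Real.exp_one_lt_three.le
  have hfin : |Real.exp (r + δ) - 1| ≤ Real.exp |r + δ| * |r + δ| :=
    abs_exp_sub_one_le_mul (Real.one_le_exp (abs_nonneg _)) (Real.exp_le_exp.2 (le_abs_self _))
  have hVy : Real.exp ((K1 + 2) * y) ≤ ρ ^ V + ρ⁻¹ ^ V := by
    have a1 : (K1 + 2) * y ≤ V * |l| := by
      rw [hy, ← mul_assoc]; gcongr
    have a2 : ρ ^ V = Real.exp (V * l) := by rw [hρl, ← Real.exp_nat_mul]
    have a3 : ρ⁻¹ ^ V = Real.exp (-(V * l)) := by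
      rw [hρi, ← Real.exp_nat_mul]; congr 1; ring
    rw [a2, a3]
    refine (Real.exp_le_exp.2 a1).trans ?_
    rcases abs_cases l with ⟨h, _⟩ | ⟨h, _⟩ <;> rw [h]
    · linarith [Real.exp_pos (-((V : ℝ) * l))]
    · rw [mul_neg]; linarith [Real.exp_pos ((V : ℝ) * l)]
  calc |Real.exp (r + δ) - 1| ≤ Real.exp |r + δ| * |r + δ| := hfin
    _ ≤ 3 * Real.exp (K1 * y) * (2 * K1 * (1 / Q + η) * Real.exp (2 * y)) := by gcongr
    _ = 6 * K1 * (1 / Q + η) * Real.exp ((K1 + 2) * y) := by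
        rw [add_mul K1 2 y, Real.exp_add]; ring
    _ ≤ _ := by gcongr

/-- Together with `pow_mul_factorial_sub_le`, this shows that moving the exponent of a power sum by
V of order √n changes the factorial by n^{±V} up to a bounded factor. -/
theorem factorial_add_le (N V n : ℕ) (hN : N ≤ n) (hn : 0 < n) :
    ((N + V).factorial : ℝ) ≤ N.factorial * (n : ℝ) ^ V * Real.exp (V ^ 2 / n) := by
  have h1 : ((N + V).factorial : ℝ) ≤ N.factorial * ((N + V : ℕ) : ℝ) ^ V := by
    have := Nat.factorial_mul_ascFactorial N V
    rw [← this]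
    push_cast
    gcongr
    exact_mod_cast Nat.ascFactorial_le_pow_add N V
  have hn' : (0 : ℝ) < n := by exact_mod_cast hn
  refine h1.trans ?_
  rw [mul_assoc]
  gcongr
  have h2 : ((N + V : ℕ) : ℝ) ≤ n * Real.exp (V / n) := by
    have h3 := Real.add_one_le_exp ((V : ℝ) / n)
    have h4 : (n : ℝ) * (V / n + 1) = V + n := by field_simp
    have h5 : (N : ℝ) ≤ n := by exact_mod_cast hN
    push_cast
    nlinarith
  calc ((N + V : ℕ) : ℝ) ^ V ≤ (n * Real.exp (V / n)) ^ V := by gcongr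
    _ = _ := by
      rw [mul_pow, ← Real.exp_nat_mul]
      congr 2
      ring

theorem pow_mul_factorial_sub_le {n J V : ℕ} (h : 2 * (J + V) ≤ n) (hn : 0 < n) :
    (n : ℝ) ^ V * ((n - J - V).factorial : ℝ) ≤
      (n - J).factorial * Real.exp (2 * V * (J + V) / n) := by
  set N := n - J - V with hN
  have hNJ : n - J = N + V := by omega
  have hn' : (0 : ℝ) < n := by exact_mod_cast hn
  have h1 : (N.factorial : ℝ) * (N : ℝ) ^ V ≤ ((N + V).factorial : ℝ) := by
    have := Nat.factorial_mul_pow_le_factorial (m := N) (n := V)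
    have h2 : (N.factorial : ℝ) * ((N : ℝ) + 1) ^ V ≤ ((N + V).factorial : ℝ) := by
      exact_mod_cast this
    refine le_trans ?_ h2
    gcongr
    linarith
  have h2 : (n : ℝ) ≤ N * Real.exp (2 * (J + V) / n) := by
    have h3 := Real.add_one_le_exp (2 * ((J : ℝ) + V) / n)
    have h4 : (N : ℝ) + J + V = n := by
      have : N + J + V = n := by omega
      exact_mod_cast this
    have h5 : 2 * ((J : ℝ) + V) ≤ n := by exact_mod_cast h
    have h6 : (n : ℝ) ≤ N * (2 * (J + V) / n + 1) := by
      rw [show (N : ℝ) * (2 * (J + V) / n + 1) = N * (2 * (J + V) + n) / n by field_simp,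
        le_div_iff₀ hn']
      have : (N : ℝ) = n - (J + V) := by linarith
      rw [this]
      nlinarith [(by positivity : (0 : ℝ) ≤ (J : ℝ) + V)]
    have h7 : (N : ℝ) * (2 * (J + V) / n + 1) ≤ N * Real.exp (2 * (J + V) / n) := by gcongr
    linarith
  rw [hNJ]
  calc (n : ℝ) ^ V * N.factorial ≤ (N * Real.exp (2 * (J + V) / n)) ^ V * N.factorial := by gcongr
    _ = N.factorial * (N : ℝ) ^ V * Real.exp (2 * V * (J + V) / n) := by
        rw [mul_pow, ← Real.exp_nat_mul,
          show (V : ℝ) * (2 * (J + V) / n) = 2 * V * (J + V) / n by ring]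
        ring
    _ ≤ _ := by gcongr

end Laplace

/-! ### The Laplace-type sum. -/

section LaplaceSum

theorem factorial_le_pow_mul_factorial_sub {n J : ℕ} (h : J ≤ n) :
    n.factorial ≤ n ^ J * (n - J).factorial := by
  rw [← Nat.factorial_mul_descFactorial h, mul_comm]
  exact Nat.mul_le_mul_right _ (Nat.descFactorial_le_pow n J)

/-- Since e^{3/2} ≤ 7, the gain (e/7)^n ≤ e^{-n/2} beats the factor exp(64K√n); completing the
square makes this explicit. -/
theorem sqrt_mul_mul_exp_bound (K : ℝ) (n : ℕ) :
    √(n : ℝ) * (n * (Real.exp 1 / 7) ^ n * Real.exp (64 * K * √(n : ℝ) + 1 + K)) ≤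
      6 * Real.exp ((64 * K + 1) ^ 2 / 2 + 1 + K) := by
  set Q := √(n : ℝ) with hQ
  have hQ0 : 0 ≤ Q := Real.sqrt_nonneg _
  have hQ2 : Q ^ 2 = n := Real.sq_sqrt (Nat.cast_nonneg n)
  have h1 : (Real.exp 1 / 7) ^ n ≤ Real.exp (-(Q ^ 2 / 2)) := by
    have h2 : Real.exp 1 / 7 ≤ Real.exp (-(1 / 2)) := by
      rw [div_le_iff₀ (by norm_num), ← div_le_iff₀' (Real.exp_pos _), ← Real.exp_sub]
      norm_num
      have h3 : Real.exp (3 / 2) ^ 2 ≤ 7 ^ 2 := by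
        rw [← Real.exp_nat_mul]
        have : ((2 : ℕ) : ℝ) * (3 / 2) = ((3 : ℕ) : ℝ) * 1 := by norm_num
        rw [this, Real.exp_nat_mul]
        calc Real.exp 1 ^ 3 ≤ 3 ^ 3 := by gcongr; exact Real.exp_one_lt_three.le
          _ ≤ 7 ^ 2 := by norm_num
      exact (pow_le_pow_iff_left₀ (Real.exp_pos _).le (by norm_num) (by norm_num)).1 h3
    calc (Real.exp 1 / 7) ^ n ≤ Real.exp (-(1 / 2)) ^ n := by gcongr
      _ = _ := by rw [← Real.exp_nat_mul, hQ2]; congr 1; ring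
  have h4 : Q ^ 3 ≤ 6 * Real.exp Q := by
    have := Real.pow_div_factorial_le_exp Q hQ0 3
    rw [div_le_iff₀ (by positivity)] at this
    norm_num [Nat.factorial] at this
    linarith
  calc Q * (n * (Real.exp 1 / 7) ^ n * Real.exp (64 * K * Q + 1 + K))
      = Q ^ 3 * ((Real.exp 1 / 7) ^ n * Real.exp (64 * K * Q + 1 + K)) := by rw [← hQ2]; ring
    _ ≤ 6 * Real.exp Q * (Real.exp (-(Q ^ 2 / 2)) * Real.exp (64 * K * Q + 1 + K)) := by gcongr
    _ = 6 * Real.exp (Q + (-(Q ^ 2 / 2) + (64 * K * Q + 1 + K))) := by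
        rw [Real.exp_add Q, Real.exp_add (-(Q ^ 2 / 2))]; ring
    _ ≤ _ := by
        refine mul_le_mul_of_nonneg_left (Real.exp_le_exp.2 ?_) (by norm_num)
        nlinarith [sq_nonneg (Q - (64 * K + 1))]

/-- The contribution of small `a`, where only monotonicity is used. -/
theorem small_part_bound {K θ c d η : ℝ} {n J a₁ : ℕ} {y : ℝ} (hK : 1 ≤ K) (hn : 56 ≤ n)
    (hθ0 : 0 < θ) (hθ1 : θ ≤ 1) (hc0 : 0 ≤ c) (hc : c ≤ K * √(n : ℝ)) (hd0 : 0 ≤ d) (hd : d ≤ K)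
    (hJ : J ≤ n) (hη : η ≤ 1) (ha₁ : n / θ / 8 ≤ a₁) (ha₁' : (a₁ : ℝ) ≤ n / θ / 8 + 1)
    {δ : ℝ} (hδ : |δ| ≤ η)
    (hy : y = (a₁ : ℝ) ^ n * Real.exp (c * (n / θ / a₁) ^ 2 - d * (n / θ / a₁) ^ 4 + δ)) :
    a₁ * y * θ ^ (n + 1) ≤ 6 * Real.exp ((64 * K + 1) ^ 2 / 2 + 1 + K) * (1 / √(n : ℝ)) *
      (Real.exp (c - d) * (n : ℝ) ^ J * (n - J).factorial) := by
  have hn0 : (0 : ℝ) < n := by exact_mod_cast (by omega : 0 < n)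
  have hn56 : (56 : ℝ) ≤ n := by exact_mod_cast hn
  set Q := √(n : ℝ) with hQ
  have hQ0 : 0 < Q := Real.sqrt_pos.2 hn0
  set x := (n : ℝ) / θ with hx
  have hxn : (n : ℝ) ≤ x := by
    rw [hx, le_div_iff₀ hθ0]; nlinarith
  have hx0 : 0 < x := by linarith
  have ha0 : (0 : ℝ) < a₁ := by linarith
  -- The rounding term 1 is absorbed because x ≥ n ≥ 56 and 1/7 - 1/8 = 1/56.
  have ha7 : (a₁ : ℝ) ≤ x / 7 := by linarith
  have hratio : x / a₁ ≤ 8 := by rw [div_le_iff₀ ha0]; linarith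
  have hexp : c * (x / a₁) ^ 2 - d * (x / a₁) ^ 4 + δ ≤ 64 * K * Q + 1 := by
    have h1 : c * (x / a₁) ^ 2 ≤ K * Q * 8 ^ 2 := by gcongr
    have h2 : 0 ≤ d * (x / a₁) ^ 4 := by positivity
    have h3 := (abs_le.1 hδ).2
    linarith
  have hy1 : a₁ * y * θ ^ (n + 1) ≤ n * ((n : ℝ) ^ n * (1 / 7) ^ n) * Real.exp (64 * K * Q + 1) := by
    calc a₁ * y * θ ^ (n + 1) ≤ x * ((x / 7) ^ n * Real.exp (64 * K * Q + 1)) * θ ^ (n + 1) := by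
          rw [hy]
          gcongr
          linarith
      _ = (x * θ) * ((x * θ) ^ n * (1 / 7) ^ n) * Real.exp (64 * K * Q + 1) := by
          rw [pow_succ, div_eq_mul_one_div x, mul_pow, mul_pow]; ring
      _ = _ := by
          have : x * θ = n := by rw [hx]; field_simp
          rw [this]
  have hM : Real.exp (-K) * ((n : ℝ) ^ n * (1 / Real.exp 1) ^ n) ≤
      Real.exp (c - d) * (n : ℝ) ^ J * (n - J).factorial := by
    have h1 : (n : ℝ) ^ n * (1 / Real.exp 1) ^ n ≤ n.factorial := by
      have := Real.pow_div_factorial_le_exp (n : ℝ) hn0.le n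
      rw [div_le_iff₀ (by positivity)] at this
      rw [one_div, inv_pow, ← div_eq_mul_inv, div_le_iff₀ (by positivity), ← Real.exp_nat_mul,
        mul_one]
      linarith
    have h2 : (n.factorial : ℝ) ≤ (n : ℝ) ^ J * (n - J).factorial := by
      exact_mod_cast factorial_le_pow_mul_factorial_sub hJ
    rw [mul_assoc]
    have h3 : -K ≤ c - d := by linarith
    exact mul_le_mul (Real.exp_le_exp.2 h3) (h1.trans h2) (by positivity) (by positivity)
  have hb := sqrt_mul_mul_exp_bound K n
  rw [← hQ] at hb
  refine hy1.trans ?_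
  refine le_trans ?_ (mul_le_mul_of_nonneg_left hM (by positivity))
  have e1 : n * ((n : ℝ) ^ n * (1 / 7) ^ n) * Real.exp (64 * K * Q + 1) =
      (Q * (n * (Real.exp 1 / 7) ^ n * Real.exp (64 * K * Q + 1 + K))) * (1 / Q) *
        (Real.exp (-K) * ((n : ℝ) ^ n * (1 / Real.exp 1) ^ n)) := by
    rw [Real.exp_add (64 * K * Q + 1) K, Real.exp_neg, div_pow, div_pow, div_pow]
    field_simp
  rw [e1]
  gcongr

/-- For a ≥ x/8 this is `tilt_bound`. Below, monotonicity bounds `h a` by `h a₁`, and the comparison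
weight is itself at most the error weight, because (x/a)^V ≥ 2^V ≥ Q. -/
theorem weight_comparison {K Q c d η x t F W : ℝ} {n J V a₁ : ℕ} {h : ℕ → ℝ} (hK : 1 ≤ K)
    (hQ1 : 1 ≤ Q) (hc0 : 0 ≤ c) (hc : c ≤ K * Q) (hd0 : 0 ≤ d) (hd : d ≤ K)
    (hJ : |(J : ℝ) - 2 * c| ≤ 1) (hη0 : 0 ≤ η) (hη : η ≤ 1) (hmono : Monotone h)
    (hpos : ∀ a, 0 ≤ h a) (hx0 : 0 < x) (ht0 : 0 < t) (ht1 : t < 1) (hJVn : J + V < n)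
    (hV1 : (16515 * K + 2) * Q ≤ V) (ha₁ : a₁ = ⌈x / 8⌉₊) (hF : F = Real.exp (c - d) * x ^ J)
    (hW : W = 6 * (16515 * K) * (1 / Q + η))
    (hasym : ∀ a : ℕ, x / 8 ≤ a → ∃ δ, |δ| ≤ η ∧
      h a = (a : ℝ) ^ n * Real.exp (c * (x / a) ^ 2 - d * (x / a) ^ 4 + δ)) (a : ℕ) :
    ‖h a * t ^ a - F * ((a : ℝ) ^ (n - J) * t ^ a)‖ ≤
      (W * F * (x⁻¹ ^ V * ((a : ℝ) ^ (n - J + V) * t ^ a)) +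
        W * F * (x ^ V * ((a : ℝ) ^ (n - J - V) * t ^ a))) +
      (if a < a₁ then h a₁ else 0) := by
  have hQ0 : 0 < Q := by linarith
  have hF0 : 0 < F := by rw [hF]; positivity
  have hW0 : 0 ≤ W := by rw [hW]; positivity
  have hta : 0 < t ^ a := by positivity
  rw [Real.norm_eq_abs]
  rcases Nat.eq_zero_or_pos a with rfl | ha
  · have e1 : n - J ≠ 0 := by omega
    have e2 : n - J + V ≠ 0 := by omega
    have e3 : n - J - V ≠ 0 := by omega
    have e4 : 0 < a₁ := by
      rw [ha₁, Nat.ceil_pos]; positivity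
    simp only [Nat.cast_zero, zero_pow e1, zero_pow e2, zero_pow e3, pow_zero, mul_one, mul_zero,
      sub_zero, add_zero, zero_add, e4, if_true]
    rw [abs_of_nonneg (hpos 0)]
    exact hmono (Nat.zero_le _)
  have ha' : (0 : ℝ) < a := by exact_mod_cast ha
  have hE : W * F * (x⁻¹ ^ V * ((a : ℝ) ^ (n - J + V) * t ^ a)) +
      W * F * (x ^ V * ((a : ℝ) ^ (n - J - V) * t ^ a)) =
      (F * ((a : ℝ) ^ (n - J) * t ^ a)) * (W * ((a / x) ^ V + (a / x)⁻¹ ^ V)) := by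
    have e1 : (a : ℝ) ^ (n - J) = (a : ℝ) ^ (n - J - V) * (a : ℝ) ^ V := by
      rw [← pow_add]; congr 1; omega
    have hA : (a : ℝ) ^ V ≠ 0 := by positivity
    have hX : x ^ V ≠ 0 := by positivity
    rw [pow_add, e1, inv_div, div_pow, div_pow, inv_pow]
    generalize (a : ℝ) ^ V = A at hA ⊢
    generalize x ^ V = X at hX ⊢
    generalize (a : ℝ) ^ (n - J - V) = Y
    field_simp
  rw [hE]
  set f := F * ((a : ℝ) ^ (n - J) * t ^ a) with hf
  have hf0 : 0 < f := by positivity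
  by_cases hlarge : x / 8 ≤ a
  · obtain ⟨δ, hδ, hha⟩ := hasym a hlarge
    have hna : ¬ a < a₁ := by rw [not_lt, ha₁]; exact Nat.ceil_le.2 hlarge
    rw [if_neg hna, add_zero]
    have htilt := tilt_bound (j := (J : ℝ)) (ρ := a / x) hK hQ1 hc0 hc hd0 hd hJ hη hδ
      (by rw [le_div_iff₀ hx0]; linarith) hV1
    have hh : h a * t ^ a = f * Real.exp (c * ((a / x)⁻¹ ^ 2 - 1) - d * ((a / x)⁻¹ ^ 4 - 1) +
        J * Real.log (a / x) + δ) := by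
      rw [hha, hf, hF, inv_div]
      have e1 : Real.exp (J * Real.log (a / x)) = (a / x) ^ J := by
        rw [Real.exp_nat_mul, Real.exp_log (by positivity)]
      have e2 : c * ((x / a) ^ 2 - 1) - d * ((x / a) ^ 4 - 1) + J * Real.log (a / x) + δ =
        (c * (x / a) ^ 2 - d * (x / a) ^ 4 + δ) + (J * Real.log (a / x) - (c - d)) := by ring
      have e3 : (a : ℝ) ^ n = a ^ J * a ^ (n - J) := by rw [← pow_add]; congr 1; omega
      rw [e2, Real.exp_add _ (J * Real.log (a / x) - (c - d)),
        Real.exp_sub (J * Real.log (a / x)) (c - d), e1, e3, div_pow (a : ℝ) x J]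
      field_simp
    rw [hh, show ∀ z : ℝ, f * z - f = f * (z - 1) from fun z => by ring, abs_mul,
      abs_of_pos hf0]
    exact mul_le_mul_of_nonneg_left (by rw [hW]; exact htilt) hf0.le
  · have hna : a < a₁ := by rw [ha₁]; exact Nat.lt_ceil.2 (not_le.1 hlarge)
    rw [if_pos hna]
    have h1 : h a * t ^ a ≤ h a₁ := by
      calc h a * t ^ a ≤ h a * 1 := by
            gcongr
            · exact hpos a
            · exact pow_le_one₀ ht0.le ht1.le
        _ ≤ h a₁ := by rw [mul_one]; exact hmono hna.le
    have h2 : 0 ≤ h a * t ^ a := mul_nonneg (hpos a) hta.le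
    have h3 : 1 ≤ W * ((a / x) ^ V + (a / x)⁻¹ ^ V) := by
      have i1 : (2 : ℝ) ≤ (a / x)⁻¹ := by
        rw [inv_div, le_div_iff₀ ha']
        linarith [not_le.1 hlarge]
      have i2 : Q ≤ (a / x)⁻¹ ^ V := by
        have i3 : (V : ℝ) ≤ 2 ^ V := by exact_mod_cast Nat.lt_two_pow_self.le
        have i4 : (2 : ℝ) ^ V ≤ (a / x)⁻¹ ^ V := by gcongr
        have i5 : Q ≤ (16515 * K + 2) * Q := le_mul_of_one_le_left hQ0.le (by linarith)
        linarith
      have i6 : 1 / Q ≤ W := by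
        rw [hW]
        calc 1 / Q ≤ 1 / Q + η := by linarith
          _ ≤ _ := le_mul_of_one_le_left (by positivity) (by linarith)
      have i7 : 0 ≤ (a / x) ^ V := by positivity
      calc (1 : ℝ) = 1 / Q * Q := by field_simp
        _ ≤ W * ((a / x) ^ V + (a / x)⁻¹ ^ V) := by
            gcongr
            linarith
    have h4 : f ≤ f * (W * ((a / x) ^ V + (a / x)⁻¹ ^ V)) := le_mul_of_one_le_right hf0.le h3
    rw [abs_le]
    constructor <;> linarith [hpos a₁]

/-- The terms a^n e^{-θa} peak at x = n/θ. There c(x/a)² has logarithmic slope -2c, so an integer J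
≈ 2c turns the weight into e^{c-d}x^J a^{n-J}, a summable pure power. The bounded d enters only
through its value at x. -/
theorem exists_laplace_bound {K : ℝ} (hK : 1 ≤ K) : ∃ (C : ℝ) (n₀ : ℕ), 0 < C ∧
    ∀ n : ℕ, n₀ ≤ n → ∀ (θ c d η S : ℝ) (J : ℕ) (h : ℕ → ℝ), 0 < θ → θ ≤ 1 → 0 ≤ c →
    c ≤ K * √(n : ℝ) → 0 ≤ d → d ≤ K → |(J : ℝ) - 2 * c| ≤ 1 → 0 ≤ η → η ≤ 1 → Monotone h →
    (∀ a, 0 ≤ h a) →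
    (∀ a : ℕ, n / θ / 8 ≤ a → ∃ δ, |δ| ≤ η ∧
      h a = (a : ℝ) ^ n * Real.exp (c * (n / θ / a) ^ 2 - d * (n / θ / a) ^ 4 + δ)) →
    HasSum (fun a => h a * Real.exp (-θ) ^ a) S →
    2 * J ≤ n ∧
    |S * θ ^ (n + 1) / (Real.exp (c - d) * (n : ℝ) ^ J * (n - J).factorial) - 1| ≤
      C * (1 / √(n : ℝ) + η + θ ^ 2) := by
  obtain ⟨CP, hCP0, hCP⟩ := exists_powerSum_bound
  -- From J ≤ 3KQ and V ≤ (16515K + 3)Q follows J + V ≤ LQ; the threshold (2L)² for n then ensures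
  -- 2(J + V) ≤ n.
  set L : ℝ := 16521 * K with hL
  set C2 : ℝ := 6 * Real.exp ((64 * K + 1) ^ 2 / 2 + 1 + K) with hC2
  set CT : ℝ := 6 * (16515 * K) with hCT
  refine ⟨CP + CT * ((1 + CP) * Real.exp (L ^ 2) + (1 + CP) * Real.exp (2 * L ^ 2)) + C2,
    ⌈(2 * L) ^ 2⌉₊ + 56, by positivity, ?_⟩
  intro n hn θ c d η S J h hθ0 hθ1 hc0 hc hd0 hd hJ hη0 hη hmono hpos hasym hS
  have hn56 : 56 ≤ n := by omega
  have hn0 : (0 : ℝ) < n := by exact_mod_cast (by omega : 0 < n)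
  set Q := √(n : ℝ) with hQ
  have hQ2 : Q ^ 2 = n := Real.sq_sqrt hn0.le
  have hQL : 2 * L ≤ Q := by
    refine Real.le_sqrt_of_sq_le ?_
    have h1 := Nat.le_ceil ((2 * L) ^ 2)
    have h2 : ((⌈(2 * L) ^ 2⌉₊ : ℕ) : ℝ) ≤ n := by exact_mod_cast (by omega)
    linarith
  have hL1 : 16521 ≤ L := by rw [hL]; linarith
  have hQ1 : 1 ≤ Q := by linarith
  have hQ0 : 0 < Q := by linarith
  set V : ℕ := ⌈(16515 * K + 2) * Q⌉₊ with hV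
  have hV1 : (16515 * K + 2) * Q ≤ V := Nat.le_ceil _
  have hV2 : (V : ℝ) ≤ (16515 * K + 3) * Q := by
    have := (Nat.ceil_lt_add_one (by positivity : 0 ≤ (16515 * K + 2) * Q)).le
    linarith
  have hJQ : (J : ℝ) ≤ 3 * K * Q := by
    have := (abs_le.1 hJ).2
    have : 1 ≤ K * Q := one_le_mul_of_one_le_of_one_le hK hQ1
    linarith
  have hKQ : Q ≤ K * Q := le_mul_of_one_le_left hQ0.le hK
  have hJV : (J : ℝ) + V ≤ L * Q := by rw [hL]; linarith
  have hVL : (V : ℝ) ≤ L * Q := by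
    have : (0 : ℝ) ≤ J := Nat.cast_nonneg J
    linarith
  have hJVn : 2 * (J + V) ≤ n := by
    have : 2 * ((J : ℝ) + V) ≤ n := by
      rw [← hQ2]; nlinarith
    exact_mod_cast this
  refine ⟨by omega, ?_⟩
  set t := Real.exp (-θ) with ht
  have ht0 : 0 < t := Real.exp_pos _
  have ht1 : t < 1 :=
    (Real.exp_lt_exp.2 (by linarith : -θ < 0)).trans_eq Real.exp_zero
  set x := (n : ℝ) / θ with hx
  have hx0 : 0 < x := by positivity
  clear_value x
  set P : ℕ → ℝ := fun N => ∑' a : ℕ, (a : ℝ) ^ N * t ^ a with hP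
  have hPs : ∀ N, HasSum (fun a : ℕ => (a : ℝ) ^ N * t ^ a) (P N) := fun N =>
    (summable_pow_mul_geometric_of_norm_lt_one N
      (by rw [Real.norm_of_nonneg ht0.le]; exact ht1)).hasSum
  set M := Real.exp (c - d) * (n : ℝ) ^ J * (n - J).factorial with hM
  have hM0 : 0 < M := by positivity
  set F := Real.exp (c - d) * x ^ J with hF
  have hF0 : 0 < F := by positivity
  have hFM : ∀ z : ℝ, F * z * θ ^ (n + 1) = M * (z * θ ^ (n - J + 1) / (n - J).factorial) := by
    intro z
    have : θ ^ (n + 1) = θ ^ J * θ ^ (n - J + 1) := by rw [← pow_add]; congr 1; omega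
    rw [this, hF, hM, hx, div_pow]
    field_simp
  -- total mass of the comparison weights
  have hPub : ∀ N, 1 ≤ N → P N ≤ (1 + CP) * N.factorial / θ ^ (N + 1) := by
    intro N hN
    have h1 := (abs_le.1 (hCP N θ hN hθ0 hθ1)).2
    have h2 : CP * θ ^ 2 ≤ CP := mul_le_of_le_one_right hCP0.le (pow_le_one₀ hθ0.le hθ1)
    rw [le_div_iff₀ (by positivity)]
    have h3 : P N * θ ^ (N + 1) / N.factorial ≤ 1 + CP := by linarith
    rwa [div_le_iff₀ (by positivity)] at h3
  have hup : (x⁻¹ ^ V * P (n - J + V)) * θ ^ (n - J + 1) / (n - J).factorial ≤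
      (1 + CP) * Real.exp (L ^ 2) := by
    have h1 := hPub (n - J + V) (by omega)
    have h2 := factorial_add_le (n - J) V n (by omega) (by omega)
    have h3 : Real.exp ((V : ℝ) ^ 2 / n) ≤ Real.exp (L ^ 2) := by
      refine Real.exp_le_exp.2 ?_
      rw [div_le_iff₀ hn0, ← hQ2, ← mul_pow]
      gcongr
    rw [div_le_iff₀ (by positivity)]
    calc (x⁻¹ ^ V * P (n - J + V)) * θ ^ (n - J + 1)
        ≤ (x⁻¹ ^ V * ((1 + CP) * (((n - J).factorial : ℝ) * (n : ℝ) ^ V * Real.exp (L ^ 2)) /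
            θ ^ (n - J + V + 1))) * θ ^ (n - J + 1) := by
          gcongr
          refine h1.trans ?_
          gcongr
          refine h2.trans ?_
          gcongr
      _ = _ := by
          rw [hx, inv_div, div_pow, show n - J + V + 1 = V + (n - J + 1) by ring, pow_add]
          field_simp
  have hdown : (x ^ V * P (n - J - V)) * θ ^ (n - J + 1) / (n - J).factorial ≤
      (1 + CP) * Real.exp (2 * L ^ 2) := by
    have h1 := hPub (n - J - V) (by omega)
    have h2 := pow_mul_factorial_sub_le hJVn (by omega)
    have h3 : Real.exp (2 * (V : ℝ) * (J + V) / n) ≤ Real.exp (2 * L ^ 2) := by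
      refine Real.exp_le_exp.2 ?_
      rw [div_le_iff₀ hn0, ← hQ2]
      calc 2 * (V : ℝ) * (J + V) ≤ 2 * (L * Q) * (L * Q) := by gcongr
        _ = _ := by ring
    rw [div_le_iff₀ (by positivity)]
    calc (x ^ V * P (n - J - V)) * θ ^ (n - J + 1)
        ≤ (x ^ V * ((1 + CP) * (n - J - V).factorial / θ ^ (n - J - V + 1))) *
            θ ^ (n - J + 1) := by gcongr
      _ = (1 + CP) * ((n : ℝ) ^ V * (n - J - V).factorial) := by
          have : θ ^ (n - J + 1) = θ ^ V * θ ^ (n - J - V + 1) := by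
            rw [← pow_add]; congr 1; omega
          rw [this, hx, div_pow]
          field_simp
      _ ≤ (1 + CP) * ((n - J).factorial * Real.exp (2 * L ^ 2)) := by
          refine mul_le_mul_of_nonneg_left (h2.trans ?_) (by positivity)
          gcongr
      _ = _ := by ring
  -- pointwise comparison
  set a₁ : ℕ := ⌈x / 8⌉₊ with ha₁
  have ha₁1 : x / 8 ≤ a₁ := Nat.le_ceil _
  have ha₁2 : (a₁ : ℝ) ≤ x / 8 + 1 := (Nat.ceil_lt_add_one (by positivity)).le
  set W : ℝ := CT * (1 / Q + η) with hW
  have hCT1 : 1 ≤ CT := by rw [hCT]; linarith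
  have hW0 : 0 ≤ W := by positivity
  have hpoint := weight_comparison (W := W) hK hQ1 hc0 hc hd0 hd hJ hη0 hη hmono hpos hx0 ht0 ht1
    (by omega : J + V < n) hV1 ha₁ hF (by rw [hW, hCT]) hasym
  have hsumE : HasSum (fun a : ℕ => (W * F * (x⁻¹ ^ V * ((a : ℝ) ^ (n - J + V) * t ^ a)) +
        W * F * (x ^ V * ((a : ℝ) ^ (n - J - V) * t ^ a))) + (if a < a₁ then h a₁ else 0))
      ((W * F * (x⁻¹ ^ V * P (n - J + V)) + W * F * (x ^ V * P (n - J - V))) + a₁ * h a₁) := by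
    refine HasSum.add (HasSum.add ?_ ?_) ?_
    · exact ((hPs _).mul_left _).mul_left _
    · exact ((hPs _).mul_left _).mul_left _
    · have h1 : ∀ b ∉ Finset.range a₁, (if b < a₁ then h a₁ else 0) = 0 := fun b hb => by
        rw [if_neg (by simpa using hb)]
      have h2 := hasSum_sum_of_ne_finset_zero (L := SummationFilter.unconditional ℕ) h1
      convert h2 using 1
      rw [Finset.sum_congr rfl fun b hb => if_pos (Finset.mem_range.1 hb), Finset.sum_const,
        Finset.card_range, nsmul_eq_mul]
  have hdiff : ‖S - F * P (n - J)‖ ≤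
      (W * F * (x⁻¹ ^ V * P (n - J + V)) + W * F * (x ^ V * P (n - J - V))) + a₁ * h a₁ := by
    rw [← (hS.sub ((hPs (n - J)).mul_left F)).tsum_eq]
    exact tsum_of_norm_bounded hsumE hpoint
  obtain ⟨δ, hδ, hha⟩ := hasym a₁ ha₁1
  rw [hx] at ha₁1 ha₁2 hha
  have hsmall := small_part_bound (J := J) hK hn56 hθ0 hθ1 hc0 hc hd0 hd (by omega) hη ha₁1 ha₁2 hδ hha
  rw [← hM, ← hQ, ← hC2] at hsmall
  have hdiff' : |S - F * P (n - J)| * θ ^ (n + 1) ≤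
      M * (W * ((1 + CP) * Real.exp (L ^ 2) + (1 + CP) * Real.exp (2 * L ^ 2)) + C2 * (1 / Q)) := by
    rw [← Real.norm_eq_abs]
    calc _ ≤ ((W * F * (x⁻¹ ^ V * P (n - J + V)) + W * F * (x ^ V * P (n - J - V))) + a₁ * h a₁) *
          θ ^ (n + 1) := by gcongr
      _ = W * (F * (x⁻¹ ^ V * P (n - J + V)) * θ ^ (n + 1)) +
          W * (F * (x ^ V * P (n - J - V)) * θ ^ (n + 1)) + a₁ * h a₁ * θ ^ (n + 1) := by ring
      _ ≤ W * (M * ((1 + CP) * Real.exp (L ^ 2))) + W * (M * ((1 + CP) * Real.exp (2 * L ^ 2))) +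
          C2 * (1 / Q) * M := by
          rw [hFM, hFM]
          gcongr
      _ = _ := by ring
  have hmain : |F * P (n - J) * θ ^ (n + 1) - M| ≤ M * (CP * θ ^ 2) := by
    rw [hFM, show ∀ z : ℝ, M * z - M = M * (z - 1) from fun z => by ring, abs_mul, abs_of_pos hM0]
    gcongr
    exact hCP (n - J) θ (by omega) hθ0 hθ1
  rw [show S * θ ^ (n + 1) / M - 1 = (S * θ ^ (n + 1) - M) / M by field_simp, abs_div,
    abs_of_pos hM0, div_le_iff₀ hM0]
  have htri : |S * θ ^ (n + 1) - M| ≤ |S - F * P (n - J)| * θ ^ (n + 1) +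
      |F * P (n - J) * θ ^ (n + 1) - M| := by
    rw [← abs_of_pos (by positivity : 0 < θ ^ (n + 1)), ← abs_mul,
      abs_of_pos (by positivity : 0 < θ ^ (n + 1))]
    refine le_trans (le_of_eq ?_) (abs_add_le _ _)
    congr 1
    ring
  refine htri.trans ((add_le_add hdiff' hmain).trans ?_)
  rw [← mul_add, mul_comm]
  gcongr
  rw [hW]
  set G := (1 + CP) * Real.exp (L ^ 2) + (1 + CP) * Real.exp (2 * L ^ 2) with hG
  have hG0 : 0 ≤ G := by positivity
  have hC20 : 0 ≤ C2 := by positivity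
  have hq : 0 ≤ 1 / Q := by positivity
  have hth : 0 ≤ θ ^ 2 := by positivity
  have z1 : 0 ≤ CP * (1 / Q + η) := by positivity
  have z2 : 0 ≤ CT * G * θ ^ 2 := by positivity
  have z3 : 0 ≤ C2 * (η + θ ^ 2) := by positivity
  linarith [z1, z2, z3]

end LaplaceSum

/-! ### Expansions in the small parameter. -/

section Expansions

/-- Remainders will be continuous functions of ε and of error coefficients in [-1, 1]; compactness
supplies the constant. -/
theorem exists_bound_of_continuous {f : ℝ × ℝ × ℝ × ℝ → ℝ} (hf : Continuous f) :
    ∃ C : ℝ, 0 < C ∧ ∀ a b c d : ℝ, |a| ≤ 1 → |b| ≤ 1 → |c| ≤ 1 → |d| ≤ 1 →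
      |f (a, b, c, d)| ≤ C := by
  have hI : IsCompact (Set.Icc (-1 : ℝ) 1) := isCompact_Icc
  obtain ⟨C, hC⟩ := (hI.prod (hI.prod (hI.prod hI))).exists_bound_of_continuousOn hf.continuousOn
  refine ⟨max C 1, by positivity, fun a b c d ha hb hc hd => (hC (a, b, c, d) ?_).trans
    (le_max_left _ _)⟩
  exact ⟨abs_le.1 ha, abs_le.1 hb, abs_le.1 hc, abs_le.1 hd⟩

theorem exists_unit_mul_eq {x B : ℝ} (hB : 0 < B) (h : |x| ≤ B) : ∃ e : ℝ, |e| ≤ 1 ∧ x = e * B :=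
  ⟨x / B, by rwa [abs_div, abs_of_pos hB, div_le_one hB], by field_simp⟩

theorem abs_le_of_eq_mul {x z B C : ℝ} (hB : 0 < B) (h : x = B * z) (hz : |z| ≤ C) :
    |x| ≤ C * B := by
  rw [h, abs_mul, abs_of_pos hB, mul_comm]
  exact mul_le_mul_of_nonneg_right hz hB.le

/-- Second order expansions, in `ε`, of the logarithm of `θ / (2 * w)` and of `θ ^ 2`, where
`w ^ 2 = 1 - exp (-ε)` and `θ = 2 * artanh w`. -/
theorem exists_artanh_expansion : ∃ C : ℝ, 0 < C ∧ ∀ ε w θ : ℝ, 0 < ε → ε ≤ 1 / 2 →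
    w = √(1 - Real.exp (-ε)) → θ = Real.log ((1 + w) / (1 - w)) →
    0 < w ∧ w < 1 ∧ 0 < θ ∧ |Real.log (θ / (2 * w)) - (ε / 3 - ε ^ 2 / 45)| ≤ C * ε ^ 3 ∧
      |θ ^ 2 - (4 * ε + 2 / 3 * ε ^ 2)| ≤ C * ε ^ 3 := by
  -- The arguments are (ε, e₁, e₂, e₃). Then w² = ε + ε²κ = εk and θ/(2w) = 1 + ε(1/3 + εμ); the two
  -- functions bounded below are the exact remainders divided by ε³.
  let κ : ℝ × ℝ × ℝ × ℝ → ℝ := fun z => -1 / 2 + z.2.1 * z.1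
  let k : ℝ × ℝ × ℝ × ℝ → ℝ := fun z => 1 + z.1 * κ z
  let μ : ℝ × ℝ × ℝ × ℝ → ℝ := fun z => κ z / 3 + k z ^ 2 * (1 / 5 + 2 * z.2.2.1 * (z.1 * k z))
  obtain ⟨C₁, hC₁, hb₁⟩ := exists_bound_of_continuous (f := fun z =>
    z.2.1 / 3 + κ z * (2 + z.1 * κ z) / 5 + 2 * z.2.2.1 * k z ^ 3 -
      (2 / 3 * μ z + z.1 * μ z ^ 2) / 2 + 2 * z.2.2.2 * (1 / 3 + z.1 * μ z) ^ 3)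
    (by fun_prop)
  obtain ⟨C₂, hC₂, hb₂⟩ := exists_bound_of_continuous (f := fun z =>
    4 * z.2.1 + 4 * (2 * μ z + (1 / 3 + z.1 * μ z) ^ 2) +
      4 * κ z * (2 / 3 + z.1 * (2 * μ z + (1 / 3 + z.1 * μ z) ^ 2)))
    (by fun_prop)
  refine ⟨C₁ + C₂, by positivity, ?_⟩
  intro ε w θ hε hε2 hw hθ
  have hg0 : 0 < 1 - Real.exp (-ε) := by
    have := Real.exp_lt_exp.2 (neg_lt_zero.2 hε)
    rw [Real.exp_zero] at this
    linarith
  have hgε : 1 - Real.exp (-ε) ≤ ε := by linarith [Real.add_one_le_exp (-ε)]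
  have hw2 : w ^ 2 = 1 - Real.exp (-ε) := by rw [hw]; exact Real.sq_sqrt hg0.le
  have hw0 : 0 < w := by rw [hw]; exact Real.sqrt_pos.2 hg0
  have hw1 : w < 1 := by nlinarith
  have hexp := Real.exp_bound (x := -ε) (by rw [abs_neg, abs_of_pos hε]; linarith)
    (by norm_num : 0 < 3)
  simp only [Finset.sum_range_succ, Finset.range_zero, Finset.sum_empty, abs_neg, abs_of_pos hε,
    Nat.factorial] at hexp
  norm_num at hexp
  obtain ⟨e₁, he₁, hg⟩ := exists_unit_mul_eq (x := w ^ 2 - (ε - ε ^ 2 / 2)) (B := ε ^ 3)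
    (by positivity) (by
      rw [hw2]
      have : 0 < ε ^ 3 := by positivity
      rw [abs_le] at hexp ⊢
      constructor <;> linarith [hexp.1, hexp.2])
  have hlow := Real.sum_range_le_log_div hw0.le hw1 3
  have hupp := Real.log_div_le_sum_range_add hw0.le hw1 3
  rw [← hθ] at hlow hupp
  simp only [Finset.sum_range_succ, Finset.range_zero, Finset.sum_empty] at hlow hupp
  norm_num at hlow hupp
  have hθ0 : 0 < θ := by
    have : 0 < w + w ^ 3 / 3 + w ^ 5 / 5 := by positivity
    linarith
  have hupp' : 1 / 2 * θ ≤ w + w ^ 3 / 3 + w ^ 5 / 5 + 2 * w ^ 7 := by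
    refine hupp.trans ?_
    gcongr
    rw [div_le_iff₀ (by linarith)]
    have : 0 < w ^ 7 := by positivity
    nlinarith
  have hr : θ / (2 * w) * w = 1 / 2 * θ := by field_simp
  obtain ⟨e₂, he₂, hr2⟩ := exists_unit_mul_eq
    (x := θ / (2 * w) - (1 + w ^ 2 / 3 + (w ^ 2) ^ 2 / 5)) (B := 2 * (w ^ 2) ^ 3)
    (by positivity) (by
      rw [abs_of_nonneg]
      · refine le_of_mul_le_mul_right (a := w) ?_ hw0
        rw [sub_mul, hr]
        linarith
      · refine le_of_mul_le_mul_right (a := w) ?_ hw0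
        rw [sub_mul, hr]
        linarith)
  generalize hrr : θ / (2 * w) = r at *
  have hθr : θ ^ 2 = 4 * w ^ 2 * r ^ 2 := by rw [← hrr]; field_simp; ring
  have hgε' : w ^ 2 ≤ ε := hw2.trans_le hgε
  have hgpos : 0 < w ^ 2 := by positivity
  generalize w ^ 2 = g at *
  have hv0 : 0 < r - 1 := by
    refine lt_of_mul_lt_mul_right (a := w) ?_ hw0.le
    rw [sub_mul, hr]
    have : 0 < w ^ 3 / 3 + w ^ 5 / 5 := by positivity
    linarith
  have hv1 : r - 1 ≤ 1 / 2 := by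
    have h1 : g ≤ 1 / 2 := by linarith
    have h2 : g ^ 2 ≤ (1 / 2) ^ 2 := by gcongr
    have h3 : g ^ 3 ≤ (1 / 2) ^ 3 := by gcongr
    have h4 : e₂ * (2 * g ^ 3) ≤ 1 * (2 * g ^ 3) := by
      gcongr
      exact (abs_le.1 he₂).2
    linarith
  obtain ⟨e₃, he₃, hl⟩ := exists_unit_mul_eq (by positivity)
    (abs_log_one_add_sub_le (v := r - 1) (by rwa [abs_of_pos hv0]))
  rw [abs_of_pos hv0, add_sub_cancel] at hl
  have hεa : |ε| ≤ 1 := by rw [abs_of_pos hε]; linarith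
  have hg' : g = ε - ε ^ 2 / 2 + e₁ * ε ^ 3 := by linarith
  have hr' : r = 1 + g / 3 + g ^ 2 / 5 + e₂ * (2 * g ^ 3) := by linarith
  have hl' : Real.log r = (r - 1) - (r - 1) ^ 2 / 2 + e₃ * (2 * (r - 1) ^ 3) := by linarith
  refine ⟨hw0, hw1, hθ0, ?_, ?_⟩
  · have h1 := hb₁ ε e₁ e₂ e₃ hεa he₁ he₂ he₃
    refine abs_le_of_eq_mul (by positivity) ?_ (h1.trans (by linarith))
    simp only [κ, k, μ]
    rw [hl', hr', hg']
    ring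
  · have h1 := hb₂ ε e₁ e₂ e₃ hεa he₁ he₂ he₃
    refine abs_le_of_eq_mul (by positivity) ?_ (h1.trans (by linarith))
    simp only [κ, k, μ]
    rw [hθr, hr', hg']
    ring

/-- The quantity is the product of (1 - j/n)^{-1} over j < J, and the leading terms j/n sum to
J²/(2n). -/
theorem abs_log_pow_mul_factorial_sub_le {n J : ℕ} (h : 2 * J ≤ n) (hn : 0 < n) :
    |Real.log ((n : ℝ) ^ J * (n - J).factorial / n.factorial) - (J : ℝ) ^ 2 / (2 * n)| ≤
      J / (2 * n) + (J : ℝ) ^ 3 / n ^ 2 := by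
  have hn' : (0 : ℝ) < n := by exact_mod_cast hn
  induction J with
  | zero => simp [Nat.factorial_ne_zero]
  | succ J ih =>
    have ih := ih (by omega)
    have hJn : 2 * (J : ℝ) ≤ n := by exact_mod_cast (by omega : 2 * J ≤ n)
    have h1 : Real.log ((n : ℝ) ^ (J + 1) * (n - (J + 1)).factorial / n.factorial) =
        Real.log ((n : ℝ) ^ J * (n - J).factorial / n.factorial) - Real.log (1 - J / n) := by
      have h2 : (0 : ℝ) < 1 - J / n := by
        rw [sub_pos, div_lt_one hn']; linarith
      have h3 : n - J = (n - (J + 1)) + 1 := by omega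
      have h4 : (((n - (J + 1) : ℕ) : ℝ) + 1) = n - J := by
        rw [Nat.cast_sub (by omega)]; push_cast; ring
      have h5 : (n : ℝ) - J ≠ 0 := by linarith
      rw [← Real.log_div (by positivity) h2.ne', h3, Nat.factorial_succ]
      congr 1
      push_cast
      rw [h4, one_sub_div hn'.ne', pow_succ]
      field_simp
    have h6 : |-Real.log (1 - J / n) - J / n| ≤ 2 * ((J : ℝ) ^ 2 / n ^ 2) := by
      have hu0 : (0 : ℝ) ≤ J / n := by positivity
      have hu : (J : ℝ) / n ≤ 1 / 2 := by rw [div_le_iff₀ hn']; linarith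
      rw [← div_pow]
      generalize (J : ℝ) / n = u at *
      have := Real.abs_log_sub_add_sum_range_le (x := u) (by rw [abs_of_nonneg hu0]; linarith) 1
      simp only [Finset.sum_range_succ, Finset.range_zero, Finset.sum_empty, abs_of_nonneg hu0]
        at this
      norm_num at this
      have h7 : u ^ 2 / (1 - u) ≤ 2 * u ^ 2 := by
        rw [div_le_iff₀ (by linarith)]
        nlinarith [sq_nonneg u]
      rw [show -Real.log (1 - u) - u = -(u + Real.log (1 - u)) by ring, abs_neg]
      exact this.trans h7
    rw [h1]
    push_cast
    have h8 : ((J : ℝ) + 1) ^ 2 / (2 * n) = J ^ 2 / (2 * n) + J / n + 1 / (2 * n) := by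
      field_simp; ring
    have h9 : ((J : ℝ) + 1) / (2 * n) + (J + 1) ^ 3 / n ^ 2 = J / (2 * n) + J ^ 3 / n ^ 2 +
        1 / (2 * n) + 3 * (J ^ 2 / n ^ 2) + (3 * J + 1) / n ^ 2 := by
      field_simp; ring
    have h10 : (0 : ℝ) ≤ (3 * J + 1) / n ^ 2 := by positivity
    have h11 : (0 : ℝ) ≤ 1 / (2 * n) := by positivity
    have h12 : (0 : ℝ) ≤ J ^ 2 / n ^ 2 := by positivity
    rw [h8, h9]
    rw [abs_le] at *
    constructor <;> linarith [ih.1, ih.2, h6.1, h6.2]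

end Expansions

/-! ### Asymptotics of the class means. -/

section MeanCountAsymptotics

theorem meanCount_normalized_bounds {n : ℕ} (lam : n.Partition) {a m : ℕ} (ha : 0 < a)
    (hm : lam.parts.count 1 = m) (hmn : m ≤ n) :
    fixedFactor (4 * (a : ℝ) ^ 2) m * (1 - n / (2 * a) - (n / (2 * a)) ^ 2) ≤
        n.factorial * meanCount lam a / 2 ^ n / (a : ℝ) ^ n ∧
      n.factorial * meanCount lam a / 2 ^ n / (a : ℝ) ^ n ≤
        fixedFactor (4 * (a : ℝ) ^ 2) m * Real.exp (n / (2 * a) + 2 * (n / (2 * a)) ^ 2) := by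
  have ha' : (0 : ℝ) < a := by exact_mod_cast ha
  obtain ⟨h1, h2⟩ := meanCount_bounds lam ha hm
  rw [enrichedCount_one, factorial_mul_identityCount m ha] at h1 h2
  have hf : 0 < fixedFactor (4 * (a : ℝ) ^ 2) m :=
    lt_of_lt_of_le one_pos (fixedFactor_ge_one (by positivity) m).1
  push_cast at h1 h2
  have hpow : (2 * (a : ℝ)) ^ n = (2 * (a : ℝ)) ^ m * (2 * (a : ℝ)) ^ (n - m) := by
    rw [← pow_add]; congr 1; omega
  rw [div_div, ← mul_pow, le_div_iff₀ (by positivity), div_le_iff₀ (by positivity)]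
  constructor
  · refine le_trans (le_of_eq ?_) h1
    rw [hpow, div_pow]
    ring
  · refine h2.trans ?_
    have h3 : (1 + 1 / (2 * (a : ℝ)) + 2 * n / (2 * a) ^ 2) ^ (n - m) ≤
        Real.exp (n / (2 * a) + 2 * (n / (2 * a)) ^ 2) := by
      have h4 : 1 + 1 / (2 * (a : ℝ)) + 2 * n / (2 * a) ^ 2 ≤
          Real.exp (1 / (2 * (a : ℝ)) + 2 * n / (2 * a) ^ 2) := by
        have := Real.add_one_le_exp (1 / (2 * (a : ℝ)) + 2 * n / (2 * a) ^ 2)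
        linarith
      calc (1 + 1 / (2 * (a : ℝ)) + 2 * n / (2 * a) ^ 2) ^ (n - m)
          ≤ (1 + 1 / (2 * (a : ℝ)) + 2 * n / (2 * a) ^ 2) ^ n := by
            refine pow_le_pow_right₀ ?_ (Nat.sub_le n m)
            rw [add_assoc, le_add_iff_nonneg_right]
            positivity
        _ ≤ Real.exp (1 / (2 * (a : ℝ)) + 2 * n / (2 * a) ^ 2) ^ n := by gcongr
        _ = _ := by
            rw [← Real.exp_nat_mul]
            congr 1
            field_simp
    rw [mul_pow (2 * (a : ℝ)), hpow]
    calc _ = (2 * (a : ℝ)) ^ m * (2 * (a : ℝ)) ^ (n - m) * fixedFactor (4 * (a : ℝ) ^ 2) m *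
          (1 + 1 / (2 * (a : ℝ)) + 2 * n / (2 * a) ^ 2) ^ (n - m) := by ring
      _ ≤ (2 * (a : ℝ)) ^ m * (2 * (a : ℝ)) ^ (n - m) * fixedFactor (4 * (a : ℝ) ^ 2) m *
          Real.exp (n / (2 * a) + 2 * (n / (2 * a)) ^ 2) := by gcongr
      _ = _ := by ring

/-- The logarithm of the fixed-point factor at b = 4a² supplies both displayed powers of n/(θa).
Everything else is controlled by u = n/(2a) ≤ 4θ. -/
theorem meanCount_asymptotic {n : ℕ} (hn : 0 < n) (lam : n.Partition) {m : ℕ}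
    (hm : lam.parts.count 1 = m) (hmn : m ≤ n) {K θ : ℝ} (hK : 1 ≤ K) (hθ0 : 0 < θ)
    (hθ : θ ≤ 1 / 16) (hθK : n * θ ^ 4 ≤ K) {a : ℕ} (ha : n / θ / 8 ≤ a) :
    ∃ δ, |δ| ≤ 5150 * K * θ ∧ n.factorial * meanCount lam a / 2 ^ n =
      (a : ℝ) ^ n * Real.exp ((m : ℝ) ^ 3 * θ ^ 2 / (12 * n ^ 2) * (n / θ / a) ^ 2 -
        3 * (m : ℝ) ^ 5 * θ ^ 4 / (160 * n ^ 4) * (n / θ / a) ^ 4 + δ) := by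
  have hn' : (0 : ℝ) < n := by exact_mod_cast hn
  have ha' : (0 : ℝ) < a := lt_of_lt_of_le (by positivity) ha
  have ha0 : 0 < a := by exact_mod_cast ha'
  obtain ⟨h1, h2⟩ := meanCount_normalized_bounds lam ha0 hm hmn
  set u : ℝ := n / (2 * a) with hu
  have hu0 : 0 < u := by positivity
  have hu1 : u ≤ 4 * θ := by
    rw [hu, div_le_iff₀ (by positivity)]
    rw [div_div, div_le_iff₀ (by positivity)] at ha
    linarith
  have hu2 : u ^ 2 ≤ 16 * θ ^ 2 := by
    calc u ^ 2 ≤ (4 * θ) ^ 2 := by gcongr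
      _ = _ := by ring
  have hZ : (n : ℝ) ^ 2 / (4 * (a : ℝ) ^ 2) = u ^ 2 := by rw [hu]; field_simp; norm_num
  have hθ2 : θ ^ 2 ≤ 1 / 16 * θ := by nlinarith
  have hlog := abs_log_fixedFactor_le (b := 4 * (a : ℝ) ^ 2) (by positivity) hmn
    (by rw [hZ]; nlinarith)
  rw [hZ] at hlog
  -- The sixth-order term is small only because nθ⁴ is bounded. A further 10θ from the nontrivial
  -- cycles completes 5150 = 20 + 5120 + 10.
  have herr : 20 * (u ^ 2 + n * (u ^ 2) ^ 3) ≤ (20 + 5120 * K) * θ := by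
    have e1 : n * (u ^ 2) ^ 3 ≤ 4096 * K * θ ^ 2 := by
      calc n * (u ^ 2) ^ 3 ≤ n * (16 * θ ^ 2) ^ 3 := by gcongr
        _ = 4096 * (n * θ ^ 4) * θ ^ 2 := by ring
        _ ≤ _ := by gcongr
    have e2 : 4096 * K * θ ^ 2 ≤ 4096 * K * (1 / 16 * θ) := by gcongr
    linarith
  have hf : 0 < fixedFactor (4 * (a : ℝ) ^ 2) m :=
    lt_of_lt_of_le one_pos (fixedFactor_ge_one (by positivity) m).1
  generalize hR : n.factorial * meanCount lam a / 2 ^ n / (a : ℝ) ^ n = R at *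
  have hv : 0 < 1 - u - u ^ 2 := by nlinarith
  have hR0 : 0 < R := lt_of_lt_of_le (by positivity) h1
  have hlow : Real.log (fixedFactor (4 * (a : ℝ) ^ 2) m) - 10 * θ ≤ Real.log R := by
    have e1 := Real.log_le_log (by positivity) h1
    rw [Real.log_mul hf.ne' hv.ne'] at e1
    have e2 := Real.one_sub_inv_le_log_of_pos hv
    have e3 : (1 - u - u ^ 2)⁻¹ ≤ 1 + 10 * θ := by
      rw [inv_le_iff_one_le_mul₀ hv]
      nlinarith
    linarith
  have hupp : Real.log R ≤ Real.log (fixedFactor (4 * (a : ℝ) ^ 2) m) + 10 * θ := by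
    have e1 := Real.log_le_log hR0 h2
    rw [Real.log_mul hf.ne' (Real.exp_pos _).ne', Real.log_exp] at e1
    linarith
  have ec : (m : ℝ) ^ 3 * θ ^ 2 / (12 * n ^ 2) * (n / θ / a) ^ 2 =
      (m : ℝ) ^ 3 / (3 * (4 * (a : ℝ) ^ 2)) := by field_simp; ring
  have ed : 3 * (m : ℝ) ^ 5 * θ ^ 4 / (160 * n ^ 4) * (n / θ / a) ^ 4 =
      3 * (m : ℝ) ^ 5 / (10 * (4 * (a : ℝ) ^ 2) ^ 2) := by field_simp; ring
  rw [ec, ed]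
  refine ⟨Real.log R - ((m : ℝ) ^ 3 / (3 * (4 * (a : ℝ) ^ 2)) -
    3 * (m : ℝ) ^ 5 / (10 * (4 * (a : ℝ) ^ 2) ^ 2)), ?_, ?_⟩
  · have : θ ≤ K * θ := le_mul_of_one_le_left hθ0.le hK
    rw [abs_le] at *
    constructor <;> linarith [hlog.1, hlog.2]
  · rw [add_sub_cancel, Real.exp_log hR0, ← hR]
    field_simp

end MeanCountAsymptotics

/-! ### Collecting the exponent. -/

section LogTransform

/-- Substituting θ² ≈ 4ε + 2ε²/3 and θ⁴ ≈ 16ε² and using j²/(2Q²) ≈ 2c²/Q², the terms in sQ and s²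
match exactly. Each leftover is O(1/Q), since Q²ε³ = s³/Q. -/
theorem abs_exponent_error_le {s Q α ε θ ρ c d j D K B : ℝ} (hs : 0 < s) (hQ : 1 ≤ Q)
    (hα0 : 0 ≤ α) (hα1 : α ≤ 1) (hB : 0 ≤ B) (hK : 1 ≤ K) (hε : ε = s / Q) (hε1 : ε ≤ 1 / 2)
    (hρ : |ρ - (ε / 3 - ε ^ 2 / 45)| ≤ B * ε ^ 3)
    (hθ : |θ ^ 2 - (4 * ε + 2 / 3 * ε ^ 2)| ≤ B * ε ^ 3) (hc : c = α ^ 3 * Q ^ 2 * θ ^ 2 / 12)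
    (hcK : c ≤ K * Q) (hd : d = 3 * α ^ 5 * Q ^ 2 * θ ^ 4 / 160) (hj0 : 0 ≤ j)
    (hj : |j - 2 * c| ≤ 1)
    (hD : |D - j ^ 2 / (2 * Q ^ 2)| ≤ j / (2 * Q ^ 2) + j ^ 3 / (Q ^ 2) ^ 2) :
    |ε - (Q ^ 2 + 1) * ρ + c - d + D - (-((1 - α ^ 3) / 3 * s * Q) +
      (1 / 45 + α ^ 3 / 18 - 3 * α ^ 5 / 10 + 2 * α ^ 6 / 9) * s ^ 2)| ≤
      (2 * s + (3 * B + 2 * (8 * (1 + B) + (1 + B) ^ 2)) * s ^ 3 + 5 * K + 27 * K ^ 3) * (1 / Q) := by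
  have hQ0 : 0 < Q := by linarith
  have hε0 : 0 < ε := by rw [hε]; positivity
  have hsε : s = ε * Q := by rw [hε]; field_simp
  have hc0 : 0 ≤ c := by rw [hc]; positivity
  have hQε : Q ^ 2 * ε ^ 3 = s ^ 3 * (1 / Q) := by rw [hsε]; field_simp
  have hε3 : ε ^ 3 ≤ s ^ 3 * (1 / Q) := by
    rw [← hQε]
    exact le_mul_of_one_le_left (by positivity) (one_le_pow₀ hQ)
  obtain ⟨e₁, he₁, h₁⟩ : ∃ e, |e| ≤ B ∧ ρ - (ε / 3 - ε ^ 2 / 45) = e * ε ^ 3 :=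
    ⟨(ρ - (ε / 3 - ε ^ 2 / 45)) / ε ^ 3, by
      rwa [abs_div, abs_of_pos (by positivity : 0 < ε ^ 3), div_le_iff₀ (by positivity)],
      by field_simp⟩
  obtain ⟨e₂, he₂, h₂⟩ : ∃ e, |e| ≤ B ∧ θ ^ 2 - (4 * ε + 2 / 3 * ε ^ 2) = e * ε ^ 3 :=
    ⟨(θ ^ 2 - (4 * ε + 2 / 3 * ε ^ 2)) / ε ^ 3, by
      rwa [abs_div, abs_of_pos (by positivity : 0 < ε ^ 3), div_le_iff₀ (by positivity)],
      by field_simp⟩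
  set ζ : ℝ := 2 / 3 + e₂ * ε with hζ
  have hζB : |ζ| ≤ 1 + B := by
    refine (abs_add_le _ _).trans ?_
    rw [abs_mul, abs_of_pos hε0, abs_of_pos (by norm_num : (0 : ℝ) < 2 / 3)]
    have : |e₂| * ε ≤ B * 1 := mul_le_mul he₂ (by linarith) hε0.le hB
    linarith
  set ξ : ℝ := 8 * ζ + ζ ^ 2 * ε with hξ
  set X : ℝ := 8 * (1 + B) + (1 + B) ^ 2 with hX
  have hξX : |ξ| ≤ X := by
    refine (abs_add_le _ _).trans ?_
    rw [abs_mul, abs_mul, abs_of_pos hε0, abs_of_pos (by norm_num : (0 : ℝ) < 8), abs_pow]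
    have : |ζ| ^ 2 * ε ≤ (1 + B) ^ 2 * 1 :=
      mul_le_mul (by gcongr) (by linarith) hε0.le (by positivity)
    linarith
  have hρ' : ρ = ε / 3 - ε ^ 2 / 45 + e₁ * ε ^ 3 := by linear_combination h₁
  have hθ2 : θ ^ 2 = 4 * ε + 2 / 3 * ε ^ 2 + e₂ * ε ^ 3 := by linear_combination h₂
  have hθ4 : θ ^ 4 = 16 * ε ^ 2 + ε ^ 3 * ξ := by
    have : θ ^ 2 = 4 * ε + ζ * ε ^ 2 := by rw [hθ2, hζ]; ring
    rw [show θ ^ 4 = (θ ^ 2) ^ 2 by ring, this, hξ]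
    ring
  clear_value ξ ζ
  have hα : ∀ k : ℕ, α ^ k ≤ 1 := fun k => pow_le_one₀ hα0 hα1
  set j₀ : ℝ := j - 2 * c with hj₀
  have hjj : j ^ 2 / (2 * Q ^ 2) = 2 * c ^ 2 / Q ^ 2 + (4 * c * j₀ + j₀ ^ 2) / (2 * Q ^ 2) := by
    rw [show j = 2 * c + j₀ by rw [hj₀]; ring]
    field_simp
    ring
  have hcc : 2 * c ^ 2 / Q ^ 2 = α ^ 6 * Q ^ 2 * θ ^ 4 / 72 := by
    rw [hc]; field_simp; ring
  have hjQ : j ≤ 3 * K * Q := by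
    have h1 := (abs_le.1 hj).2
    have : 1 ≤ K * Q := one_le_mul_of_one_le_of_one_le hK hQ
    linarith
  clear_value j₀
  have hqs : 0 ≤ s ^ 3 * (1 / Q) := by positivity
  have t₁ : |2 / 3 * ε + ε ^ 2 / 45| ≤ 2 * s * (1 / Q) := by
    rw [abs_of_pos (by positivity), show 2 * s * (1 / Q) = 2 * ε by rw [hε]; ring]
    nlinarith
  have t₂ : |(Q ^ 2 + 1) * (e₁ * ε ^ 3)| ≤ 2 * B * (s ^ 3 * (1 / Q)) := by
    rw [show (Q ^ 2 + 1) * (e₁ * ε ^ 3) = e₁ * (Q ^ 2 * ε ^ 3 + ε ^ 3) by ring, abs_mul,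
      abs_of_pos (by positivity : 0 < Q ^ 2 * ε ^ 3 + ε ^ 3), hQε]
    calc _ ≤ B * (s ^ 3 * (1 / Q) + s ^ 3 * (1 / Q)) := by gcongr
      _ = _ := by ring
  have hterm : ∀ (k : ℕ) (v z Z : ℝ), 0 ≤ v → v ≤ 1 → |z| ≤ Z →
      |α ^ k * v * (Q ^ 2 * ε ^ 3 * z)| ≤ Z * (s ^ 3 * (1 / Q)) := by
    intro k v z Z hv0 hv1 hz
    rw [hQε, abs_mul, abs_mul, abs_mul, abs_of_nonneg hqs, abs_of_nonneg hv0,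
      abs_of_nonneg (pow_nonneg hα0 k)]
    calc _ ≤ 1 * 1 * (s ^ 3 * (1 / Q) * Z) := by
          gcongr
          exact hα k
      _ = _ := by ring
  have t₃ := hterm 3 (1 / 12) e₂ B (by norm_num) (by norm_num) he₂
  have t₄ := hterm 5 (3 / 160) ξ X (by norm_num) (by norm_num) hξX
  have t₅ := hterm 6 (1 / 72) ξ X (by norm_num) (by norm_num) hξX
  have t₆ : |(4 * c * j₀ + j₀ ^ 2) / (2 * Q ^ 2)| ≤ 3 * K * (1 / Q) := by
    rw [abs_div, abs_of_pos (by positivity : 0 < 2 * Q ^ 2), div_le_iff₀ (by positivity)]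
    refine (abs_add_le _ _).trans ?_
    rw [abs_mul, abs_pow, abs_of_nonneg (by positivity : 0 ≤ 4 * c)]
    have h1 : 4 * c * |j₀| ≤ 4 * (K * Q) * 1 := by gcongr
    have h2 : |j₀| ^ 2 ≤ 1 := pow_le_one₀ (abs_nonneg _) hj
    have h3 : 1 ≤ K * Q := one_le_mul_of_one_le_of_one_le hK hQ
    have h4 : 3 * K * (1 / Q) * (2 * Q ^ 2) = 6 * (K * Q) := by field_simp; ring
    linarith
  have t₇ : j / (2 * Q ^ 2) + j ^ 3 / (Q ^ 2) ^ 2 ≤ (2 * K + 27 * K ^ 3) * (1 / Q) := by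
    calc _ ≤ 3 * K * Q / (2 * Q ^ 2) + (3 * K * Q) ^ 3 / (Q ^ 2) ^ 2 := by gcongr
      _ = (3 / 2 * K + 27 * K ^ 3) * (1 / Q) := by field_simp; ring
      _ ≤ _ := by
        gcongr
        linarith
  have key : ε - (Q ^ 2 + 1) * ρ + c - d + D - (-((1 - α ^ 3) / 3 * s * Q) +
      (1 / 45 + α ^ 3 / 18 - 3 * α ^ 5 / 10 + 2 * α ^ 6 / 9) * s ^ 2) =
      (2 / 3 * ε + ε ^ 2 / 45) - (Q ^ 2 + 1) * (e₁ * ε ^ 3) +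
      α ^ 3 * (1 / 12) * (Q ^ 2 * ε ^ 3 * e₂) - α ^ 5 * (3 / 160) * (Q ^ 2 * ε ^ 3 * ξ) +
      α ^ 6 * (1 / 72) * (Q ^ 2 * ε ^ 3 * ξ) + (4 * c * j₀ + j₀ ^ 2) / (2 * Q ^ 2) +
      (D - j ^ 2 / (2 * Q ^ 2)) := by
    rw [hjj, hcc, hd, hc, hθ4, hsε, hρ', hθ2]
    ring
  rw [key]
  have hD' := hD.trans t₇
  clear_value X
  rw [show (2 * s + (3 * B + 2 * X) * s ^ 3 + 5 * K + 27 * K ^ 3) * (1 / Q) =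
    2 * s * (1 / Q) + 2 * B * (s ^ 3 * (1 / Q)) + B * (s ^ 3 * (1 / Q)) + X * (s ^ 3 * (1 / Q)) +
    X * (s ^ 3 * (1 / Q)) + 3 * K * (1 / Q) + (2 * K + 27 * K ^ 3) * (1 / Q) by ring]
  refine (abs_add_le _ _).trans (add_le_add ((abs_add_le _ _).trans (add_le_add
    ((abs_add_le _ _).trans (add_le_add ((abs_sub _ _).trans (add_le_add
    ((abs_add_le _ _).trans (add_le_add ((abs_sub _ _).trans (add_le_add t₁ t₂)) t₃)) t₄)) t₅))
    t₆)) hD')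

end LogTransform

/-! ### The Laplace transform of the peak number. -/

section Transform

theorem uniformExp_exp_pos {n : ℕ} (lam : n.Partition) (f : Equiv.Perm (Fin n) → ℝ) :
    0 < uniformExp (cycleClass lam) fun π => Real.exp (f π) := by
  have h := cycleClass_nonempty lam
  exact div_pos (Finset.sum_pos (fun π _ => Real.exp_pos _) h) (by exact_mod_cast h.card_pos)

theorem count_one_le {n : ℕ} (lam : n.Partition) : lam.parts.count 1 ≤ n := by
  have h1 : lam.parts.card • 1 ≤ lam.parts.sum :=
    Multiset.card_nsmul_le_sum fun x hx => lam.parts_pos hx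
  rw [lam.parts_sum, smul_eq_mul, mul_one] at h1
  exact (Multiset.count_le_card _ _).trans h1

/-- The generating function of `meanCount` at `t = exp (-θ)`, in terms of the Laplace transform of
the number of peaks. -/
theorem hasSum_meanCount_exp {n : ℕ} (hn : 0 < n) (lam : n.Partition) {s w θ : ℝ}
    (hw : w ^ 2 = 1 - Real.exp (-(s / √(n : ℝ)))) (hw0 : 0 < w) (hw1 : w < 1)
    (hθ : θ = Real.log ((1 + w) / (1 - w))) :
    HasSum (fun a : ℕ => n.factorial * meanCount lam a / 2 ^ n * Real.exp (-θ) ^ a)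
      (n.factorial / 2 ^ n * (Real.exp (-(s / √(n : ℝ))) / 2 * (1 / w) ^ (n + 1) *
        uniformExp (cycleClass lam) fun π => Real.exp (-(s * (peaks π : ℝ) / √(n : ℝ))))) := by
  have h1w : 0 < 1 - w := by linarith
  have ht : Real.exp (-θ) = (1 - w) / (1 + w) := by
    rw [hθ, ← Real.log_inv, inv_div, Real.exp_log (by positivity)]
  have h := meanCount_hasSum hn lam (t := Real.exp (-θ)) (Real.exp_pos _) (by
    rw [ht, div_lt_one (by linarith)]; linarith)
  have e1 : 4 * Real.exp (-θ) / (1 + Real.exp (-θ)) ^ 2 = Real.exp (-(s / √(n : ℝ))) := by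
    rw [ht, show Real.exp (-(s / √(n : ℝ))) = 1 - w ^ 2 by linarith]
    field_simp
    ring
  have e2 : (1 + Real.exp (-θ)) / (1 - Real.exp (-θ)) = 1 / w := by
    rw [ht]
    have : 1 - (1 - w) / (1 + w) = 2 * w / (1 + w) := by field_simp; ring
    rw [this]
    field_simp
    ring
  rw [e1, e2] at h
  have e3 : (fun π : Equiv.Perm (Fin n) => Real.exp (-(s / √(n : ℝ))) ^ peaks π) =
      fun π => Real.exp (-(s * (peaks π : ℝ) / √(n : ℝ))) := by
    funext π
    rw [← Real.exp_nat_mul]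
    congr 1
    ring
  rw [e3] at h
  refine (h.mul_left (n.factorial / 2 ^ n : ℝ)).congr_fun ?_
  intro a
  ring

/-- The generating function is evaluated twice, exactly through the transform and asymptotically by
`exists_laplace_bound`; taking logarithms isolates the transform. The error Kθ = O(n^{-1/4}) of the
class means dominates. -/
theorem exists_log_transform_bound {s : ℝ} (hs : 0 < s) : ∃ (C : ℝ) (n₀ : ℕ), 0 < C ∧
    ∀ n : ℕ, n₀ ≤ n → 0 < n → ∀ lam : n.Partition,
      |Real.log (uniformExp (cycleClass lam)
          fun π => Real.exp (-(s * (peaks π : ℝ) / √(n : ℝ)))) -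
        (-((1 - fixedDensity lam ^ 3) / 3 * s * √(n : ℝ)) +
          (1 / 45 + fixedDensity lam ^ 3 / 18 - 3 * fixedDensity lam ^ 5 / 10 +
            2 * fixedDensity lam ^ 6 / 9) * s ^ 2)| ≤ C * (1 / √√(n : ℝ)) := by
  obtain ⟨B, hB, hexpand⟩ := exists_artanh_expansion
  -- The summand 36s² bounds nθ⁴, hence also d, and s bounds c/√n ≤ s/2.
  set K : ℝ := 1 + 36 * s ^ 2 + s with hK
  have hK1 : 1 ≤ K := by rw [hK]; linarith [sq_nonneg s]
  obtain ⟨C₁, n₁, hC₁, hlap⟩ := exists_laplace_bound hK1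
  set C₂ : ℝ := C₁ * (1 + 5150 * K * (3 * √s) + 9 * s) with hC₂
  have hC₂0 : 0 < C₂ := by positivity
  set C₃ : ℝ := 2 * s + (3 * B + 2 * (8 * (1 + B) + (1 + B) ^ 2)) * s ^ 3 + 5 * K + 27 * K ^ 3
    with hC₃
  have hC₃0 : 0 < C₃ := by positivity
  -- Each summand secures one smallness condition once √√n ≥ R₀: a relative error at most 1/2,
  -- 5150Kθ ≤ 1, and ε(2 + B) ≤ 1.
  set R₀ : ℝ := 1 + 2 * C₂ + 5150 * K * (3 * √s) + s * (2 + B) with hR₀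
  refine ⟨C₃ + 2 * C₂, n₁ + ⌈R₀ ^ 4⌉₊, by positivity, ?_⟩
  intro n hn hn0 lam
  have hn' : (0 : ℝ) < n := by exact_mod_cast hn0
  set Q := √(n : ℝ) with hQ
  have hQ0 : 0 < Q := Real.sqrt_pos.2 hn'
  have hQ2 : Q ^ 2 = n := Real.sq_sqrt hn'.le
  set R := √Q with hR
  have hR0 : 0 < R := Real.sqrt_pos.2 hQ0
  have hR2 : R ^ 2 = Q := Real.sq_sqrt hQ0.le
  have hR₀1 : 1 ≤ R₀ := by
    have : 0 ≤ 2 * C₂ + 5150 * K * (3 * √s) + s * (2 + B) := by positivity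
    rw [hR₀]; linarith
  have hRR : R₀ ≤ R := by
    have h1 : R₀ ^ 4 ≤ R ^ 4 := by
      rw [show R ^ 4 = (R ^ 2) ^ 2 by ring, hR2, hQ2]
      refine (Nat.le_ceil _).trans ?_
      exact_mod_cast (by omega : ⌈R₀ ^ 4⌉₊ ≤ n)
    exact le_of_pow_le_pow_left₀ (by norm_num) hR0.le h1
  have hparts : 0 < C₂ ∧ 0 ≤ 5150 * K * (3 * √s) ∧ 0 ≤ s * (2 + B) :=
    ⟨hC₂0, by positivity, by positivity⟩
  obtain ⟨-, hp2, hp3⟩ := hparts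
  have hR1 : 1 ≤ R := hR₀1.trans hRR
  have hQR : R ≤ Q := by rw [← hR2]; exact le_self_pow₀ hR1 two_ne_zero
  have hQ1 : 1 ≤ Q := hR1.trans hQR
  clear_value R Q
  set ε : ℝ := s / Q with hε
  have hε0 : 0 < ε := by positivity
  have hεB : ε * (2 + B) ≤ 1 := by
    rw [hε, div_mul_eq_mul_div, div_le_one hQ0]
    linarith
  have hε2 : ε ≤ 1 / 2 := by linarith [mul_pos hε0 hB]
  set w := √(1 - Real.exp (-ε)) with hw
  set θ := Real.log ((1 + w) / (1 - w)) with hθ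
  obtain ⟨hw0, hw1, hθ0, hρ, hθ2⟩ := hexpand ε w θ hε0 hε2 hw hθ
  have hw2 : w ^ 2 = 1 - Real.exp (-ε) := by
    refine Real.sq_sqrt ?_
    linarith [Real.exp_le_one_iff.2 (neg_nonpos.2 hε0.le)]
  have hE := hasSum_meanCount_exp hn0 lam (s := s) (by rw [← hQ]; exact hw2) hw0 hw1 hθ
  rw [← hQ, ← hε] at hE
  have hEpos := uniformExp_exp_pos lam fun π => -(s * (peaks π : ℝ) / Q)
  generalize uniformExp (cycleClass lam) (fun π => Real.exp (-(s * (peaks π : ℝ) / Q))) = E at *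
  clear_value θ w
  have hθ6 : θ ^ 2 ≤ 6 * ε := by
    have h1 := (abs_le.1 hθ2).2
    have h2 : B * ε ^ 3 ≤ 1 * ε := by
      have : B * ε * ε ≤ 1 * 1 :=
        mul_le_mul (by linarith) (by linarith) hε0.le zero_le_one
      calc B * ε ^ 3 = B * ε * ε * ε := by ring
        _ ≤ 1 * 1 * ε := by gcongr
        _ = 1 * ε := by ring
    have h3 : ε * ε ≤ 1 * ε := by gcongr; linarith
    linarith
  have hθR : θ ≤ 3 * √s * (1 / R) := by
    refine le_of_sq_le_sq ?_ (by positivity)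
    rw [mul_pow, mul_pow, Real.sq_sqrt hs.le, div_pow, hR2, one_pow]
    have : (3 : ℝ) ^ 2 * s * (1 / Q) = 9 * ε := by rw [hε]; ring
    linarith
  have hη : 5150 * K * θ ≤ 1 := by
    calc 5150 * K * θ ≤ 5150 * K * (3 * √s * (1 / R)) := by gcongr
      _ = 5150 * K * (3 * √s) / R := by ring
      _ ≤ 1 := by rw [div_le_one hR0]; linarith
  have hθ16 : θ ≤ 1 / 16 := by linarith [le_mul_of_one_le_left hθ0.le hK1]
  set m := lam.parts.count 1 with hm
  have hmn : m ≤ n := count_one_le lam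
  have hα : fixedDensity lam = m / n := rfl
  rw [hα]
  set α : ℝ := m / n with hαd
  have hα0 : 0 ≤ α := by positivity
  have hα1 : α ≤ 1 := by
    rw [hαd, div_le_one hn']; exact_mod_cast hmn
  have hQε : Q * ε = s := by rw [hε]; field_simp
  have hθ4 : (n : ℝ) * θ ^ 4 ≤ 36 * s ^ 2 := by
    calc (n : ℝ) * θ ^ 4 = Q ^ 2 * (θ ^ 2) ^ 2 := by rw [hQ2]; ring
      _ ≤ Q ^ 2 * (6 * ε) ^ 2 := by gcongr
      _ = 36 * (Q * ε) ^ 2 := by ring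
      _ = _ := by rw [hQε]
  set c : ℝ := (m : ℝ) ^ 3 * θ ^ 2 / (12 * n ^ 2) with hc
  set d : ℝ := 3 * (m : ℝ) ^ 5 * θ ^ 4 / (160 * n ^ 4) with hd
  have hc' : c = α ^ 3 * Q ^ 2 * θ ^ 2 / 12 := by
    rw [hc, hαd, hQ2]; field_simp
  have hd' : d = 3 * α ^ 5 * Q ^ 2 * θ ^ 4 / 160 := by
    rw [hd, hαd, hQ2]; field_simp
  have hc0 : 0 ≤ c := by positivity
  have hd0 : 0 ≤ d := by positivity
  have hcK : c ≤ K * Q := by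
    calc c ≤ 1 * Q ^ 2 * (6 * ε) / 12 := by
          rw [hc']
          gcongr
          exact pow_le_one₀ hα0 hα1
      _ = s / 2 * Q := by rw [← hQε]; ring
      _ ≤ K * Q := by
          gcongr
          rw [hK]; linarith [sq_nonneg s]
  have hdK : d ≤ K := by
    calc d = 3 * α ^ 5 * (n * θ ^ 4) / 160 := by rw [hd', hQ2]; ring
      _ ≤ 3 * 1 * (36 * s ^ 2) / 160 := by
          gcongr
          exact pow_le_one₀ hα0 hα1
      _ ≤ K := by rw [hK]; linarith [sq_nonneg s]
  set J : ℕ := ⌊2 * c⌋₊ with hJ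
  have hJc : |(J : ℝ) - 2 * c| ≤ 1 := by
    have h1 := Nat.floor_le (by positivity : 0 ≤ 2 * c)
    have h2 := Nat.lt_floor_add_one (2 * c)
    rw [abs_le]
    constructor <;> linarith
  obtain ⟨hJn, hmain⟩ := hlap n (by omega) θ c d (5150 * K * θ) _ J
    (fun a => n.factorial * meanCount lam a / 2 ^ n) hθ0 (by linarith) hc0 (hQ ▸ hcK) hd0 hdK hJc
    (by positivity) hη
    (fun a b hab => by
      have := meanCount_mono hn0 lam hab
      simp only
      gcongr)
    (fun a => div_nonneg (mul_nonneg (by positivity) (meanCount_nonneg lam a)) (by positivity))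
    (fun a ha => meanCount_asymptotic hn0 lam hm.symm hmn hK1 hθ0 hθ16
      (hθ4.trans (by rw [hK]; linarith)) ha) hE
  rw [← hQ] at hmain
  set r := θ / (2 * w) with hr
  have hr0 : 0 < r := by positivity
  have hratio : n.factorial / 2 ^ n * (Real.exp (-ε) / 2 * (1 / w) ^ (n + 1) * E) * θ ^ (n + 1) /
      (Real.exp (c - d) * (n : ℝ) ^ J * (n - J).factorial) =
      Real.exp (-ε) * r ^ (n + 1) * E / (Real.exp (c - d) *
        ((n : ℝ) ^ J * (n - J).factorial / n.factorial)) := by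
    rw [hr, div_pow, div_pow, one_pow, mul_pow, pow_succ 2 n]
    field_simp
  rw [hratio] at hmain
  set Y := (n : ℝ) ^ J * (n - J).factorial / n.factorial with hY
  have hY0 : 0 < Y := by positivity
  clear_value r Y
  have hbound : C₁ * (1 / Q + 5150 * K * θ + θ ^ 2) ≤ C₂ * (1 / R) := by
    have h1 : 1 / Q ≤ 1 / R := by gcongr
    have h2 : θ ^ 2 ≤ 9 * s * (1 / R) := by
      calc θ ^ 2 ≤ 6 * s * (1 / Q) := by rw [hε] at hθ6; convert hθ6 using 1; ring
        _ ≤ 9 * s * (1 / R) := by gcongr; norm_num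
    have h3 : 5150 * K * θ ≤ 5150 * K * (3 * √s * (1 / R)) := by gcongr
    rw [hC₂, mul_assoc C₁]
    refine mul_le_mul_of_nonneg_left ?_ hC₁.le
    linarith
  set e := Real.exp (-ε) * r ^ (n + 1) * E / (Real.exp (c - d) * Y) - 1 with he
  have he' : |e| ≤ C₂ * (1 / R) := hmain.trans hbound
  have heh : |e| ≤ 1 / 2 := by
    refine he'.trans ?_
    rw [mul_one_div, div_le_iff₀ hR0]
    linarith
  have hlog1 : |Real.log (1 + e)| ≤ 2 * |e| := by
    have h1 := Real.abs_log_sub_add_sum_range_le (x := -e) (by rw [abs_neg]; linarith) 0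
    simp only [Finset.range_zero, Finset.sum_empty, zero_add, sub_neg_eq_add, abs_neg,
      pow_one] at h1
    refine h1.trans ?_
    rw [div_le_iff₀ (by linarith)]
    linarith [mul_le_mul_of_nonneg_left heh (abs_nonneg e)]
  have hlogE : Real.log E = (ε - (Q ^ 2 + 1) * Real.log r + c - d + Real.log Y) +
      Real.log (1 + e) := by
    have h1 : 1 + e = Real.exp (-ε) * r ^ (n + 1) * E / (Real.exp (c - d) * Y) := by
      rw [he]; ring
    rw [h1, Real.log_div (by positivity) (by positivity), Real.log_mul (by positivity) hEpos.ne',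
      Real.log_mul (by positivity) (by positivity), Real.log_mul (by positivity) hY0.ne',
      Real.log_exp, Real.log_exp, Real.log_pow, hQ2]
    push_cast
    ring
  have hD := abs_log_pow_mul_factorial_sub_le hJn hn0
  rw [← hY, ← hQ2] at hD
  have herr := abs_exponent_error_le (α := α) hs hQ1 hα0 hα1 hB.le hK1 hε hε2 hρ hθ2 hc' hcK hd'
    (Nat.cast_nonneg J) hJc hD
  rw [hlogE, add_sub_right_comm]
  refine (abs_add_le _ _).trans ?_
  have hf : C₃ * (1 / Q) ≤ C₃ * (1 / R) := by gcongr
  rw [← hC₃] at herr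
  linarith

end Transform

/-! ### The theorem. -/

theorem theorem2 (s : ℝ) (hs : 0 < s) :
    ∃ C : ℝ, 0 < C ∧ ∀ (n : ℕ), 0 < n → ∀ lam : n.Partition, ∃ E : ℝ,
      |E| ≤ C * (n : ℝ) ^ (-(1 / 4) : ℝ) ∧
      uniformExp (cycleClass lam) (fun π => Real.exp (-(s * (peaks π : ℝ) / √(n : ℝ)))) =
        Real.exp (-((1 - fixedDensity lam ^ 3) / 3 * s * √(n : ℝ)) +
          (1 / 45 + fixedDensity lam ^ 3 / 18 - 3 * fixedDensity lam ^ 5 / 10 +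
            2 * fixedDensity lam ^ 6 / 9) * s ^ 2 + E) := by
  obtain ⟨C, n₀, hC, hlarge⟩ := exists_log_transform_bound hs
  let err : (n : ℕ) → n.Partition → ℝ := fun n lam =>
    Real.log (uniformExp (cycleClass lam)
        fun π => Real.exp (-(s * (peaks π : ℝ) / √(n : ℝ)))) -
      (-((1 - fixedDensity lam ^ 3) / 3 * s * √(n : ℝ)) +
        (1 / 45 + fixedDensity lam ^ 3 / 18 - 3 * fixedDensity lam ^ 5 / 10 +
          2 * fixedDensity lam ^ 6 / 9) * s ^ 2)
  have hs0 : ∀ k : ℕ, 0 ≤ ∑ lam : k.Partition, |err k lam| * √√(k : ℝ) := fun k =>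
    Finset.sum_nonneg fun lam _ => by positivity
  -- Below `n₀` there are finitely many partitions, so their rescaled errors are simply added to the
  -- constant.
  set T := ∑ k ∈ Finset.range n₀, ∑ lam : k.Partition, |err k lam| * √√(k : ℝ) with hT
  have hT0 : 0 ≤ T := Finset.sum_nonneg fun k _ => hs0 k
  refine ⟨C + T, by positivity, fun n hn lam => ⟨err n lam, ?_, ?_⟩⟩
  · have hn' : (0 : ℝ) < n := by exact_mod_cast hn
    have hR0 : 0 < √√(n : ℝ) := Real.sqrt_pos.2 (Real.sqrt_pos.2 hn')
    have hpow : (n : ℝ) ^ (-(1 / 4) : ℝ) = 1 / √√(n : ℝ) := by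
      rw [Real.rpow_neg hn'.le, Real.sqrt_eq_rpow, Real.sqrt_eq_rpow, ← Real.rpow_mul hn'.le,
        one_div]
      norm_num
    rw [hpow]
    rcases le_or_gt n₀ n with h | h
    · refine (hlarge n h hn lam).trans ?_
      gcongr
      linarith
    · rw [mul_one_div, le_div_iff₀ hR0]
      have h1 : |err n lam| * √√(n : ℝ) ≤ ∑ lam : n.Partition, |err n lam| * √√(n : ℝ) :=
        Finset.single_le_sum (f := fun lam : n.Partition => |err n lam| * √√(n : ℝ))
          (fun lam _ => by positivity) (Finset.mem_univ lam)
      have h2 : ∑ lam : n.Partition, |err n lam| * √√(n : ℝ) ≤ T :=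
        Finset.single_le_sum (f := fun k => ∑ lam : k.Partition, |err k lam| * √√(k : ℝ))
          (fun k _ => hs0 k) (Finset.mem_range.2 h)
      linarith
  · rw [add_sub_cancel, Real.exp_log (uniformExp_exp_pos lam _)]
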